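/- Let $G$ be a compact Lie group with simple Lie algebra $\mathfrak g$, with an $\mathrm{Ad}$-invariant inner product $\langle\cdot,\cdot\rangle$ on $\mathfrak g$. Let $\eta(u,v,w)=\langle u,[v,w]\rangle$ be the Cartan 3-form on $G$, $\theta_l,\theta_r$ the left and right Maurer–Cartan forms, $D$ the closed unit disk in $\mathbb C$, and $I=[0,1]$. *The NQ-group.* Let $\widetilde{T[1]G}$ be the NQ-group with body $G$ and differential graded Lie algebra $\mathfrak g\oplus\mathfrak g[1]\oplus\mathbb R[2]$, where $\mathfrak g$ acts on $\mathfrak g[1]$ by the adjoint action, the bracket $\mathfrak g[1]\times\mathfrak g[1]\to\mathbb R[2]$ is the inner product, $\mathbb R[2]$ is central, and $Q$ is the identity $\mathfrak g[1]\to\mathfrak g$ and $0$ on $\mathfrak g\oplus\mathbb R[2]$. A map $T[1]K\to\widetilde{T[1]G}$ is a product $f\exp(\alpha+s)$ with $f:K\to G$, $\alpha\in\Omega^1(K)\otimes\mathfrak g[1]$, $s\in\Omega^2(K)\otimes\mathbb R[2]$ smooth up to the boundary; it is an NQ-map if it intertwines $d$ and $Q$. Such maps are multiplied pointwise. Two NQ-maps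 $a,b:T[1]D\to\widetilde{T[1]G}$ are homotopic rel boundary if some NQ-map $T[1](D\times I)\to\widetilde{T[1]G}$ restricts to $a$ and $b$ over $D\times\{0\}$ and $D\times\{1\}$, and its restriction to $T[1]\partial D\times T[1]I$ is the projection to $T[1]\partial D$ followed by $a|_{T[1]\partial D}$. *The standard central extension.* Let $P\subset\mathbb R$ be the group generated by the integrals $\int_{D\times I}F^*\eta$ over smooth $F:D\times I\to G$ mapping the whole boundary to $1$ (the periods of $\eta$ on 3-spheres). On pairs $(f,z)$ with $f:D\to G$ smooth and $z\in\mathbb R/P$ put $$(f,z)(g,w)=\Big(fg,\;z+w-\int_D\langle f^*\theta_l\wedge g^*\theta_r\rangle\Big),$$ and let $(f,z)\sim(f',z')$ if there is a smooth homotopy $F:D\times I\to G$ rel boundary from $f$ to $f'$ with $z'=z+\int_{D\times I}F^*\eta$. The quotient is the standard central extension $\widetilde{LG}$ by $\mathbb R/P$ of the group of those smooth loops in $G$ that extend to smooth maps $D\to G$ (all of $LG$ if $G$ is connected and simply connected). The projection is $[f,z]\mapsto f|_{\partial D}$ and the inclusion of $\mathbb R/P$ is $z\mapsto[1,z]$.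 **Claim.** The NQ-maps $T[1]D\to\widetilde{T[1]G}$ form a group, homotopy rel boundary is a congruence on it, and $\sim$ is a congruence on the group of pairs $(f,z)$. The group of homotopy classes rel boundary of NQ-maps $T[1]D\to\widetilde{T[1]G}$ is isomorphic to $\widetilde{LG}$, by $$[f\exp(\alpha+s)]\longmapsto\Big[f,\;2\int_D s \bmod P\Big].$$ This isomorphism is compatible with the restriction to loops $f|_{\partial D}$, and maps the class of an NQ-map $\exp(s)$ with $s\in\Omega^2(D)\otimes\mathbb R[2]$ to the element $2\int_D s \bmod P$ of the central subgroup $\mathbb R/P$. -/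

import Mathlib

set_option linter.unusedSectionVars false

open scoped Manifold ContDiff
open MeasureTheory
noncomputable section
namespace NQLoop

section LieGroup
variable {E : Type*} [NormedAddCommGroup E] [NormedSpace ℝ E]
  {G : Type*} [TopologicalSpace G] [ChartedSpace E G] [Group G]

instance instLieGroupMinSmoothness [LieGroup 𝓘(ℝ, E) ∞ G] :
    LieGroup 𝓘(ℝ, E) (minSmoothness ℝ 3) G :=
  LieGroup.of_le (n := ∞) (by
    rw [minSmoothness_of_isRCLikeNormedField]
    exact WithTop.coe_le_coe.2 (le_top : ((3 : ℕ∞)) ≤ ⊤))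

/-- The adjoint action of `g` on the Lie algebra `T_1 G` (which is `E` by definition). -/
def Ad (E : Type*) [NormedAddCommGroup E] [NormedSpace ℝ E] [ChartedSpace E G] (g : G) :
    E →L[ℝ] E :=
  mfderiv 𝓘(ℝ, E) 𝓘(ℝ, E) (fun x : G => g * x * g⁻¹) 1

theorem Ad_one : Ad E (1 : G) = ContinuousLinearMap.id ℝ E := by
  have : (fun x : G => (1 : G) * x * (1 : G)⁻¹) = id := by ext x; simp
  unfold Ad
  rw [this]
  exact mfderiv_id

theorem Ad_mul [LieGroup 𝓘(ℝ, E) ∞ G] (g h : G) : Ad E (g * h) = (Ad E g).comp (Ad E h) := by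
  have hs : ∀ k : G, MDifferentiable 𝓘(ℝ, E) 𝓘(ℝ, E) (fun x : G => k * x * k⁻¹) := fun k =>
    ((contMDiff_const.mul contMDiff_id).mul contMDiff_const : ContMDiff 𝓘(ℝ, E) 𝓘(ℝ, E) ∞ _).mdifferentiable
      (by simp)
  have : (fun x : G => (g * h) * x * (g * h)⁻¹)
      = (fun x : G => g * x * g⁻¹) ∘ (fun x : G => h * x * h⁻¹) := by
    ext x; simp [mul_assoc]
  unfold Ad
  rw [this]
  refine (mfderiv_comp (1 : G) (hs g _) (hs h 1)).trans ?_
  let L : G → E →L[ℝ] E := fun z => mfderiv 𝓘(ℝ, E) 𝓘(ℝ, E) (fun x : G => g * x * g⁻¹) z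
  exact congrArg (fun z : G => (L z).comp (Ad E h)) (show h * 1 * h⁻¹ = 1 by simp)

/-- The bracket of Mathlib's Lie algebra `GroupLieAlgebra` of `G` (left-invariant vector fields),
as a continuous bilinear map on the tangent space `T_1 G = E`. -/
def lieBr (E G : Type*) [NormedAddCommGroup E] [NormedSpace ℝ E] [FiniteDimensional ℝ E]
    [TopologicalSpace G] [ChartedSpace E G] [Group G] [LieGroup 𝓘(ℝ, E) ∞ G] :
    E →L[ℝ] E →L[ℝ] E :=
  LinearMap.toContinuousBilinearMap (𝕜 := ℝ) (E := E) (F := E) (G := E)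
    (LinearMap.mk₂ ℝ (M := GroupLieAlgebra 𝓘(ℝ, E) G) (Nₗ := GroupLieAlgebra 𝓘(ℝ, E) G)
      (Pₗ := GroupLieAlgebra 𝓘(ℝ, E) G) (fun u v => ⁅u, v⁆) add_lie smul_lie lie_add
      (fun c u v => lie_smul c u v))

/-- The differential at `x` of a `G`-valued map defined on `K`, read in `T_{f x} G = E`. It is only
used for maps with `f x = 1`, so that its values lie in the Lie algebra. -/
def dMap (E : Type*) [NormedAddCommGroup E] [NormedSpace ℝ E] [ChartedSpace E G] {V : Type*}
    [NormedAddCommGroup V] [NormedSpace ℝ V] (K : Set V) (f : V → G) (x : V) : V →L[ℝ] E :=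
  mfderivWithin 𝓘(ℝ, V) 𝓘(ℝ, E) f K x

/-- The pull-back `f^* θ_l` of the left Maurer-Cartan form, `v ↦ f(x)⁻¹ df(v)`, as a Lie algebra
valued 1-form on `K`. -/
def leftMC (E : Type*) [NormedAddCommGroup E] [NormedSpace ℝ E] [ChartedSpace E G] {V : Type*}
    [NormedAddCommGroup V] [NormedSpace ℝ V] (K : Set V) (f : V → G) (x : V) :
    V [⋀^Fin 1]→L[ℝ] E :=
  ContinuousAlternatingMap.ofSubsingleton ℝ V E 0 (dMap E K (fun y => (f x)⁻¹ * f y) x)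

/-- The pull-back `f^* θ_r` of the right Maurer-Cartan form, `v ↦ df(v) f(x)⁻¹`. -/
def rightMC (E : Type*) [NormedAddCommGroup E] [NormedSpace ℝ E] [ChartedSpace E G] {V : Type*}
    [NormedAddCommGroup V] [NormedSpace ℝ V] (K : Set V) (f : V → G) (x : V) :
    V [⋀^Fin 1]→L[ℝ] E :=
  ContinuousAlternatingMap.ofSubsingleton ℝ V E 0 (dMap E K (fun y => f y * (f x)⁻¹) x)

section product_rule
variable [LieGroup 𝓘(ℝ, E) ∞ G] {V : Type*} [NormedAddCommGroup V] [NormedSpace ℝ V] {K : Set V} {x : V}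

theorem dMap_mul {p q : V → G} (hK : UniqueDiffWithinAt ℝ K x)
    (hp : MDifferentiableWithinAt 𝓘(ℝ, V) 𝓘(ℝ, E) p K x)
    (hq : MDifferentiableWithinAt 𝓘(ℝ, V) 𝓘(ℝ, E) q K x) (hp1 : p x = 1) (hq1 : q x = 1) :
    dMap E K (fun y => p y * q y) x = dMap E K p x + dMap E K q x := by
  have hμ : MDifferentiable (𝓘(ℝ, E).prod 𝓘(ℝ, E)) 𝓘(ℝ, E) (fun z : G × G => z.1 * z.2) :=
    (contMDiff_mul 𝓘(ℝ, E) ∞).mdifferentiable (by simp)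
  have h1 := mfderiv_comp_mfderivWithin_of_eq (y := ((1 : G), (1 : G))) (hμ _)
    (hp.prodMk hq) hK.uniqueMDiffWithinAt (by simp [hp1, hq1])
  ext v
  have h2 := congrArg (fun (L : V →L[ℝ] E) => L v) h1
  have h3 : mfderivWithin 𝓘(ℝ, V) (𝓘(ℝ, E).prod 𝓘(ℝ, E)) (fun y => (p y, q y)) K x
      = (mfderivWithin 𝓘(ℝ, V) 𝓘(ℝ, E) p K x).prod (mfderivWithin 𝓘(ℝ, V) 𝓘(ℝ, E) q K x) :=
    mfderivWithin_prodMk hp hq hK.uniqueMDiffWithinAt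
  have h4 := mfderiv_prod_eq_add_apply (v := ((dMap E K p x v, dMap E K q x v) : E × E)) (hμ ((1 : G), (1 : G)))
  have h5 : mfderiv 𝓘(ℝ, E) 𝓘(ℝ, E) (fun z : G => z * (1 : G)) 1 = ContinuousLinearMap.id ℝ E := by
    have : (fun z : G => z * 1) = id := by ext; simp
    rw [this]; exact mfderiv_id
  have h6 : mfderiv 𝓘(ℝ, E) 𝓘(ℝ, E) (fun z : G => (1 : G) * z) 1 = ContinuousLinearMap.id ℝ E := by
    have : (fun z : G => 1 * z) = id := by ext; simp
    rw [this]; exact mfderiv_id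
  have h7 : dMap E K (fun y => p y * q y) x v =
    mfderiv (𝓘(ℝ, E).prod 𝓘(ℝ, E)) 𝓘(ℝ, E) (fun z : G × G => z.1 * z.2) ((1 : G), (1 : G)) 
     ((dMap E K p x v, dMap E K q x v) : E × E) := by
    refine h2.trans ?_
    simp only [h3]
    rfl
  rw [h7]
  refine h4.trans ?_
  simp only [h5, h6]
  rfl

theorem dMap_conj {p : V → G} (hK : UniqueDiffWithinAt ℝ K x)
    (hp : MDifferentiableWithinAt 𝓘(ℝ, V) 𝓘(ℝ, E) p K x) (hp1 : p x = 1) (g : G) :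
    dMap E K (fun y => g * p y * g⁻¹) x = (Ad E g).comp (dMap E K p x) := by
  have hs : MDifferentiable 𝓘(ℝ, E) 𝓘(ℝ, E) (fun x : G => g * x * g⁻¹) :=
    ((contMDiff_const.mul contMDiff_id).mul contMDiff_const :
      ContMDiff 𝓘(ℝ, E) 𝓘(ℝ, E) ∞ _).mdifferentiable (by simp)
  exact mfderiv_comp_mfderivWithin_of_eq (y := (1 : G)) (hs _) hp hK.uniqueMDiffWithinAt hp1

theorem mdiff_left {f : V → G} (hf : MDifferentiableWithinAt 𝓘(ℝ, V) 𝓘(ℝ, E) f K x) (g : G) :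
    MDifferentiableWithinAt 𝓘(ℝ, V) 𝓘(ℝ, E) (fun y => g * f y) K x := 
  ((contMDiff_mul_left (I := 𝓘(ℝ, E)) (n := ∞) (a := g)).mdifferentiable (by simp)).mdifferentiableAt.comp_mdifferentiableWithinAt x hf

theorem mdiff_right {f : V → G} (hf : MDifferentiableWithinAt 𝓘(ℝ, V) 𝓘(ℝ, E) f K x) (g : G) :
    MDifferentiableWithinAt 𝓘(ℝ, V) 𝓘(ℝ, E) (fun y => f y * g) K x := 
  ((contMDiff_mul_right (I := 𝓘(ℝ, E)) (n := ∞) (a := g)).mdifferentiable (by simp)).mdifferentiableAt.comp_mdifferentiableWithinAt x hf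

theorem leftMC_mul {f g : V → G} (hK : UniqueDiffWithinAt ℝ K x)
    (hf : MDifferentiableWithinAt 𝓘(ℝ, V) 𝓘(ℝ, E) f K x)
    (hg : MDifferentiableWithinAt 𝓘(ℝ, V) 𝓘(ℝ, E) g K x) :
    leftMC E K (f * g) x =
      (Ad E (g x)⁻¹).compContinuousAlternatingMap (leftMC E K f x) + leftMC E K g x := by
  have e : (fun y => ((f * g) x)⁻¹ * (f * g) y) =
      fun y => ((g x)⁻¹ * ((f x)⁻¹ * f y) * (g x)⁻¹⁻¹) * ((g x)⁻¹ * g y) := by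
    ext y; simp [mul_assoc]
  have h1 := mdiff_left hf (f x)⁻¹
  have h2 := mdiff_left hg (g x)⁻¹
  unfold leftMC
  rw [e, dMap_mul hK (mdiff_right (mdiff_left h1 _) _) h2 (by simp) (by simp),
    dMap_conj hK h1 (by simp)]
  rfl

theorem rightMC_mul {f g : V → G} (hK : UniqueDiffWithinAt ℝ K x)
    (hf : MDifferentiableWithinAt 𝓘(ℝ, V) 𝓘(ℝ, E) f K x)
    (hg : MDifferentiableWithinAt 𝓘(ℝ, V) 𝓘(ℝ, E) g K x) :
    rightMC E K (f * g) x =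
      rightMC E K f x + (Ad E (f x)).compContinuousAlternatingMap (rightMC E K g x) := by
  have e : (fun y => (f * g) y * ((f * g) x)⁻¹) =
      fun y => (f y * (f x)⁻¹) * (f x * (g y * (g x)⁻¹) * (f x)⁻¹) := by
    ext y; simp [mul_assoc]
  have h1 := mdiff_right hf (f x)⁻¹
  have h2 := mdiff_right hg (g x)⁻¹
  unfold rightMC
  rw [e, dMap_mul hK h1 (mdiff_right (mdiff_left h2 _) _) (by simp) (by simp),
    dMap_conj hK h2 (by simp)]
  rfl

theorem dMap_const (g : G) : dMap E K (fun _ => g) x = 0 := mfderivWithin_const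

theorem leftMC_one : leftMC E K (1 : V → G) x = 0 := by
  unfold leftMC
  simp only [Pi.one_apply, dMap_const]
  rfl

theorem rightMC_one : rightMC E K (1 : V → G) x = 0 := by
  unfold rightMC
  simp only [Pi.one_apply, dMap_const]
  rfl

theorem inTangentCoordinates_of_eq {p : V → G} (φ : V → V →L[ℝ] E) {x₀ x : V} (hp : p x = p x₀) :
    inTangentCoordinates 𝓘(ℝ, V) 𝓘(ℝ, E) id p φ x₀ x = φ x := by
  rw [inTangentCoordinates_eq _ _ _ (by rw [chartAt_self_eq]; trivial) (by simp [hp]), hp]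
  ext v
  simp only [ContinuousLinearMap.comp_apply]
  rw [tangentBundleCore_coordChange_model_space]
  rw [(tangentBundleCore 𝓘(ℝ, E) G).coordChange_self _ _ (by simp)]
  rfl

theorem continuousOn_dMap {h : V → V → G} (hK : UniqueDiffOn ℝ K)
    (hh : ContMDiffOn (𝓘(ℝ, V).prod 𝓘(ℝ, V)) 𝓘(ℝ, E) ∞ (Function.uncurry h) (K ×ˢ K))
    (h1 : ∀ x, h x x = 1) :
    ContinuousOn (fun x => dMap E K (h x) x) K := by
  intro x₀ hx₀
  have h2 := ((hh (x₀, x₀) ⟨hx₀, hx₀⟩).mfderivWithin (m := 0) (g := id) contMDiffWithinAt_id hx₀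
    (Set.mapsTo_id _) (by simp) hK.uniqueMDiffOn).continuousWithinAt
  refine h2.congr_of_eventuallyEq_of_mem ?_ hx₀
  filter_upwards [self_mem_nhdsWithin] with x hx
  exact (inTangentCoordinates_of_eq (fun x => dMap E K (h x) x) (by simp [h1])).symm

theorem continuousOn_leftMC {f : V → G} (hK : UniqueDiffOn ℝ K)
    (hf : ContMDiffOn 𝓘(ℝ, V) 𝓘(ℝ, E) ∞ f K) (v : Fin 1 → V) :
    ContinuousOn (fun x => leftMC E K f x v) K :=
  (continuousOn_dMap (h := fun x y => (f x)⁻¹ * f y) hK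
    ((hf.comp contMDiffOn_fst (fun z hz => hz.1)).inv.mul
      (hf.comp contMDiffOn_snd (fun z hz => hz.2))) (by simp)).clm_apply continuousOn_const

theorem continuousOn_rightMC {f : V → G} (hK : UniqueDiffOn ℝ K)
    (hf : ContMDiffOn 𝓘(ℝ, V) 𝓘(ℝ, E) ∞ f K) (v : Fin 1 → V) :
    ContinuousOn (fun x => rightMC E K f x v) K :=
  (continuousOn_dMap (h := fun x y => f y * (f x)⁻¹) hK
    ((hf.comp contMDiffOn_snd (fun z hz => hz.2)).mul
      (hf.comp contMDiffOn_fst (fun z hz => hz.1)).inv) (by simp)).clm_apply continuousOn_const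

end product_rule
end LieGroup
/-- An inner product on the Lie algebra of `G` invariant under the adjoint action of `G`. -/
structure InvariantInnerProduct (E G : Type*) [NormedAddCommGroup E] [NormedSpace ℝ E]
    [TopologicalSpace G] [ChartedSpace E G] [Group G] where
  form : E →L[ℝ] E →L[ℝ] ℝ
  symm : ∀ u v, form u v = form v u
  pos : ∀ u, u ≠ 0 → 0 < form u u
  invariant : ∀ (g : G) u v, form (Ad E g u) (Ad E g v) = form u v

section Forms
variable {V F F₁ F₂ : Type*} [NormedAddCommGroup V] [NormedSpace ℝ V]
  [NormedAddCommGroup F] [NormedSpace ℝ F] [NormedAddCommGroup F₁] [NormedSpace ℝ F₁]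
  [NormedAddCommGroup F₂] [NormedSpace ℝ F₂] {k : ℕ}

/-- The wedge product of a 1-form with a `k`-form, the values being multiplied by `b`; for 1-forms
`(α ∧ τ)(u, v) = b (α u) (τ v) - b (α v) (τ u)`. Normalized like Mathlib's exterior derivative. -/
def wedge (b : F₁ →L[ℝ] F₂ →L[ℝ] F) (α : V [⋀^Fin 1]→L[ℝ] F₁) (τ : V [⋀^Fin k]→L[ℝ] F₂) :
    V [⋀^Fin (k + 1)]→L[ℝ] F :=
  ContinuousAlternatingMap.alternatizeUncurryFin
    (((ContinuousLinearMap.compContinuousAlternatingMapCLM ℝ V F₂ F (Fin k)).flip τ).comp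
      (b.comp ((ContinuousAlternatingMap.ofSubsingleton ℝ V F₁ 0).symm α)))

theorem wedge_apply (b : F₁ →L[ℝ] F₂ →L[ℝ] F) (α : V [⋀^Fin 1]→L[ℝ] F₁)
    (τ : V [⋀^Fin k]→L[ℝ] F₂) (v : Fin (k + 1) → V) :
    wedge b α τ v = ∑ i : Fin (k + 1), (-1) ^ (i : ℕ) • b (α ![v i]) (τ (i.removeNth v)) := by
  have e : ∀ w : V, (fun _ : Fin 1 => w) = ![w] := fun w => by ext i; fin_cases i; rfl
  simp [wedge, ContinuousAlternatingMap.alternatizeUncurryFin_apply, e]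

theorem wedge_add_left (b : F₁ →L[ℝ] F₂ →L[ℝ] F) (α α' : V [⋀^Fin 1]→L[ℝ] F₁)
    (τ : V [⋀^Fin k]→L[ℝ] F₂) : wedge b (α + α') τ = wedge b α τ + wedge b α' τ := by
  ext v; simp [wedge_apply, Finset.sum_add_distrib]

theorem wedge_add_right (b : F₁ →L[ℝ] F₂ →L[ℝ] F) (α : V [⋀^Fin 1]→L[ℝ] F₁)
    (τ τ' : V [⋀^Fin k]→L[ℝ] F₂) : wedge b α (τ + τ') = wedge b α τ + wedge b α τ' := by
  ext v; simp [wedge_apply, Finset.sum_add_distrib]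

theorem wedge_zero_left (b : F₁ →L[ℝ] F₂ →L[ℝ] F) 
    (τ : V [⋀^Fin k]→L[ℝ] F₂) : wedge b 0 τ = 0 := by
  ext v; simp [wedge_apply]

theorem wedge_zero_right (b : F₁ →L[ℝ] F₂ →L[ℝ] F) (α : V [⋀^Fin 1]→L[ℝ] F₁) :
    wedge b α (0 : V [⋀^Fin k]→L[ℝ] F₂) = 0 := by
  ext v; simp [wedge_apply]

theorem wedge_neg_left (b : F₁ →L[ℝ] F₂ →L[ℝ] F) (α : V [⋀^Fin 1]→L[ℝ] F₁)
    (τ : V [⋀^Fin k]→L[ℝ] F₂) : wedge b (-α) τ = - wedge b α τ := by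
  ext v; simp [wedge_apply]

end Forms

section Ext
variable {E : Type*} [NormedAddCommGroup E] [NormedSpace ℝ E]
  {G : Type*} [TopologicalSpace G] [ChartedSpace E G] [Group G] 
  {V : Type*} [NormedAddCommGroup V] [NormedSpace ℝ V] {W : Type*} [NormedAddCommGroup W] [NormedSpace ℝ W]

theorem wedge_two (b : E →L[ℝ] E →L[ℝ] ℝ) (α β : V [⋀^Fin 1]→L[ℝ] E) (v : Fin 2 → V) :
    wedge b α β v = b (α ![v 0]) (β ![v 1]) - b (α ![v 1]) (β ![v 0]) := by
  have h0 : (0 : Fin 2).removeNth v = ![v 1] := by ext i; fin_cases i; rfl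
  have h1 : (1 : Fin 2).removeNth v = ![v 0] := by ext i; fin_cases i; rfl
  simp [wedge_apply, Fin.sum_univ_two, h0, h1, sub_eq_add_neg]

namespace InvariantInnerProduct
variable (B : InvariantInnerProduct E G)

theorem wedge_self (α : V [⋀^Fin 1]→L[ℝ] E) : wedge B.form α α = 0 := by
  ext v; rw [wedge_two, B.symm]; simp

theorem wedge_Ad (g : G) (α β : V [⋀^Fin 1]→L[ℝ] E) :
    wedge B.form ((Ad E g).compContinuousAlternatingMap α)
      ((Ad E g).compContinuousAlternatingMap β) = wedge B.form α β := by
  ext v; simp [wedge_two, B.invariant]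

end InvariantInnerProduct

/-
Let `𝔤` be the Lie algebra of `G`, and let `𝔥 = 𝔤 ⊕ 𝔤[1] ⊕ ℝ[2]` be the graded Lie algebra with
elements `u` (degree 0), `ε u` (degree -1), `c` (degree -2), for `u` in `𝔤`, with

  `[u, v] = [u, v]`, `[u, ε v] = ε [u, v]`, `[ε u, ε v] = ⟨u, v⟩ c`, `c` central,
  `Q (ε u) = u`, `Q u = 0`, `Q c = 0`.

The graded group with body `G` and Lie algebra `𝔥` is the NQ-group extension of `T[1]G`. For a
vector space `V`, its points with values in the graded algebra `Λ V^*` (functions on `V[1]`) are the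
products `g · exp (ε α + c s)` with `g` in `G` and `ε α + c s` of total degree 0 in
`𝔥_{<0} ⊗ Λ V^*`, i.e. with `α` in `𝔤 ⊗ V^*` and `s` in `Λ² V^*`.
Coefficients are written on the right, and the Koszul rule
`[x φ, y ψ] = (-1)^(|φ| |y|) [x, y] φ ψ` is used throughout. Hence

  `[ε α, ε τ] = - c ⟨α ∧ τ⟩` for `α` of form degree 1, and `[ε α, ξ] = ε [α ∧ ξ]` for `ξ` in `𝔤 ⊗ Λ`.
-/

/-- The `ℝ[2]`-component of the bracket `[ε α, ε τ]` of a 1-form `α` and a `k`-form `τ`. -/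
def oddBracket {k : ℕ} (B : InvariantInnerProduct E G) (α : V [⋀^Fin 1]→L[ℝ] E)
    (τ : V [⋀^Fin k]→L[ℝ] E) : V [⋀^Fin (k + 1)]→L[ℝ] ℝ :=
  -wedge B.form α τ

/-- The `Λ V^*`-points `body · exp (ε one + c two)` of the graded group with body `G` and Lie algebra
`𝔤 ⊕ 𝔤[1] ⊕ ℝ[2]`. -/
@[ext]
structure ExtPoint (B : InvariantInnerProduct E G) (V : Type*) [NormedAddCommGroup V]
    [NormedSpace ℝ V] where
  body : G
  one : V [⋀^Fin 1]→L[ℝ] E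
  two : V [⋀^Fin 2]→L[ℝ] ℝ

namespace ExtPoint
variable {B : InvariantInnerProduct E G}

/-- Functoriality of points in the coefficient algebra `Λ V^* → Λ W^*`, for a linear map `W → V`
(restriction of forms). -/
def comap (L : W →L[ℝ] V) (h : ExtPoint B V) : ExtPoint B W where
  body := h.body
  one := h.one.compContinuousLinearMap L
  two := h.two.compContinuousLinearMap L

instance : One (ExtPoint B V) := ⟨⟨1, 0, 0⟩⟩

/-- The product `f e^a · g e^b = (f g) · (e^{Ad(g⁻¹) a} e^b)`, with
`e^a e^b = e^{a + b + [a, b] / 2}`. -/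
instance : Mul (ExtPoint B V) := ⟨fun h h' =>
  ⟨h.body * h'.body,
   (Ad E h'.body⁻¹).compContinuousAlternatingMap h.one + h'.one,
   h.two + h'.two +
    (1 / 2 : ℝ) • oddBracket B ((Ad E h'.body⁻¹).compContinuousAlternatingMap h.one) h'.one⟩⟩

instance : Inv (ExtPoint B V) := ⟨fun h =>
  ⟨h.body⁻¹, -(Ad E h.body).compContinuousAlternatingMap h.one, -h.two⟩⟩

theorem one_def : (1 : ExtPoint B V) = ⟨1, 0, 0⟩ := rfl
theorem mul_def (h h' : ExtPoint B V) : h * h' = ⟨h.body * h'.body,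
   (Ad E h'.body⁻¹).compContinuousAlternatingMap h.one + h'.one,
   h.two + h'.two +
    (1 / 2 : ℝ) • oddBracket B ((Ad E h'.body⁻¹).compContinuousAlternatingMap h.one) h'.one⟩ := rfl
theorem inv_def (h : ExtPoint B V) : h⁻¹ =
  ⟨h.body⁻¹, -(Ad E h.body).compContinuousAlternatingMap h.one, -h.two⟩ := rfl

theorem comp_add (L : E →L[ℝ] E) (α β : V [⋀^Fin 1]→L[ℝ] E) :
    L.compContinuousAlternatingMap (α + β) =
      L.compContinuousAlternatingMap α + L.compContinuousAlternatingMap β := by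
  ext v; simp

theorem Ad_mul_comp [LieGroup 𝓘(ℝ, E) ∞ G] (g h : G) (α : V [⋀^Fin 1]→L[ℝ] E) :
    (Ad E (g * h)).compContinuousAlternatingMap α =
      (Ad E g).compContinuousAlternatingMap ((Ad E h).compContinuousAlternatingMap α) := by
  ext v; simp [Ad_mul]

theorem Ad_one_comp (α : V [⋀^Fin 1]→L[ℝ] E) :
    (Ad E (1 : G)).compContinuousAlternatingMap α = α := by
  ext v; simp [Ad_one]

instance [LieGroup 𝓘(ℝ, E) ∞ G] : Group (ExtPoint B V) where
  mul_assoc a b c := by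
    simp only [oddBracket, mul_def, comp_add, mul_inv_rev, Ad_mul_comp, wedge_add_left, wedge_add_right]
    rw [B.wedge_Ad]
    ext v
    · simp [mul_assoc]
    · simp [add_assoc]
    · simp; ring
  one_mul a := by
    have : (Ad E a.body⁻¹).compContinuousAlternatingMap (0 : V [⋀^Fin 1]→L[ℝ] E) = 0 := by ext; simp
    simp [mul_def, one_def, this, oddBracket, wedge_zero_left]
  mul_one a := by
    simp [mul_def, one_def, Ad_one_comp, oddBracket, wedge_zero_right]
  inv_mul_cancel a := by
    have : (Ad E a.body⁻¹).compContinuousAlternatingMap 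
      (-(Ad E a.body).compContinuousAlternatingMap a.one) = - a.one := by
      have h := Ad_mul_comp (V := V) a.body⁻¹ a.body a.one
      rw [inv_mul_cancel, Ad_one_comp] at h
      conv_rhs => rw [h]
      ext v; simp
    simp [mul_def, one_def, inv_def, this, oddBracket, wedge_neg_left, B.wedge_self]

end ExtPoint
end Ext

section NQ
variable {E : Type*} [NormedAddCommGroup E] [NormedSpace ℝ E] [FiniteDimensional ℝ E]
  {G : Type*} [TopologicalSpace G] [ChartedSpace E G] [Group G] [LieGroup 𝓘(ℝ, E) ∞ G]
  {V : Type*} [NormedAddCommGroup V] [NormedSpace ℝ V] (B : InvariantInnerProduct E G)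

/-- Elements of total degree 1 in `𝔥 ⊗ Λ V^*`: the components in `𝔤 ⊗ Λ¹`, `𝔤[1] ⊗ Λ²` and
`ℝ[2] ⊗ Λ³`. -/
abbrev DegOne (E V : Type*) [NormedAddCommGroup E] [NormedSpace ℝ E] [NormedAddCommGroup V]
    [NormedSpace ℝ V] : Type _ :=
  (V [⋀^Fin 1]→L[ℝ] E) × (V [⋀^Fin 2]→L[ℝ] E) × (V [⋀^Fin 3]→L[ℝ] ℝ)

/-- The bracket `[ε α + c s, X]` with `X` of degree 1 (it does not depend on `s`). -/
def adPoint (α : V [⋀^Fin 1]→L[ℝ] E) (X : DegOne E V) : DegOne E V :=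
  (0, wedge (lieBr E G) α X.1, oddBracket B α X.2.1)

variable {B}

/-- `(d - Q) a` for `a = ε α + c s`, the forms `α` and `s` being the components of `h`. By the sign
rule `d (ε α) = - ε dα`, `d (c s) = c ds`, `Q (ε α) = α`. -/
def dMinusQ (K : Set V) (h : V → ExtPoint B V) (x : V) : DegOne E V :=
  (-(h x).one, -extDerivWithin (fun y => (h y).one) K x, extDerivWithin (fun y => (h y).two) K x)

/-- The element `h⁻¹ (d h - Q h)` of `𝔥 ⊗ Λ` at `x`, where `h = f e^a`. As `Q` vanishes on `G`, it is
`e^{-ad a} (f⁻¹ df) + e^{-a} (d - Q) e^a`, with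
`e^{-a} D e^a = D a - [a, D a] / 2 + [a, [a, D a]] / 6` for a derivation `D`; further terms vanish for
degree reasons. -/
def qDefect (K : Set V) (h : V → ExtPoint B V) (x : V) : DegOne E V :=
  let ad : DegOne E V → DegOne E V := adPoint B (h x).one
  let ξ : DegOne E V := (leftMC E K (fun y => (h y).body) x, 0, 0)
  let D : DegOne E V := dMinusQ K h x
  (ξ - ad ξ + (1 / 2 : ℝ) • ad (ad ξ)) + (D - (1 / 2 : ℝ) • ad D + (1 / 6 : ℝ) • ad (ad D))

/-- A field of `Λ T_x^*K`-points, i.e. a map from `T[1]K` to the extension of `T[1]G`, is an NQ-map if it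
is smooth and intertwines `d`, the vector field `Q` of `T[1]K`, with `Q` on the target. Values outside
`K` are irrelevant. -/
structure IsNQMap (K : Set V) (h : V → ExtPoint B V) : Prop where
  smooth_body : ContMDiffOn 𝓘(ℝ, V) 𝓘(ℝ, E) ∞ (fun x => (h x).body) K
  smooth_one : ContDiffOn ℝ ∞ (fun x => (h x).one) K
  smooth_two : ContDiffOn ℝ ∞ (fun x => (h x).two) K
  q_equivariant : ∀ x ∈ K, qDefect K h x = 0

/-- The closed unit disk. -/
def disk : Set ℂ := Metric.closedBall 0 1

/-- The disk times the unit interval. -/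
def cylinder : Set (ℂ × ℝ) := disk ×ˢ Set.Icc 0 1

/-- The inclusion of the tangent line of the unit circle at `x`. -/
def circleTangent (x : ℂ) : ℝ →L[ℝ] ℂ := ContinuousLinearMap.toSpanSingleton ℝ (Complex.I * x)

/-- Homotopy rel boundary of maps from `T[1](disk)`: an NQ-map `H` on `T[1](disk × [0,1])` that
restricts to `a` and `b` on the two ends and whose restriction to `T[1](∂ disk) × T[1][0,1]` is constant
along `T[1][0,1]`, i.e. is the composition of the projection with `a` on `T[1](∂ disk)`. -/
def HomotopicRB (a b : ℂ → ExtPoint B ℂ) : Prop :=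
  ∃ H : ℂ × ℝ → ExtPoint B (ℂ × ℝ), IsNQMap cylinder H ∧
    (∀ x ∈ disk, (H (x, 0)).comap (ContinuousLinearMap.inl ℝ ℂ ℝ) = a x) ∧
    (∀ x ∈ disk, (H (x, 1)).comap (ContinuousLinearMap.inl ℝ ℂ ℝ) = b x) ∧
    ∀ x ∈ Metric.sphere (0 : ℂ) 1, ∀ t ∈ Set.Icc (0 : ℝ) 1,
      (H (x, t)).comap ((circleTangent x).prodMap (ContinuousLinearMap.id ℝ ℝ)) =
        (a x).comap ((circleTangent x).comp (ContinuousLinearMap.fst ℝ ℝ ℝ))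

variable (B) in
/-- The group of NQ-maps from `T[1](disk)` under pointwise product. It is defined as the subgroup
generated by the NQ-maps; the theorem states that these form a subgroup. -/
def NQDisks : Subgroup (ℂ → ExtPoint B ℂ) := Subgroup.closure {a | IsNQMap disk a}

variable (B) in
/-- The congruence generated by homotopy rel boundary; the theorem states that homotopy rel boundary
is itself a congruence. -/
def diskCon : Con (NQDisks B) := conGen fun a b => HomotopicRB (a : ℂ → ExtPoint B ℂ) b

variable (B) in
/-- The group of homotopy classes rel boundary of disks in the NQ-group. -/
abbrev DiskClasses : Type _ := (diskCon B).Quotient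

end NQ

section LoopGroup
variable {E : Type*} [NormedAddCommGroup E] [NormedSpace ℝ E] [FiniteDimensional ℝ E]
  {G : Type*} [TopologicalSpace G] [ChartedSpace E G] [Group G] [LieGroup 𝓘(ℝ, E) ∞ G]

theorem uniqueDiffOn_disk : UniqueDiffOn ℝ disk :=
  uniqueDiffOn_convex (convex_closedBall _ _) ⟨0, by simp [disk, interior_closedBall]⟩

variable (E G) in
/-- Maps to `G` that are smooth on the closed disk (values outside are irrelevant). -/
def SmoothDisks : Subgroup (ℂ → G) where
  carrier := {f | ContMDiffOn 𝓘(ℝ, ℂ) 𝓘(ℝ, E) ∞ f disk}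
  mul_mem' := fun hf hg => ContMDiffOn.mul hf hg
  one_mem' := contMDiffOn_const
  inv_mem' := fun hf => ContMDiffOn.inv hf

/-- `F` is a smooth homotopy rel boundary from `f` to `f'`, as maps from the disk to `G`. -/
structure IsMapHomotopyRB (E : Type*) [NormedAddCommGroup E] [NormedSpace ℝ E] [ChartedSpace E G]
   (f f' : ℂ → G) (F : ℂ × ℝ → G) : Prop where
  smooth : ContMDiffOn 𝓘(ℝ, ℂ × ℝ) 𝓘(ℝ, E) ∞ F cylinder
  start : ∀ x ∈ disk, F (x, 0) = f x
  finish : ∀ x ∈ disk, F (x, 1) = f' x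
  boundary : ∀ x ∈ Metric.sphere (0 : ℂ) 1, ∀ t ∈ Set.Icc (0 : ℝ) 1, F (x, t) = f x

variable (B : InvariantInnerProduct E G)

/-- The integral of `F^* η` over `disk × [0,1]`, where `η(u,v,w) = ⟨u,[v,w]⟩` is the Cartan 3-form. -/
def etaIntegral (F : ℂ × ℝ → G) : ℝ :=
  ∫ p in cylinder, B.form (leftMC E cylinder F p ![(1, 0)])
    (lieBr E G (leftMC E cylinder F p ![(Complex.I, 0)]) (leftMC E cylinder F p ![(0, 1)]))

/-- The spherical periods of `η`: its integrals over maps of `disk × [0,1]` to `G` that send the whole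
boundary to 1, i.e. over pointed 3-spheres. -/
def periods : AddSubgroup ℝ :=
  AddSubgroup.closure {r | ∃ F : ℂ × ℝ → G, IsMapHomotopyRB E 1 1 F ∧ r = etaIntegral B F}

/-- The integral of the 2-form `⟨f^* θ_l ∧ g^* θ_r⟩` over the disk. -/
def cocycle (f g : ℂ → G) : ℝ :=
  ∫ x in disk, wedge B.form (leftMC E disk f x) (rightMC E disk g x) ![1, Complex.I]

theorem integrable_cocycle {f g : ℂ → G} (hf : f ∈ SmoothDisks E G) (hg : g ∈ SmoothDisks E G) :
    IntegrableOn (fun x => wedge B.form (leftMC E disk f x) (rightMC E disk g x) ![1, Complex.I])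
      disk := by
  refine ContinuousOn.integrableOn_compact (isCompact_closedBall _ _) ?_
  simp only [wedge_two]
  have hl := continuousOn_leftMC uniqueDiffOn_disk hf
  have hr := continuousOn_rightMC uniqueDiffOn_disk hg
  exact ((B.form.continuous.comp_continuousOn (hl _)).clm_apply (hr _)).sub
    ((B.form.continuous.comp_continuousOn (hl _)).clm_apply (hr _))

theorem mdiff_of_mem {f : ℂ → G} (hf : f ∈ SmoothDisks E G) {x : ℂ} (hx : x ∈ disk) :
    MDifferentiableWithinAt 𝓘(ℝ, ℂ) 𝓘(ℝ, E) f disk x :=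
  (hf x hx).mdifferentiableWithinAt (by simp)

theorem cocycle_identity {f g h : ℂ → G} (hf : f ∈ SmoothDisks E G) (hg : g ∈ SmoothDisks E G)
    (hh : h ∈ SmoothDisks E G) :
    cocycle B f g + cocycle B (f * g) h = cocycle B g h + cocycle B f (g * h) := by
  unfold cocycle
  rw [← integral_add (integrable_cocycle B hf hg) (integrable_cocycle B (mul_mem hf hg) hh),
    ← integral_add (integrable_cocycle B hg hh) (integrable_cocycle B hf (mul_mem hg hh))]
  refine setIntegral_congr_fun measurableSet_closedBall fun x hx => ?_
  have hu := uniqueDiffOn_disk x hx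
  rw [leftMC_mul hu (mdiff_of_mem hf hx) (mdiff_of_mem hg hx),
    rightMC_mul hu (mdiff_of_mem hg hx) (mdiff_of_mem hh hx), wedge_add_left, wedge_add_right]
  have := B.wedge_Ad (g x) ((Ad E (g x)⁻¹).compContinuousAlternatingMap (leftMC E disk f x))
    (rightMC E disk h x)
  rw [← ExtPoint.Ad_mul_comp, mul_inv_cancel, ExtPoint.Ad_one_comp] at this
  rw [this]
  simp only [ContinuousAlternatingMap.add_apply]
  ring

theorem cocycle_one_left (g : ℂ → G) : cocycle B 1 g = 0 := by
  simp [cocycle, leftMC_one, wedge_zero_left]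

theorem cocycle_one_right (g : ℂ → G) : cocycle B g 1 = 0 := by
  simp [cocycle, rightMC_one, wedge_zero_right]

/-- The pairs `(f, z)` of a smooth map from the disk to `G` and a phase in `ℝ / periods`, with product
`(f, z) (g, w) = (f g, z + w - ∫ ⟨f^* θ_l ∧ g^* θ_r⟩)`. -/
@[ext]
structure DiskPair where
  map : SmoothDisks E G
  phase : ℝ ⧸ periods B

namespace DiskPair
variable {B}

instance : One (DiskPair B) := ⟨⟨1, 0⟩⟩

instance : Mul (DiskPair B) := ⟨fun p q =>
  ⟨p.map * q.map, p.phase + q.phase + ((-cocycle B p.map q.map : ℝ) : ℝ ⧸ periods B)⟩⟩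

instance : Inv (DiskPair B) := ⟨fun p =>
  ⟨p.map⁻¹, -p.phase + ((cocycle B ((p.map⁻¹ : SmoothDisks E G) : ℂ → G) p.map : ℝ) : ℝ ⧸ periods B)⟩⟩

theorem one_def : (1 : DiskPair B) = ⟨1, 0⟩ := rfl
theorem mul_def (p q : DiskPair B) : p * q =
  ⟨p.map * q.map, p.phase + q.phase + ((-cocycle B p.map q.map : ℝ) : ℝ ⧸ periods B)⟩ := rfl
theorem inv_def (p : DiskPair B) : p⁻¹ =
  ⟨p.map⁻¹, -p.phase + ((cocycle B ((p.map⁻¹ : SmoothDisks E G) : ℂ → G) p.map : ℝ) : ℝ ⧸ periods B)⟩ := rfl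

instance : Group (DiskPair B) where
  mul_assoc p q r := by
    have h := congrArg (fun t : ℝ => (t : ℝ ⧸ periods B))
      (cocycle_identity B p.map.2 q.map.2 r.map.2)
    simp only [QuotientAddGroup.mk_add] at h
    ext1
    · simp [mul_def, mul_assoc]
    · simp only [mul_def, Subgroup.coe_mul, QuotientAddGroup.mk_neg]
      rw [← sub_eq_zero] at h ⊢
      rw [← neg_eq_zero, ← h]
      abel
  one_mul p := by
    ext1
    · simp [mul_def, one_def]
    · simp [mul_def, one_def, cocycle_one_left]
  mul_one p := by
    ext1
    · simp [mul_def, one_def]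
    · simp [mul_def, one_def, cocycle_one_right]
  inv_mul_cancel p := by
    ext1
    · simp [mul_def, one_def, inv_def]
    · simp [mul_def, one_def, inv_def]

/-- `(f, z) ∼ (f', z')`: there is a homotopy `F` rel boundary from `f` to `f'` with `z' = z + ∫ F^* η`. -/
def Rel (p q : DiskPair B) : Prop :=
  ∃ F : ℂ × ℝ → G, IsMapHomotopyRB E (p.map : ℂ → G) (q.map : ℂ → G) F ∧
    q.phase = p.phase + ((etaIntegral B F : ℝ) : ℝ ⧸ periods B)

end DiskPair

/-- The congruence generated by this relation; the theorem states that the relation is itself a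
congruence. -/
def loopCon : Con (DiskPair B) := conGen DiskPair.Rel

/-- The standard central extension of the loop group, in its construction by disks: pairs `(f, z)`
modulo `∼`. -/
abbrev LoopExtension : Type _ := (loopCon B).Quotient

variable (E G) in
/-- The loop group: smooth maps from the circle to `G`. -/
abbrev LoopGroup : Type _ := ContMDiffMap (𝓡 1) 𝓘(ℝ, E) Circle G ∞

theorem contMDiff_circle_coe : ContMDiff (𝓡 1) 𝓘(ℝ, ℂ) ∞ (fun z : Circle => (z : ℂ)) :=
  haveI := finrank_real_complex_fact'
  (contMDiff_coe_sphere : ContMDiff (𝓡 1) 𝓘(ℝ, ℂ) ∞ ((↑) : Metric.sphere (0 : ℂ) 1 → ℂ))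

/-- Restriction to the boundary circle. -/
def DiskPair.boundary : DiskPair B →* LoopGroup E G where
  toFun p := ⟨fun z => (p.map : ℂ → G) z, 
    ContMDiffOn.comp_contMDiff p.map.2 contMDiff_circle_coe fun z => by simp [disk, z.norm_coe]⟩
  map_one' := rfl
  map_mul' _ _ := rfl

/-- The projection of the central extension to the loop group. -/
def LoopExtension.toLoop : LoopExtension B →* LoopGroup E G :=
  Con.lift (loopCon B) (DiskPair.boundary B) <| Con.conGen_le.2 fun p q ⟨F, hF, _⟩ => by
    refine (Con.ker_rel _).2 (ContMDiffMap.ext fun z => ?_)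
    have hz : (z : ℂ) ∈ Metric.sphere (0 : ℂ) 1 := by simp [z.norm_coe]
    exact (hF.boundary z hz 1 (by simp)).symm.trans
      (hF.finish z (Metric.sphere_subset_closedBall hz))

/-- The inclusion of the centre `ℝ / periods`. -/
def LoopExtension.central : Multiplicative (ℝ ⧸ periods B) →* LoopExtension B :=
  (loopCon B).mk'.comp
    { toFun := fun z => ⟨1, z.toAdd⟩
      map_one' := rfl
      map_mul' := fun z w => by
        ext1
        · simp [DiskPair.mul_def]
        · simp [DiskPair.mul_def, cocycle_one_left] }

end LoopGroup
end NQLoop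

end

set_option linter.unusedSectionVars false

noncomputable section
namespace NQLoop

/-! ### Maurer–Cartan forms, the structure equation and the adjoint action. -/

section MaurerCartan
variable {E : Type*} [NormedAddCommGroup E] [NormedSpace ℝ E]
  {G : Type*} [TopologicalSpace G] [ChartedSpace E G] [Group G] [LieGroup 𝓘(ℝ, E) ∞ G]
  {V : Type*} [NormedAddCommGroup V] [NormedSpace ℝ V] {K : Set V} {x : V}
  {W : Type*} [NormedAddCommGroup W] [NormedSpace ℝ W]

/-! Write θ for the pull-back of the left Maurer–Cartan form by the body `f`. Expanding `qDefect` by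
degree, the 𝔤-component says α = θ, the 𝔤[1]-component then vanishes by the Maurer–Cartan equation,
and the ℝ[2]-component says ds = f^*η/2 (`isNQMap_iff`). Over the disk the last condition is empty,
so an NQ-map is a smooth `f` with an arbitrary 2-form `s`. Over the cylinder `s` must be a primitive
of half the Cartan form.

That NQ-maps are closed under products is the Polyakov–Wiegmann identity (`cartanForm_mul`): the
Cartan form of `f g` differs from the sum of those of `f` and `g` by an exact term, which is the
correction to `s` in the product. Integrated over the disk and doubled, this correction is minus the
cocycle, so f exp(α + s) ↦ (f, 2∫s) is a homomorphism `toDiskPair`. Constant 2-forms show that it is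
onto.

It remains to compare the relations (`rel_toDiskPair_iff`). If two NQ-maps are homotopic, Stokes on
the cylinder gives 2∫s' = 2∫s + ∫F^*η. Conversely, a homotopy `F` of bodies lifts: integrate η/2 in
the time direction to get a 2-form on the cylinder (`exists_homotopicRB`). Its end has the right
body, and its integral is right up to a period. Each period is 2∫s of an NQ-map with trivial body
that is homotopic to 1 (`exists_of_mem_periods`), so the integral can be made exactly right.
Finally, 2-forms on the disk with equal integrals differ by dl with `l` vanishing on the boundary
tangents (`exists_curl_eq`), and adding dt ∧ l gives a homotopy (`homotopicRB_of_integral_eq`).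

Homotopies can be multiplied and inverted pointwise, so symmetry and transitivity of homotopy follow
from the group structure without gluing. The corresponding facts about ∼ are transported along the
surjection `toDiskPair`. -/

theorem contDiffOn_dMap {h : V → V → G} (hK : UniqueDiffOn ℝ K)
    (hh : ContMDiffOn (𝓘(ℝ, V).prod 𝓘(ℝ, V)) 𝓘(ℝ, E) ∞ (Function.uncurry h) (K ×ˢ K))
    (h1 : ∀ x, h x x = 1) :
    ContDiffOn ℝ ∞ (fun x => dMap E K (h x) x) K := by
  intro x₀ hx₀
  have h2 := ((hh (x₀, x₀) ⟨hx₀, hx₀⟩).mfderivWithin (m := ∞) (g := id) contMDiffWithinAt_id hx₀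
    (Set.mapsTo_id _) (by simp) hK.uniqueMDiffOn)
  refine h2.contDiffWithinAt.congr_of_mem (fun x hx => ?_) hx₀
  -- As h x x = 1 throughout, all the differentials land in one tangent space, where the tangent
  -- coordinates are the identity.
  exact (inTangentCoordinates_of_eq (fun x => dMap E K (h x) x) (by simp [h1])).symm

theorem contDiffOn_leftMC {f : V → G} (hK : UniqueDiffOn ℝ K)
    (hf : ContMDiffOn 𝓘(ℝ, V) 𝓘(ℝ, E) ∞ f K) :
    ContDiffOn ℝ ∞ (leftMC E K f) K :=
  (ContinuousAlternatingMap.ofSubsingletonLIE (ι := Fin 1) (𝕜 := ℝ) (E := V) (F := E) 0).contDiff.comp_contDiffOn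
    (contDiffOn_dMap (h := fun x y => (f x)⁻¹ * f y) hK
    ((hf.comp contMDiffOn_fst (fun z hz => hz.1)).inv.mul
      (hf.comp contMDiffOn_snd (fun z hz => hz.2))) (by simp))

theorem leftMC_apply (f : V → G) (v : Fin 1 → V) :
    leftMC E K f x v = dMap E K (fun y => (f x)⁻¹ * f y) x (v 0) := rfl

theorem leftMC_const_mul (f : V → G) (g : G) :
    leftMC E K (fun y => g * f y) = leftMC E K f := by
  funext x
  simp [leftMC, mul_assoc]

theorem leftMC_congr_of_eventuallyEq {f f' : V → G} (h : f =ᶠ[nhdsWithin x K] f') (hx : f x = f' x) :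
    leftMC E K f x = leftMC E K f' x := by
  unfold leftMC dMap
  congr 1
  refine Filter.EventuallyEq.mfderivWithin_eq ?_ (by simp [hx])
  filter_upwards [h] with y hy
  rw [hy, hx]

theorem leftMC_congr {f f' : V → G} (h : Set.EqOn f f' K) (hx : x ∈ K) :
    leftMC E K f x = leftMC E K f' x :=
  leftMC_congr_of_eventuallyEq (h.eventuallyEq_of_mem self_mem_nhdsWithin) (h hx)

theorem leftMC_comp {f : V → G} {q : W → V} {L : Set W} {y : W} (hL : UniqueDiffWithinAt ℝ L y)
    (hf : MDifferentiableWithinAt 𝓘(ℝ, V) 𝓘(ℝ, E) f K (q y))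
    (hq : DifferentiableWithinAt ℝ q L y) (hm : Set.MapsTo q L K) :
    leftMC E L (fun z => f (q z)) y =
      (leftMC E K f (q y)).compContinuousLinearMap (fderivWithin ℝ q L y) := by
  have h := mfderivWithin_comp (I := 𝓘(ℝ, W)) (I' := 𝓘(ℝ, V)) (I'' := 𝓘(ℝ, E))
    (g := fun z => (f (q y))⁻¹ * f z) y (mdiff_left hf (f (q y))⁻¹)
    hq.mdifferentiableWithinAt hm hL.uniqueMDiffWithinAt
  ext v
  simp only [ContinuousAlternatingMap.compContinuousLinearMap_apply]
  rw [leftMC_apply, leftMC_apply]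
  have h3 : mfderivWithin 𝓘(ℝ, W) 𝓘(ℝ, V) q L y = fderivWithin ℝ q L y := mfderivWithin_eq_fderivWithin
  rw [h3] at h
  exact congrArg (fun (T : W →L[ℝ] E) => T (v 0)) h

theorem leftMC_univ_of_isOpen {f : V → G} (hK : IsOpen K) (hx : x ∈ K) :
    leftMC E K f x = leftMC E Set.univ f x := by
  unfold leftMC dMap
  rw [mfderivWithin_of_isOpen hK hx, mfderivWithin_univ]

theorem leftMC_conj {f : V → G} (hK : UniqueDiffWithinAt ℝ K x)
    (hf : MDifferentiableWithinAt 𝓘(ℝ, V) 𝓘(ℝ, E) f K x) (g : G) :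
    leftMC E K (fun y => g * f y * g⁻¹) x =
      (Ad E g).compContinuousAlternatingMap (leftMC E K f x) := by
  have e : (fun y => (g * f x * g⁻¹)⁻¹ * (g * f y * g⁻¹)) = fun y => g * ((f x)⁻¹ * f y) * g⁻¹ := by
    ext y; simp [mul_assoc]
  unfold leftMC
  rw [e, dMap_conj hK (mdiff_left hf _) (by simp)]
  rfl

theorem rightMC_eq {f : V → G} (hK : UniqueDiffWithinAt ℝ K x)
    (hf : MDifferentiableWithinAt 𝓘(ℝ, V) 𝓘(ℝ, E) f K x) :
    rightMC E K f x = (Ad E (f x)).compContinuousAlternatingMap (leftMC E K f x) := by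
  have e : (fun y => f y * (f x)⁻¹) = fun y => f x * ((f x)⁻¹ * f y) * (f x)⁻¹ := by
    ext y; simp
  unfold rightMC leftMC
  rw [e, dMap_conj hK (mdiff_left hf _) (by simp)]
  rfl

theorem leftMC_inv {f : V → G} (hK : UniqueDiffWithinAt ℝ K x)
    (hf : MDifferentiableWithinAt 𝓘(ℝ, V) 𝓘(ℝ, E) f K x)
    (hf' : MDifferentiableWithinAt 𝓘(ℝ, V) 𝓘(ℝ, E) f⁻¹ K x) :
    leftMC E K f⁻¹ x = -(Ad E (f x)).compContinuousAlternatingMap (leftMC E K f x) := by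
  have h := leftMC_mul hK hf hf'
  rw [mul_inv_cancel, leftMC_one] at h
  rw [Pi.inv_apply, inv_inv] at h
  exact (neg_eq_of_add_eq_zero_right h.symm).symm

/-- The tangent space at `g` is identified with `E` by the preferred chart at `g` itself, so no
Jacobian appears when brackets at 1 are computed in that chart. -/
theorem mfderiv_extChartAt_self (g : G) :
    (mfderiv 𝓘(ℝ, E) 𝓘(ℝ, E) (extChartAt 𝓘(ℝ, E) g) g : E →L[ℝ] E) = ContinuousLinearMap.id ℝ E := by
  have e : (extChartAt 𝓘(ℝ, E) g : G → E) = chartAt E g := by simp [mfld_simps]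
  have h : (mfderiv 𝓘(ℝ, E) 𝓘(ℝ, E) (chartAt E g) g : E →L[ℝ] E) =
      tangentCoordChange 𝓘(ℝ, E) g g g :=
    mfderiv_chartAt_eq_tangentCoordChange (I := 𝓘(ℝ, E)) (x := g) (y := g) (by simp)
  let T : (G → E) → E →L[ℝ] E := fun p => mfderiv 𝓘(ℝ, E) 𝓘(ℝ, E) p g
  have h2 : (mfderiv 𝓘(ℝ, E) 𝓘(ℝ, E) (extChartAt 𝓘(ℝ, E) g) g : E →L[ℝ] E) =
      (mfderiv 𝓘(ℝ, E) 𝓘(ℝ, E) (chartAt E g) g : E →L[ℝ] E) :=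
    congrArg T e
  refine (h2.trans h).trans ?_
  ext v
  exact tangentCoordChange_self (by simp)

theorem isOpen_chart_target (g : G) : IsOpen (extChartAt 𝓘(ℝ, E) g).target :=
  isOpen_extChartAt_target g

theorem contMDiffOn_chart_symm (g : G) : ContMDiffOn 𝓘(ℝ, E) 𝓘(ℝ, E) ∞
    (extChartAt 𝓘(ℝ, E) g).symm (extChartAt 𝓘(ℝ, E) g).target :=
  contMDiffOn_extChartAt_symm g


/-- The pull-back of the left Maurer-Cartan form by the inverse of the preferred chart at `1`. -/
def chartMC (E G : Type*) [NormedAddCommGroup E] [NormedSpace ℝ E]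
    [TopologicalSpace G] [ChartedSpace E G] [Group G] : E → E [⋀^Fin 1]→L[ℝ] E :=
  leftMC E Set.univ (extChartAt 𝓘(ℝ, E) (1 : G)).symm

theorem contDiffOn_chartMC :
    ContDiffOn ℝ ∞ (chartMC E G) (extChartAt 𝓘(ℝ, E) (1 : G)).target :=
  (contDiffOn_leftMC (isOpen_chart_target 1).uniqueDiffOn (contMDiffOn_chart_symm 1)).congr
    fun _ hx => (leftMC_univ_of_isOpen (isOpen_chart_target 1) hx).symm

theorem mdifferentiableAt_chart_symm {a : E} (ha : a ∈ (extChartAt 𝓘(ℝ, E) (1 : G)).target) :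
    MDifferentiableAt 𝓘(ℝ, E) 𝓘(ℝ, E) (extChartAt 𝓘(ℝ, E) (1 : G)).symm a :=
  ((contMDiffOn_chart_symm (1 : G)).contMDiffAt ((isOpen_chart_target 1).mem_nhds ha)).mdifferentiableAt
    (by simp)

/-- The differential at `h` of the left translation by `g`, read in the preferred charts. -/
def leftTranslationD (E : Type*) [NormedAddCommGroup E] [NormedSpace ℝ E] [ChartedSpace E G]
    (g h : G) : E →L[ℝ] E :=
  mfderiv 𝓘(ℝ, E) 𝓘(ℝ, E) (fun z : G => g * z) h

/-- The differential of the inverse of the preferred chart at `1`. -/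
def chartSymmD (G : Type*) [TopologicalSpace G] [ChartedSpace E G] [Group G] (a : E) : E →L[ℝ] E :=
  mfderiv 𝓘(ℝ, E) 𝓘(ℝ, E) (extChartAt 𝓘(ℝ, E) (1 : G)).symm a

theorem leftTranslationD_one (h : G) : leftTranslationD E 1 h = ContinuousLinearMap.id ℝ E := by
  have e : (fun z : G => (1 : G) * z) = id := by ext; simp
  unfold leftTranslationD
  rw [e]
  exact mfderiv_id

theorem leftTranslationD_comp (g k h : G) :
    (leftTranslationD E g (k * h)).comp (leftTranslationD E k h) = leftTranslationD E (g * k) h := by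
  have h4 := mfderiv_comp (I := 𝓘(ℝ, E)) (I' := 𝓘(ℝ, E)) (I'' := 𝓘(ℝ, E)) h
    (g := fun z : G => g * z) (f := fun z : G => k * z)
    ((contMDiff_mul_left (I := 𝓘(ℝ, E)) (n := ∞)).mdifferentiable (by simp) _)
    ((contMDiff_mul_left (I := 𝓘(ℝ, E)) (n := ∞)).mdifferentiable (by simp) _)
  have h5 : (fun z : G => g * z) ∘ (fun z : G => k * z) = fun z => g * k * z := by
    ext; simp [mul_assoc]
  rw [h5] at h4
  exact h4.symm

theorem chartMC_apply {a : E} (ha : a ∈ (extChartAt 𝓘(ℝ, E) (1 : G)).target) (w : Fin 1 → E) :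
    chartMC E G a w = leftTranslationD E ((extChartAt 𝓘(ℝ, E) (1 : G)).symm a)⁻¹
      ((extChartAt 𝓘(ℝ, E) (1 : G)).symm a) (chartSymmD G a (w 0)) := by
  unfold chartMC
  rw [leftMC_apply]
  unfold dMap
  rw [mfderivWithin_univ]
  have h := mfderiv_comp (I := 𝓘(ℝ, E)) (I' := 𝓘(ℝ, E)) (I'' := 𝓘(ℝ, E)) a
    (g := fun z : G => ((extChartAt 𝓘(ℝ, E) (1 : G)).symm a)⁻¹ * z)
    ((contMDiff_mul_left (I := 𝓘(ℝ, E)) (n := ∞)).mdifferentiable (by simp) _)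
    (mdifferentiableAt_chart_symm ha)
  exact congrArg (fun (T : E →L[ℝ] E) => T (w 0)) h

/-- The left-invariant vector field with value `v` at `1`, in the preferred chart at `1`. -/
def chartField (G : Type*) [TopologicalSpace G] [ChartedSpace E G] [Group G] (v : E) : E → E :=
  VectorField.mpullbackWithin 𝓘(ℝ, E) 𝓘(ℝ, E) (extChartAt 𝓘(ℝ, E) (1 : G)).symm
    (mulInvariantVectorField (I := 𝓘(ℝ, E)) (G := G) v) (Set.range 𝓘(ℝ, E))

theorem chartSymmD_chartField {a : E} (ha : a ∈ (extChartAt 𝓘(ℝ, E) (1 : G)).target) (v : E) :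
    chartSymmD G a (chartField G v a) =
      leftTranslationD E ((extChartAt 𝓘(ℝ, E) (1 : G)).symm a) 1 v := by
  let M : E →L[ℝ] E := mfderivWithin 𝓘(ℝ, E) 𝓘(ℝ, E) (extChartAt 𝓘(ℝ, E) (1 : G)).symm
      (Set.range 𝓘(ℝ, E)) a
  have hi : M.IsInvertible :=
    isInvertible_mfderivWithin_extChartAt_symm (I := 𝓘(ℝ, E)) (x := (1 : G)) ha
  have h3 : M = chartSymmD G a := by
    change mfderivWithin 𝓘(ℝ, E) 𝓘(ℝ, E) (extChartAt 𝓘(ℝ, E) (1 : G)).symm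
      (Set.range 𝓘(ℝ, E)) a = _
    rw [modelWithCornersSelf_coe, Set.range_id, mfderivWithin_univ]
    rfl
  rw [← h3]
  exact hi.self_apply_inverse _

/-- Left-invariant fields pair with θ to constants; this is what makes the exterior derivative of θ
computable. -/
theorem chartMC_chartField {a : E} (ha : a ∈ (extChartAt 𝓘(ℝ, E) (1 : G)).target) (v : E) :
    chartMC E G a ![chartField G v a] = v := by
  rw [chartMC_apply ha]
  simp only [Matrix.cons_val_zero]
  rw [chartSymmD_chartField ha]
  have h := DFunLike.congr_fun (leftTranslationD_comp (E := E)
    ((extChartAt 𝓘(ℝ, E) (1 : G)).symm a)⁻¹ ((extChartAt 𝓘(ℝ, E) (1 : G)).symm a) 1) v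
  rw [mul_one, inv_mul_cancel, leftTranslationD_one] at h
  exact h

theorem chartSymmD_one : chartSymmD G (extChartAt 𝓘(ℝ, E) (1 : G) 1) = ContinuousLinearMap.id ℝ E := by
  have h := mfderivWithin_extChartAt_symm_comp_mfderiv_extChartAt' (I := 𝓘(ℝ, E))
    (mem_extChartAt_source (I := 𝓘(ℝ, E)) (1 : G))
  rw [modelWithCornersSelf_coe, Set.range_id, mfderivWithin_univ] at h
  let D : E →L[ℝ] E := mfderiv 𝓘(ℝ, E) 𝓘(ℝ, E) (extChartAt 𝓘(ℝ, E) (1 : G)) 1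
  have h2 : (chartSymmD G (extChartAt 𝓘(ℝ, E) (1 : G) 1)).comp D = ContinuousLinearMap.id ℝ E := h
  have h1 : D = ContinuousLinearMap.id ℝ E := mfderiv_extChartAt_self (1 : G)
  rwa [h1, ContinuousLinearMap.comp_id] at h2

theorem chartMC_chart_one (v : Fin 1 → E) :
    chartMC E G (extChartAt 𝓘(ℝ, E) (1 : G) 1) v = v 0 := by
  rw [chartMC_apply (mem_extChartAt_target 1), extChartAt_to_inv, chartSymmD_one, inv_one,
    leftTranslationD_one]
  rfl

variable [FiniteDimensional ℝ E]

/-- The bracket of left-invariant fields is computed in the chart at 1 and carried back by the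
differential of the chart, which is the identity there. -/
theorem lieBr_apply (u v : E) : lieBr E G u v =
    VectorField.lieBracket ℝ (chartField G u) (chartField G v) (extChartAt 𝓘(ℝ, E) (1 : G) 1) := by
  let D : E →L[ℝ] E := mfderiv 𝓘(ℝ, E) 𝓘(ℝ, E) (extChartAt 𝓘(ℝ, E) (1 : G)) 1
  have h : lieBr E G u v = D.inverse (VectorField.lieBracketWithin ℝ (chartField G u)
    (chartField G v) ((extChartAt 𝓘(ℝ, E) (1 : G)).symm ⁻¹' Set.univ ∩ Set.range 𝓘(ℝ, E))
    (extChartAt 𝓘(ℝ, E) (1 : G) 1)) := rfl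
  have h1 : D = ContinuousLinearMap.id ℝ E := mfderiv_extChartAt_self (1 : G)
  have h2 : (extChartAt 𝓘(ℝ, E) (1 : G)).symm ⁻¹' Set.univ ∩ Set.range 𝓘(ℝ, E) = Set.univ := by
    simp
  rw [h, h1, h2, VectorField.lieBracketWithin_univ, ContinuousLinearMap.inverse_id]
  rfl

theorem differentiableAt_chartField (v : E) :
    DifferentiableAt ℝ (chartField G v) (extChartAt 𝓘(ℝ, E) (1 : G) 1) := by
  have h := (mdifferentiableAt_mulInvariantVectorField (I := 𝓘(ℝ, E)) (G := G) v
    (g := 1)).mdifferentiableWithinAt (s := Set.univ)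
  have : IsManifold 𝓘(ℝ, E) 2 G := IsManifold.of_le (n := ∞) (WithTop.coe_le_coe.2 (le_top : ((2 : ℕ∞)) ≤ ⊤))
  have h2 := h.differentiableWithinAt_mpullbackWithin_vectorField
  have h3 : (extChartAt 𝓘(ℝ, E) (1 : G)).symm ⁻¹' Set.univ ∩ Set.range 𝓘(ℝ, E) = Set.univ := by
    simp
  have h4 : DifferentiableWithinAt ℝ (chartField G v)
    ((extChartAt 𝓘(ℝ, E) (1 : G)).symm ⁻¹' Set.univ ∩ Set.range 𝓘(ℝ, E))
    (extChartAt 𝓘(ℝ, E) (1 : G) 1) := h2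
  rwa [h3, differentiableWithinAt_univ] at h4

/-- In dθ(X, Y) = X θ(Y) − Y θ(X) − θ([X, Y]) for left-invariant X, Y, the first two terms
differentiate constants. -/
theorem extDeriv_chartMC (u v : E) :
    extDeriv (chartMC E G) (extChartAt 𝓘(ℝ, E) (1 : G) 1) ![u, v] = -lieBr E G u v := by
  set e := extChartAt 𝓘(ℝ, E) (1 : G) 1 with he
  have hmem : e ∈ (extChartAt 𝓘(ℝ, E) (1 : G)).target := mem_extChartAt_target 1
  have hn := (isOpen_chart_target (1 : G)).mem_nhds hmem
  have hd : DifferentiableAt ℝ (chartMC E G) e :=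
    (contDiffOn_chartMC.contDiffAt hn).differentiableAt (by simp)
  have h0 : ∀ w, chartField G w e = w := fun w => by
    have h := chartMC_chartField hmem w
    rw [chartMC_chart_one] at h
    exact h
  have h := extDeriv_apply_vectorField (V := ![chartField G u, chartField G v]) hd (by
    intro i; fin_cases i
    · exact differentiableAt_chartField u
    · exact differentiableAt_chartField v)
  have hc : ∀ w, fderiv ℝ (fun y => chartMC E G y ![chartField G w y]) e = 0 := fun w => by
    have : (fun y => chartMC E G y ![chartField G w y]) =ᶠ[nhds e] fun _ => w := by
      filter_upwards [hn] with y hy using chartMC_chartField hy w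
    rw [this.fderiv_eq]; simp
  have e1 : (fun i => ![chartField G u, chartField G v] i e) = ![u, v] := by
    ext i; fin_cases i <;> simp [h0]
  have r0 : (fun y => chartMC E G y (Fin.removeNth (0 : Fin 2)
      (fun i => ![chartField G u, chartField G v] i y))) =
      fun y => chartMC E G y ![chartField G v y] := by
    ext y; congr 1; ext j; fin_cases j; rfl
  have r1 : (fun y => chartMC E G y (Fin.removeNth (1 : Fin 2)
      (fun i => ![chartField G u, chartField G v] i y))) =
      fun y => chartMC E G y ![chartField G u y] := by
    ext y; congr 1; ext j; fin_cases j; rfl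
  rw [e1, Fin.sum_univ_two, r0, r1, hc, hc] at h
  rw [h, lieBr_apply]
  simp
  exact chartMC_chart_one _

theorem minSmoothness_two_le : minSmoothness ℝ 2 ≤ (∞ : WithTop ℕ∞) := by
  rw [minSmoothness_of_isRCLikeNormedField]
  exact WithTop.coe_le_coe.2 (le_top : (2 : ℕ∞) ≤ ⊤)

/-- The Maurer-Cartan equation `dθ = -[θ, θ]`. -/
theorem extDerivWithin_leftMC {f : V → G} (hK : UniqueDiffOn ℝ K)
    (hf : ContMDiffOn 𝓘(ℝ, V) 𝓘(ℝ, E) ∞ f K) (hx : x ∈ K) (hx' : x ∈ closure (interior K))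
    (u v : V) :
    extDerivWithin (leftMC E K f) K x ![u, v] =
      -lieBr E G (leftMC E K f x ![u]) (leftMC E K f x ![v]) := by
  let φ := extChartAt 𝓘(ℝ, E) (1 : G)
  let p : V → G := fun y => (f x)⁻¹ * f y
  let q : V → E := fun y => φ (p y)
  have hp : ContMDiffOn 𝓘(ℝ, V) 𝓘(ℝ, E) ∞ p K := contMDiffOn_const.mul hf
  have hpx : p x = 1 := by simp [p]
  have hqx : q x = φ 1 := by simp [q, hpx]
  have hsrc : ∀ᶠ y in nhdsWithin x K, p y ∈ φ.source :=
    (hp.continuousOn x hx).eventually (by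
      rw [hpx]; exact extChartAt_source_mem_nhds (I := 𝓘(ℝ, E)) (1 : G))
  have hq : ∀ y ∈ K, p y ∈ φ.source → ContDiffWithinAt ℝ ∞ q K y := fun y hy hs =>
    ((contMDiffOn_extChartAt (I := 𝓘(ℝ, E)) (x := (1 : G)) _
      (by simpa [φ] using hs)).contMDiffAt ((isOpen_extChartAt_source (I := 𝓘(ℝ, E)) (1 : G)).mem_nhds
        hs |> (by simpa [φ] using ·))
      |>.comp_contMDiffWithinAt y (hp y hy)).contDiffWithinAt
  have hmem : q x ∈ φ.target := by rw [hqx]; exact mem_extChartAt_target 1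
  have key : ∀ y ∈ K, p y ∈ φ.source → p =ᶠ[nhdsWithin y K] (fun z => φ.symm (q z)) →
      leftMC E K f y =
      (chartMC E G (q y)).compContinuousLinearMap (fderivWithin ℝ q K y) := fun y hy hs he => by
    rw [← leftMC_const_mul f (f x)⁻¹]
    change leftMC E K p y = _
    rw [leftMC_congr_of_eventuallyEq he (he.eq_of_nhdsWithin hy)]
    refine leftMC_comp (hK y hy) ?_ ((hq y hy hs).differentiableWithinAt (by simp))
      (Set.mapsTo_univ _ _)
    exact (mdifferentiableAt_chart_symm (φ.map_source hs)).mdifferentiableWithinAt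
  have he : p =ᶠ[nhdsWithin x K] (fun z => φ.symm (q z)) := by
    filter_upwards [hsrc] with y hy using (φ.left_inv hy).symm
  have he' : leftMC E K f =ᶠ[nhdsWithin x K]
      fun y => (chartMC E G (q y)).compContinuousLinearMap (fderivWithin ℝ q K y) := by
    filter_upwards [hsrc, self_mem_nhdsWithin, eventually_eventually_nhdsWithin.2 he]
      with y hy hyK hye using key y hyK hy hye
  have hsx : p x ∈ φ.source := by rw [hpx]; exact mem_extChartAt_source 1
  have hd : DifferentiableAt ℝ (chartMC E G) (q x) :=
    (contDiffOn_chartMC.contDiffAt ((isOpen_chart_target (1 : G)).mem_nhds hmem)).differentiableAt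
      (by simp)
  rw [he'.extDerivWithin_eq_of_mem hx, key x hx hsx he,
    extDerivWithin_pullback (t := Set.univ) hd.differentiableWithinAt (hq x hx hsx)
      minSmoothness_two_le hK hx' hx (Set.mapsTo_univ _ _), extDerivWithin_univ]
  simp only [ContinuousAlternatingMap.compContinuousLinearMap_apply]
  have h := extDeriv_chartMC (G := G) (fderivWithin ℝ q K x u) (fderivWithin ℝ q K x v)
  rw [hqx, chartMC_chart_one, chartMC_chart_one]
  refine Eq.trans ?_ h
  congr 1
  ext i; fin_cases i <;> rfl

theorem extDerivWithin_one_apply {F : Type*} [NormedAddCommGroup F] [NormedSpace ℝ F]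
    (τ : V → V [⋀^Fin 1]→L[ℝ] F) (u v : V) :
    extDerivWithin τ K x ![u, v] = fderivWithin ℝ τ K x u ![v] - fderivWithin ℝ τ K x v ![u] := by
  have h0 : (0 : Fin 2).removeNth ![u, v] = ![v] := by ext i; fin_cases i; rfl
  have h1 : (1 : Fin 2).removeNth ![u, v] = ![u] := by ext i; fin_cases i; rfl
  simp [extDerivWithin, ContinuousAlternatingMap.alternatizeUncurryFin_apply, Fin.sum_univ_two,
    h0, h1, sub_eq_add_neg]

theorem extDerivWithin_two_apply {F : Type*} [NormedAddCommGroup F] [NormedSpace ℝ F]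
    (τ : V → V [⋀^Fin 2]→L[ℝ] F) (u v w : V) :
    extDerivWithin τ K x ![u, v, w] = fderivWithin ℝ τ K x u ![v, w]
      - fderivWithin ℝ τ K x v ![u, w] + fderivWithin ℝ τ K x w ![u, v] := by
  have h0 : (0 : Fin 3).removeNth ![u, v, w] = ![v, w] := by ext i; fin_cases i <;> rfl
  have h1 : (1 : Fin 3).removeNth ![u, v, w] = ![u, w] := by ext i; fin_cases i <;> rfl
  have h2 : (2 : Fin 3).removeNth ![u, v, w] = ![u, v] := by ext i; fin_cases i <;> rfl
  simp [extDerivWithin, ContinuousAlternatingMap.alternatizeUncurryFin_apply, Fin.sum_univ_three,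
    h0, h1, h2, sub_eq_add_neg]

theorem lieBr_skew (u v : E) : lieBr E G u v = -lieBr E G v u :=
  (lie_skew (L := GroupLieAlgebra 𝓘(ℝ, E) G) u v).symm

theorem contMDiffOn_chart_symm_mdiff {a : E} (ha : a ∈ (extChartAt 𝓘(ℝ, E) (1 : G)).target) :
    MDifferentiableWithinAt 𝓘(ℝ, E) 𝓘(ℝ, E) (extChartAt 𝓘(ℝ, E) (1 : G)).symm
      (extChartAt 𝓘(ℝ, E) (1 : G)).target a :=
  (mdifferentiableAt_chart_symm ha).mdifferentiableWithinAt

/-- Conjugating a map by `g` applies `Ad g` to its Maurer–Cartan form. The structure equation holds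
for the inverse chart and for its conjugate; comparing the two at the base point gives the claim. -/
theorem Ad_lieBr (g : G) (u v : E) : Ad E g (lieBr E G u v) = lieBr E G (Ad E g u) (Ad E g v) := by
  let T := (extChartAt 𝓘(ℝ, E) (1 : G)).target
  let φ := (extChartAt 𝓘(ℝ, E) (1 : G)).symm
  set e := extChartAt 𝓘(ℝ, E) (1 : G) 1 with he
  have hT : IsOpen T := isOpen_chart_target 1
  have hφ : ContMDiffOn 𝓘(ℝ, E) 𝓘(ℝ, E) ∞ φ T := contMDiffOn_chart_symm 1
  have heT : e ∈ T := mem_extChartAt_target 1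
  have hcl : e ∈ closure (interior T) := by rw [hT.interior_eq]; exact subset_closure heT
  have h1 : leftMC E T φ e = chartMC E G e := leftMC_univ_of_isOpen hT heT
  have hd : DifferentiableWithinAt ℝ (leftMC E T φ) T e :=
    (contDiffOn_leftMC hT.uniqueDiffOn hφ e heT).differentiableWithinAt (by simp)
  have h2 : Set.EqOn (leftMC E T (fun y => g * φ y * g⁻¹))
      (fun y => (Ad E g).compContinuousAlternatingMapCLM ℝ E E E (Fin 1) (leftMC E T φ y)) T :=
    fun y hy => leftMC_conj (hT.uniqueDiffOn y hy) (contMDiffOn_chart_symm_mdiff hy) g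
  have m1 := extDerivWithin_leftMC hT.uniqueDiffOn hφ heT hcl u v
  have hφ' : ContMDiffOn 𝓘(ℝ, E) 𝓘(ℝ, E) ∞ (fun y => g * φ y * g⁻¹) T :=
    (contMDiffOn_const.mul hφ).mul contMDiffOn_const
  have m2 := extDerivWithin_leftMC hT.uniqueDiffOn hφ' heT hcl u v
  have h3 := ((((Ad E g).compContinuousAlternatingMapCLM ℝ E E E (Fin 1)).hasFDerivAt).comp_hasFDerivWithinAt e hd.hasFDerivWithinAt).fderivWithin (hT.uniqueDiffOn e heT)
  rw [extDerivWithin_congr' h2 heT, h2 heT, extDerivWithin_one_apply] at m2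
  rw [extDerivWithin_one_apply, h1, chartMC_chart_one, chartMC_chart_one] at m1
  change fderivWithin ℝ (fun y => (Ad E g).compContinuousAlternatingMapCLM ℝ E E E (Fin 1)
    (leftMC E T φ y)) T e = _ at h3
  beta_reduce at m2
  rw [h3, h1] at m2
  change Ad E g (fderivWithin ℝ (leftMC E T φ) T e u ![v]) -
    Ad E g (fderivWithin ℝ (leftMC E T φ) T e v ![u]) =
    -lieBr E G (Ad E g (chartMC E G e ![u])) (Ad E g (chartMC E G e ![v])) at m2
  rw [← map_sub, m1, map_neg, chartMC_chart_one, chartMC_chart_one] at m2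
  exact neg_injective m2

/-- This is the structure equation for (a, b) ↦ φ(a) φ(b), whose form is Ad(φ(b)⁻¹) θ_a + θ_b,
evaluated at the base point on (w, 0) and (0, u). -/
theorem hasDerivAt_Ad (u w : E) :
    HasDerivAt (fun s : ℝ => Ad E ((extChartAt 𝓘(ℝ, E) (1 : G)).symm
      (extChartAt 𝓘(ℝ, E) (1 : G) 1 + s • u))⁻¹ w) (lieBr E G w u) 0 := by
  let T := (extChartAt 𝓘(ℝ, E) (1 : G)).target
  let φ := (extChartAt 𝓘(ℝ, E) (1 : G)).symm
  set e := extChartAt 𝓘(ℝ, E) (1 : G) 1 with he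
  have hT : IsOpen T := isOpen_chart_target 1
  have hT2 : IsOpen (T ×ˢ T) := hT.prod hT
  have hφ : ContMDiffOn 𝓘(ℝ, E) 𝓘(ℝ, E) ∞ φ T := contMDiffOn_chart_symm 1
  have heT : e ∈ T := mem_extChartAt_target 1
  have he2 : ((e, e) : E × E) ∈ T ×ˢ T := ⟨heT, heT⟩
  have hcl : (e, e) ∈ closure (interior (T ×ˢ T)) := by
    rw [hT2.interior_eq]; exact subset_closure he2
  have hfst : ContMDiffOn 𝓘(ℝ, E × E) 𝓘(ℝ, E) ∞ (fun z : E × E => φ z.1) (T ×ˢ T) :=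
    hφ.comp contDiff_fst.contMDiff.contMDiffOn (fun z hz => hz.1)
  have hsnd : ContMDiffOn 𝓘(ℝ, E × E) 𝓘(ℝ, E) ∞ (fun z : E × E => φ z.2) (T ×ˢ T) :=
    hφ.comp contDiff_snd.contMDiff.contMDiffOn (fun z hz => hz.2)
  let Θ := leftMC E (T ×ˢ T) ((fun z : E × E => φ z.1) * (fun z : E × E => φ z.2))
  have hΘ : ∀ z ∈ T ×ˢ T, ∀ v : Fin 1 → E × E, Θ z v =
      Ad E (φ z.2)⁻¹ (chartMC E G z.1 (Prod.fst ∘ v)) + chartMC E G z.2 (Prod.snd ∘ v) := by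
    intro z hz v
    have hu : UniqueDiffWithinAt ℝ (T ×ˢ T) z := hT2.uniqueDiffOn z hz
    have e1 := leftMC_comp (f := φ) (K := T) (q := fun z : E × E => z.1) hu
      (contMDiffOn_chart_symm_mdiff hz.1) differentiableWithinAt_fst (fun z hz => hz.1)
    have e2 := leftMC_comp (f := φ) (K := T) (q := fun z : E × E => z.2) hu
      (contMDiffOn_chart_symm_mdiff hz.2) differentiableWithinAt_snd (fun z hz => hz.2)
    change leftMC E _ _ z v = _
    rw [leftMC_mul hu ((hfst z hz).mdifferentiableWithinAt (by simp))
      ((hsnd z hz).mdifferentiableWithinAt (by simp)),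
      e1,
      e2, leftMC_univ_of_isOpen hT hz.1, leftMC_univ_of_isOpen hT hz.2,
      fderivWithin_fst hu, fderivWithin_snd hu]
    rfl
  have m := extDerivWithin_leftMC hT2.uniqueDiffOn (hfst.mul hsnd) he2 hcl (w, 0) (0, u)
  change extDerivWithin Θ _ _ _ = -lieBr E G (Θ _ _) (Θ _ _) at m
  rw [extDerivWithin_one_apply, hΘ _ he2, hΘ _ he2] at m
  have hd : HasFDerivAt Θ (fderivWithin ℝ Θ (T ×ˢ T) (e, e)) (e, e) :=
    ((contDiffOn_leftMC hT2.uniqueDiffOn (hfst.mul hsnd) _ he2).differentiableWithinAt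
      (by simp)).hasFDerivWithinAt.hasFDerivAt (hT2.mem_nhds he2)
  have hline : ∀ v z : E × E, HasDerivAt (fun s : ℝ => Θ ((e, e) + s • v) ![z])
      (fderivWithin ℝ Θ (T ×ˢ T) (e, e) v ![z]) 0 := fun v z => by
    have h1 : HasDerivAt (fun s : ℝ => ((e, e) : E × E) + s • v) v 0 := by
      simpa using ((hasDerivAt_id (0 : ℝ)).smul_const v).const_add ((e, e) : E × E)
    have h2 := HasFDerivAt.comp_hasDerivAt (f := fun s : ℝ => ((e, e) : E × E) + s • v) 0
      (by simpa using hd) h1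
    exact ((ContinuousAlternatingMap.apply ℝ (E × E) E ![z]).hasFDerivAt.comp_hasDerivAt 0 h2 :)
  have hev : ∀ v : E × E, ∀ᶠ s : ℝ in nhds 0, (e, e) + s • v ∈ T ×ˢ T := fun v => by
    have hc : ContinuousAt (fun s : ℝ => ((e, e) : E × E) + s • v) 0 := by fun_prop
    exact hc.eventually_mem (by simpa using hT2.mem_nhds he2)
  -- Along the first factor the form on (0, u) is θ_b(u), which does not depend on the first
  -- variable.
  have d1 : fderivWithin ℝ Θ (T ×ˢ T) (e, e) (w, 0) ![(0, u)] = 0 := by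
    have h1 : HasDerivAt (fun s : ℝ => Θ ((e, e) + s • (w, (0 : E))) ![(0, u)]) 0 0 := by
      refine (hasDerivAt_const (0 : ℝ) u).congr_of_eventuallyEq ?_
      filter_upwards [hev (w, 0)] with s hs
      rw [hΘ _ hs]
      have a1 : (Prod.fst ∘ ![((0 : E), u)]) = 0 := by ext i; fin_cases i; rfl
      rw [a1]
      simp [chartMC_chart_one, e, -extChartAt]
    exact (hline _ _).unique h1
  have d2 : HasDerivAt (fun s : ℝ => Ad E (φ (e + s • u))⁻¹ w)
      (fderivWithin ℝ Θ (T ×ˢ T) (e, e) (0, u) ![(w, 0)]) 0 := by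
    refine (hline (0, u) (w, 0)).congr_of_eventuallyEq ?_
    filter_upwards [hev (0, u)] with s hs
    rw [hΘ _ hs]
    have a1 : (Prod.snd ∘ ![(w, (0 : E))]) = 0 := by ext i; fin_cases i; rfl
    rw [a1]
    simp [chartMC_chart_one, e, -extChartAt]
  rw [d1, zero_sub] at m
  have m2 := neg_injective m
  rw [m2] at d2
  have a1 : (Prod.snd ∘ ![(w, (0 : E))]) = 0 := by ext i; fin_cases i; rfl
  have a2 : (Prod.fst ∘ ![((0 : E), u)]) = 0 := by ext i; fin_cases i; rfl
  have a3 : φ e = 1 := extChartAt_to_inv 1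
  convert d2 using 1
  rw [a1, a2, a3, inv_one, Ad_one]
  simp [chartMC_chart_one, e, -extChartAt]

/-- Differentiate the invariance of the inner product under Ad along a curve through 1 with velocity
`v`. -/
theorem form_lieBr (B : InvariantInnerProduct E G) (u v w : E) :
    B.form (lieBr E G u v) w = B.form u (lieBr E G v w) := by
  have h1 := (B.form.hasFDerivAt.comp_hasDerivAt 0 (hasDerivAt_Ad (G := G) v u)).clm_apply
    (hasDerivAt_Ad (G := G) v w)
  have h2 : HasDerivAt (fun _ : ℝ => B.form u w) 0 0 := hasDerivAt_const _ _
  have h3 := h1.unique (by simpa [Function.comp_def, B.invariant] using h2)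
  simp only [Function.comp_apply, zero_smul, add_zero, extChartAt_to_inv, inv_one, Ad_one] at h3
  simp only [ContinuousLinearMap.id_apply] at h3
  rw [lieBr_skew v w, map_neg]
  linarith

end MaurerCartan

/-! ### Leibniz rules for wedge products. -/

section WedgeCalculus
variable {V F F₁ F₂ : Type*} [NormedAddCommGroup V] [NormedSpace ℝ V]
  [NormedAddCommGroup F] [NormedSpace ℝ F] [NormedAddCommGroup F₁] [NormedSpace ℝ F₁]
  [NormedAddCommGroup F₂] [NormedSpace ℝ F₂] {k : ℕ} {K : Set V} {x : V}

theorem wedge_neg_right (b : F₁ →L[ℝ] F₂ →L[ℝ] F) (α : V [⋀^Fin 1]→L[ℝ] F₁)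
    (τ : V [⋀^Fin k]→L[ℝ] F₂) : wedge b α (-τ) = - wedge b α τ := by
  ext v; simp [wedge_apply]

theorem wedge_smul_right (b : F₁ →L[ℝ] F₂ →L[ℝ] F) (c : ℝ) (α : V [⋀^Fin 1]→L[ℝ] F₁)
    (τ : V [⋀^Fin k]→L[ℝ] F₂) : wedge b α (c • τ) = c • wedge b α τ := by
  ext v
  simp only [wedge_apply, ContinuousAlternatingMap.smul_apply, map_smul, Finset.smul_sum]
  exact Finset.sum_congr rfl fun i _ => smul_comm _ _ _

theorem wedge_pair_apply (b : F₁ →L[ℝ] F₂ →L[ℝ] F) (α : V [⋀^Fin 1]→L[ℝ] F₁)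
    (β : V [⋀^Fin 1]→L[ℝ] F₂) (u v : V) :
    wedge b α β ![u, v] = b (α ![u]) (β ![v]) - b (α ![v]) (β ![u]) := by
  have h0 : (0 : Fin 2).removeNth ![u, v] = ![v] := by ext i; fin_cases i; rfl
  have h1 : (1 : Fin 2).removeNth ![u, v] = ![u] := by ext i; fin_cases i; rfl
  simp [wedge_apply, Fin.sum_univ_two, h0, h1, sub_eq_add_neg]

theorem wedge_triple_apply (b : F₁ →L[ℝ] F₂ →L[ℝ] F) (α : V [⋀^Fin 1]→L[ℝ] F₁)
    (β : V [⋀^Fin 2]→L[ℝ] F₂) (u v w : V) :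
    wedge b α β ![u, v, w] =
      b (α ![u]) (β ![v, w]) - b (α ![v]) (β ![u, w]) + b (α ![w]) (β ![u, v]) := by
  have h0 : (0 : Fin 3).removeNth ![u, v, w] = ![v, w] := by ext i; fin_cases i <;> rfl
  have h1 : (1 : Fin 3).removeNth ![u, v, w] = ![u, w] := by ext i; fin_cases i <;> rfl
  have h2 : (2 : Fin 3).removeNth ![u, v, w] = ![u, v] := by ext i; fin_cases i <;> rfl
  simp [wedge_apply, Fin.sum_univ_three, h0, h1, h2, sub_eq_add_neg]

theorem contDiffOn_wedge (b : F₁ →L[ℝ] F₂ →L[ℝ] F) {σ : V → V [⋀^Fin 1]→L[ℝ] F₁}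
    {τ : V → V [⋀^Fin k]→L[ℝ] F₂} {n : WithTop ℕ∞} (hσ : ContDiffOn ℝ n σ K)
    (hτ : ContDiffOn ℝ n τ K) : ContDiffOn ℝ n (fun y => wedge b (σ y) (τ y)) K := by
  have h1 : ContDiffOn ℝ n (fun y =>
      (ContinuousAlternatingMap.ofSubsingleton ℝ V F₁ (0 : Fin 1)).symm (σ y)) K :=
    (ContinuousAlternatingMap.ofSubsingletonLIE (ι := Fin 1) (𝕜 := ℝ) (E := V) (F := F₁)
      0).symm.contDiff.comp_contDiffOn hσ
  have h2 : ContDiffOn ℝ n (fun y =>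
      ((ContinuousLinearMap.compContinuousAlternatingMapCLM ℝ V F₂ F (Fin k)).flip (τ y))) K :=
    (ContinuousLinearMap.contDiff _).comp_contDiffOn hτ
  exact (ContinuousAlternatingMap.alternatizeUncurryFinCLM ℝ V F).contDiff.comp_contDiffOn
    (h2.clm_comp (contDiffOn_const.clm_comp h1))

theorem hasFDerivWithinAt_alternating_apply {ρ : V → V [⋀^Fin k]→L[ℝ] F}
    {ρ' : V →L[ℝ] V [⋀^Fin k]→L[ℝ] F} (h : HasFDerivWithinAt ρ ρ' K x) (z : Fin k → V) :
    HasFDerivWithinAt (fun y => ρ y z) ((ContinuousAlternatingMap.apply ℝ V F z).comp ρ') K x :=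
  (ContinuousAlternatingMap.apply ℝ V F z).hasFDerivAt.comp_hasFDerivWithinAt x h

theorem fderivWithin_wedge_pair (b : F₁ →L[ℝ] F₂ →L[ℝ] F) {σ : V → V [⋀^Fin 1]→L[ℝ] F₁}
    {τ : V → V [⋀^Fin 1]→L[ℝ] F₂} (hK : UniqueDiffOn ℝ K) (hx : x ∈ K)
    (hσ : ContDiffOn ℝ ∞ σ K) (hτ : ContDiffOn ℝ ∞ τ K) (u v w : V) :
    fderivWithin ℝ (fun y => wedge b (σ y) (τ y)) K x u ![v, w] =
      b (fderivWithin ℝ σ K x u ![v]) (τ x ![w]) + b (σ x ![v]) (fderivWithin ℝ τ K x u ![w])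
      - (b (fderivWithin ℝ σ K x u ![w]) (τ x ![v]) +
        b (σ x ![w]) (fderivWithin ℝ τ K x u ![v])) := by
  have hd := (contDiffOn_wedge b hσ hτ).differentiableOn (by simp) x hx
  have hs := (hσ.differentiableOn (by simp) x hx).hasFDerivWithinAt
  have ht := (hτ.differentiableOn (by simp) x hx).hasFDerivWithinAt
  have hb : ∀ z z' : V, HasFDerivWithinAt (fun y => b (σ y ![z]) (τ y ![z'])) _ K x := fun z z' =>
    (b.hasFDerivAt.comp_hasFDerivWithinAt x (hasFDerivWithinAt_alternating_apply hs ![z])).clm_apply (hasFDerivWithinAt_alternating_apply ht ![z'])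
  have h1 := hasFDerivWithinAt_alternating_apply hd.hasFDerivWithinAt ![v, w]
  simp only [wedge_pair_apply] at h1
  have h2 := (hK x hx).eq h1 ((hb v w).sub (hb w v))
  have h3 := DFunLike.congr_fun h2 u
  refine h3.trans ?_
  simp
  abel

/-- Since `wedge` takes the 1-form first, dσ ∧ τ is written as τ ∧ dσ with the flipped pairing.
There is no sign because dσ has even degree. -/
theorem extDerivWithin_wedge_pair (b : F₁ →L[ℝ] F₂ →L[ℝ] F) {σ : V → V [⋀^Fin 1]→L[ℝ] F₁}
    {τ : V → V [⋀^Fin 1]→L[ℝ] F₂} (hK : UniqueDiffOn ℝ K) (hx : x ∈ K)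
    (hσ : ContDiffOn ℝ ∞ σ K) (hτ : ContDiffOn ℝ ∞ τ K) (u v w : V) :
    extDerivWithin (fun y => wedge b (σ y) (τ y)) K x ![u, v, w] =
      wedge b.flip (τ x) (extDerivWithin σ K x) ![u, v, w] -
        wedge b (σ x) (extDerivWithin τ K x) ![u, v, w] := by
  simp only [extDerivWithin_two_apply, fderivWithin_wedge_pair b hK hx hσ hτ, wedge_triple_apply,
    extDerivWithin_one_apply, map_sub, ContinuousLinearMap.flip_apply]
  abel

theorem ContinuousAlternatingMap.ext_triple {α β : V [⋀^Fin 3]→L[ℝ] F}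
    (h : ∀ u v w, α ![u, v, w] = β ![u, v, w]) : α = β := by
  ext z
  have : z = ![z 0, z 1, z 2] := by ext i; fin_cases i <;> rfl
  rw [this, h]

theorem ContinuousAlternatingMap.ext_pair {α β : V [⋀^Fin 2]→L[ℝ] F}
    (h : ∀ u v, α ![u, v] = β ![u, v]) : α = β := by
  ext z
  have : z = ![z 0, z 1] := by ext i; fin_cases i <;> rfl
  rw [this, h]

end WedgeCalculus

/-! ### Normal form of NQ-maps, and their products, inverses and pull-backs. -/

section NormalForm
variable {E : Type*} [NormedAddCommGroup E] [NormedSpace ℝ E] [FiniteDimensional ℝ E]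
  {G : Type*} [TopologicalSpace G] [ChartedSpace E G] [Group G] [LieGroup 𝓘(ℝ, E) ∞ G]
  {V : Type*} [NormedAddCommGroup V] [NormedSpace ℝ V] {B : InvariantInnerProduct E G}
  {K : Set V} {x : V}
  {W : Type*} [NormedAddCommGroup W] [NormedSpace ℝ W]

variable (B) in
/-- The 3-form `⟨α ∧ [α ∧ α]⟩`, with values `6 ⟨α u, [α v, α w]⟩`. -/
def cartanForm (α : V [⋀^Fin 1]→L[ℝ] E) : V [⋀^Fin 3]→L[ℝ] ℝ :=
  wedge B.form α (wedge (lieBr E G) α α)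

theorem form_lieBr_cycle (u v w : E) :
    B.form u (lieBr E G v w) = B.form v (lieBr E G w u) := by
  rw [← form_lieBr, B.symm, ← form_lieBr, B.symm]

theorem form_lieBr_swap (u v w : E) :
    B.form u (lieBr E G v w) = - B.form u (lieBr E G w v) := by
  rw [lieBr_skew, map_neg]

/-- By invariance ⟨u, [v, w]⟩ is totally antisymmetric, so the six terms of the two wedges coincide.
-/
theorem cartanForm_apply (α : V [⋀^Fin 1]→L[ℝ] E) (u v w : V) :
    cartanForm B α ![u, v, w] = 6 * B.form (α ![u]) (lieBr E G (α ![v]) (α ![w])) := by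
  rw [cartanForm, wedge_triple_apply]
  simp only [wedge_pair_apply, map_sub]
  have h1 := form_lieBr_swap (B := B) (α ![u]) (α ![v]) (α ![w])
  have h2 := form_lieBr_cycle (B := B) (α ![u]) (α ![v]) (α ![w])
  have h3 := form_lieBr_cycle (B := B) (α ![v]) (α ![w]) (α ![u])
  have h4 := form_lieBr_cycle (B := B) (α ![u]) (α ![w]) (α ![v])
  have h5 := form_lieBr_cycle (B := B) (α ![w]) (α ![v]) (α ![u])
  linarith

/-- The factor 1/2 appears because [θ ∧ θ](u, v) = 2 [θ u, θ v]. -/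
theorem extDerivWithin_leftMC_eq {f : V → G} (hK : UniqueDiffOn ℝ K)
    (hf : ContMDiffOn 𝓘(ℝ, V) 𝓘(ℝ, E) ∞ f K) (hx : x ∈ K) (hx' : x ∈ closure (interior K)) :
    extDerivWithin (leftMC E K f) K x =
      -((1 / 2 : ℝ) • wedge (lieBr E G) (leftMC E K f x) (leftMC E K f x)) := by
  refine ContinuousAlternatingMap.ext_pair fun u v => ?_
  rw [extDerivWithin_leftMC hK hf hx hx', ContinuousAlternatingMap.neg_apply,
    ContinuousAlternatingMap.smul_apply, wedge_pair_apply,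
    lieBr_skew (leftMC E K f x ![v]) (leftMC E K f x ![u]), sub_neg_eq_add, ← two_smul ℝ, smul_smul]
  norm_num

/-- With α = θ and dα = −[θ ∧ θ]/2, the 𝔤[1]-component is (−1 + 1/2 + 1/2)[θ ∧ θ] = 0. In the
ℝ[2]-component ⟨θ ∧ [θ ∧ θ]⟩ has coefficient −1/2 + 1/4 + 1/6 = −1/12. -/
theorem qDefect_eq (hK : UniqueDiffOn ℝ K) {h : V → ExtPoint B V}
    (hf : ContMDiffOn 𝓘(ℝ, V) 𝓘(ℝ, E) ∞ (fun x => (h x).body) K)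
    (h1 : ∀ x ∈ K, (h x).one = leftMC E K (fun x => (h x).body) x)
    (hx : x ∈ K) (hx' : x ∈ closure (interior K)) :
    qDefect K h x = (0, 0, extDerivWithin (fun y => (h y).two) K x -
      (1 / 12 : ℝ) • cartanForm B (leftMC E K (fun x => (h x).body) x)) := by
  have e : extDerivWithin (fun y => (h y).one) K x = _ :=
    (extDerivWithin_congr' (fun y hy => h1 y hy) hx).trans (extDerivWithin_leftMC_eq hK hf hx hx')
  simp only [qDefect, dMinusQ, adPoint, h1 x hx, e, oddBracket, wedge_zero_right, wedge_neg_right,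
    wedge_smul_right, neg_zero, neg_neg, cartanForm]
  refine Prod.ext ?_ (Prod.ext ?_ ?_)
  · simp
  · ext v; simp; module
  · ext v; simp; ring

/-- All later arguments use this form of the NQ condition. As the Cartan form here is 6η, the last
clause reads ds = f^*η/2, which is why 2∫s appears in the comparison map. -/
theorem isNQMap_iff (hK : UniqueDiffOn ℝ K) (hK' : K ⊆ closure (interior K))
    {h : V → ExtPoint B V} :
    IsNQMap K h ↔ ContMDiffOn 𝓘(ℝ, V) 𝓘(ℝ, E) ∞ (fun x => (h x).body) K ∧
      (∀ x ∈ K, (h x).one = leftMC E K (fun x => (h x).body) x) ∧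
      ContDiffOn ℝ ∞ (fun x => (h x).two) K ∧
      ∀ x ∈ K, extDerivWithin (fun y => (h y).two) K x =
        (1 / 12 : ℝ) • cartanForm B (leftMC E K (fun x => (h x).body) x) := by
  constructor
  · intro H
    -- `adPoint` has zero 𝔤-component, so the 𝔤-component of the defect is just θ − α.
    have h1 : ∀ x ∈ K, (h x).one = leftMC E K (fun x => (h x).body) x := fun x hx => by
      have := congrArg Prod.fst (H.q_equivariant x hx)
      simp [qDefect, dMinusQ, adPoint] at this
      exact (add_neg_eq_zero.1 this).symm
    refine ⟨H.smooth_body, h1, H.smooth_two, fun x hx => ?_⟩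
    have := H.q_equivariant x hx
    rw [qDefect_eq hK H.smooth_body h1 hx (hK' hx)] at this
    exact sub_eq_zero.1 (congrArg (fun p : DegOne E V => p.2.2) this)
  · rintro ⟨hf, h1, h2, h3⟩
    refine ⟨hf, (contDiffOn_leftMC hK hf).congr h1, h2, fun x hx => ?_⟩
    rw [qDefect_eq hK hf h1 hx (hK' hx), h3 x hx, sub_self]
    rfl

theorem cartanForm_Ad (g : G) (α : V [⋀^Fin 1]→L[ℝ] E) :
    cartanForm B ((Ad E g).compContinuousAlternatingMap α) = cartanForm B α := by
  refine ContinuousAlternatingMap.ext_triple fun u v w => ?_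
  simp [cartanForm_apply, ← Ad_lieBr, B.invariant]

theorem cartanForm_neg (α : V [⋀^Fin 1]→L[ℝ] E) : cartanForm B (-α) = -cartanForm B α := by
  refine ContinuousAlternatingMap.ext_triple fun u v w => ?_
  simp [cartanForm_apply]

theorem cartanForm_comp (α : V [⋀^Fin 1]→L[ℝ] E) (L : W →L[ℝ] V) :
    cartanForm B (α.compContinuousLinearMap L) = (cartanForm B α).compContinuousLinearMap L := by
  refine ContinuousAlternatingMap.ext_triple fun u v w => ?_
  have h3 : L ∘ ![u, v, w] = ![L u, L v, L w] := by ext i; fin_cases i <;> rfl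
  have h1 : ∀ u, L ∘ ![u] = ![L u] := fun u => by ext i; fin_cases i; rfl
  simp only [ContinuousAlternatingMap.compContinuousLinearMap_apply, cartanForm_apply, h3, h1]

/-- The Polyakov-Wiegmann identity. -/
theorem cartanForm_mul (hK : UniqueDiffOn ℝ K) {f g : V → G}
    (hf : ContMDiffOn 𝓘(ℝ, V) 𝓘(ℝ, E) ∞ f K) (hg : ContMDiffOn 𝓘(ℝ, V) 𝓘(ℝ, E) ∞ g K)
    (hx : x ∈ K) (hx' : x ∈ closure (interior K)) :
    cartanForm B (leftMC E K (f * g) x) = cartanForm B (leftMC E K f x) +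
      cartanForm B (leftMC E K g x) - (6 : ℝ) • extDerivWithin (fun y => wedge B.form
        (leftMC E K (f * g) y - leftMC E K g y) (leftMC E K g y)) K x := by
  have hfg := hf.mul hg
  have hρ := contDiffOn_leftMC hK hfg
  have hτ := contDiffOn_leftMC hK hg
  have e1 := leftMC_mul (hK x hx) ((hf x hx).mdifferentiableWithinAt (by simp))
      ((hg x hx).mdifferentiableWithinAt (by simp))
  have e2 := cartanForm_Ad (B := B) (g x)⁻¹ (leftMC E K f x)
  -- The twisted form Ad(g⁻¹) f^*θ enters as a difference of two Maurer–Cartan forms, so its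
  -- exterior derivative follows from the structure equation and Ad need not be differentiated.
  have e3 : extDerivWithin (fun y => leftMC E K (f * g) y - leftMC E K g y) K x = 
      extDerivWithin (leftMC E K (f * g)) K x - extDerivWithin (leftMC E K g) K x := by
    refine ContinuousAlternatingMap.ext_pair fun u v => ?_
    simp only [ContinuousAlternatingMap.sub_apply, extDerivWithin_one_apply]
    rw [fderivWithin_fun_sub (hK x hx) (hρ.differentiableOn (by simp) x hx)
      (hτ.differentiableOn (by simp) x hx)]
    simp
    abel
  rw [← e2]
  set σ := (Ad E (g x)⁻¹).compContinuousAlternatingMap (leftMC E K f x)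
  refine ContinuousAlternatingMap.ext_triple fun u v w => ?_
  simp only [ContinuousAlternatingMap.sub_apply, ContinuousAlternatingMap.add_apply,
    ContinuousAlternatingMap.smul_apply]
  rw [extDerivWithin_wedge_pair B.form hK hx (hρ.sub hτ) hτ, e3,
    extDerivWithin_leftMC_eq hK hfg hx hx', extDerivWithin_leftMC_eq hK hg hx hx', e1,
    add_sub_cancel_right]
  set τ := leftMC E K g x
  simp only [cartanForm_apply, wedge_triple_apply, wedge_pair_apply,
    ContinuousAlternatingMap.sub_apply, ContinuousAlternatingMap.add_apply,
    ContinuousAlternatingMap.smul_apply, ContinuousAlternatingMap.neg_apply, map_sub, map_add,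
    map_neg, map_smul, _root_.add_apply, ContinuousLinearMap.flip_apply, smul_eq_mul]
  -- All orderings of a triple reduce to one by antisymmetry; what remains is an identity of
  -- coefficients.
  have key : ∀ a b c : E,
      B.form b (lieBr E G c a) = B.form a (lieBr E G b c) ∧
      B.form c (lieBr E G a b) = B.form a (lieBr E G b c) ∧
      B.form a (lieBr E G c b) = -B.form a (lieBr E G b c) ∧
      B.form b (lieBr E G a c) = -B.form a (lieBr E G b c) ∧
      B.form c (lieBr E G b a) = -B.form a (lieBr E G b c) := fun a b c => by
    have h1 := form_lieBr_cycle (B := B) a b c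
    have h2 := form_lieBr_cycle (B := B) b c a
    exact ⟨h1.symm, by rw [← h2, h1], form_lieBr_swap _ _ _, by rw [form_lieBr_swap, h1],
      by rw [form_lieBr_swap, ← h2, h1]⟩
  simp only [form_lieBr]
  simp only [key (σ ![u]) (σ ![v]) (τ ![w]),
    key (σ ![u]) (τ ![v]) (σ ![w]), key (σ ![u]) (τ ![v]) (τ ![w]), key (τ ![u]) (σ ![v]) (σ ![w]),
    key (τ ![u]) (σ ![v]) (τ ![w]), key (τ ![u]) (τ ![v]) (σ ![w]), key (τ ![u]) (τ ![v]) (τ ![w])]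
  ring

/-- The bracket term of the product adds −⟨σ ∧ τ⟩/2 to the 2-form, where σ = Ad(g⁻¹) f^*θ and τ =
g^*θ. Its differential is 1/12 of the term −6 d⟨σ ∧ τ⟩ in `cartanForm_mul`. -/
theorem IsNQMap.mul (hK : UniqueDiffOn ℝ K) (hK' : K ⊆ closure (interior K))
    {h h' : V → ExtPoint B V} (H : IsNQMap K h) (H' : IsNQMap K h') : IsNQMap K (h * h') := by
  obtain ⟨a1, a2, a3, a4⟩ := (isNQMap_iff hK hK').1 H
  obtain ⟨b1, b2, b3, b4⟩ := (isNQMap_iff hK hK').1 H'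
  set f := fun x => (h x).body
  set g := fun x => (h' x).body
  have hρ := contDiffOn_leftMC hK (a1.mul b1)
  have hτ := contDiffOn_leftMC hK b1
  have e : ∀ x ∈ K, leftMC E K (f * g) x =
      (Ad E (g x)⁻¹).compContinuousAlternatingMap (leftMC E K f x) + leftMC E K g x := fun x hx =>
    leftMC_mul (hK x hx) ((a1 x hx).mdifferentiableWithinAt (by simp))
      ((b1 x hx).mdifferentiableWithinAt (by simp))
  have ht : ∀ x ∈ K, ((h * h') x).two = (h x).two + (h' x).two - (1 / 2 : ℝ) •
      wedge B.form (leftMC E K (f * g) x - leftMC E K g x) (leftMC E K g x) := fun x hx => by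
    rw [Pi.mul_apply, ExtPoint.mul_def, e x hx, add_sub_cancel_right, a2 x hx, b2 x hx, oddBracket,
      smul_neg, sub_eq_add_neg]
  have hw := contDiffOn_wedge B.form (hρ.sub hτ) hτ
  refine (isNQMap_iff hK hK').2 ⟨a1.mul b1, fun x hx => ?_, ?_, fun x hx => ?_⟩
  · change _ = leftMC E K (f * g) x
    rw [Pi.mul_apply, ExtPoint.mul_def, e x hx, a2 x hx, b2 x hx]
  · exact ((a3.add b3).sub (hw.const_smul (1 / 2 : ℝ))).congr ht
  · change _ = (1 / 12 : ℝ) • cartanForm B (leftMC E K (f * g) x)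
    rw [cartanForm_mul hK a1 b1 hx (hK' hx), extDerivWithin_congr' ht hx]
    have hd : ∀ {k : ℕ} {ρ : V → V [⋀^Fin k]→L[ℝ] ℝ}, ContDiffOn ℝ ∞ ρ K →
      DifferentiableWithinAt ℝ ρ K x := fun hρ => hρ.differentiableOn (by simp) x hx
    have e2 := extDerivWithin_fun_add (hK x hx) (hd (a3.add b3))
      (hd (hw.const_smul (-(1 / 2) : ℝ)))
    rw [extDerivWithin_fun_add (hK x hx) (hd a3) (hd b3), extDerivWithin_fun_smul _ _ (hK x hx),
      a4 x hx, b4 x hx] at e2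
    simp only [neg_smul, ← sub_eq_add_neg] at e2
    refine e2.trans ?_
    module

/-- The Cartan form is cubic and Ad-invariant, and the form of f⁻¹ is −Ad(f) θ, so inversion changes
its sign, as it does that of `s`. -/
theorem IsNQMap.inv (hK : UniqueDiffOn ℝ K) (hK' : K ⊆ closure (interior K))
    {h : V → ExtPoint B V} (H : IsNQMap K h) : IsNQMap K h⁻¹ := by
  obtain ⟨a1, a2, a3, a4⟩ := (isNQMap_iff hK hK').1 H
  set f := fun x => (h x).body
  have e : ∀ x ∈ K, leftMC E K f⁻¹ x =
      -(Ad E (f x)).compContinuousAlternatingMap (leftMC E K f x) := fun x hx =>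
    leftMC_inv (hK x hx) ((a1 x hx).mdifferentiableWithinAt (by simp))
      ((a1.inv x hx).mdifferentiableWithinAt (by simp))
  refine (isNQMap_iff hK hK').2 ⟨a1.inv, fun x hx => ?_, a3.neg, fun x hx => ?_⟩
  · change _ = leftMC E K f⁻¹ x
    rw [Pi.inv_apply, ExtPoint.inv_def, e x hx, a2 x hx]
  · change extDerivWithin (fun y => -(h y).two) K x = (1 / 12 : ℝ) • cartanForm B (leftMC E K f⁻¹ x)
    have e2 := extDerivWithin_fun_smul (-1 : ℝ) (fun y => (h y).two) (hK x hx)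
    simp only [neg_smul, one_smul] at e2
    rw [e2, e x hx, cartanForm_neg, cartanForm_Ad, a4 x hx, smul_neg]

theorem IsNQMap.one (hK : UniqueDiffOn ℝ K) (hK' : K ⊆ closure (interior K)) :
    IsNQMap K (1 : V → ExtPoint B V) := by
  refine (isNQMap_iff hK hK').2 ⟨contMDiffOn_const, fun x hx => ?_, contDiffOn_const, fun x hx => ?_⟩
  · exact (leftMC_one (E := E) (G := G)).symm
  · have e : leftMC E K (fun y => ((1 : V → ExtPoint B V) y).body) x = 0 := leftMC_one
    rw [e, cartanForm, wedge_zero_left, smul_zero]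
    change extDerivWithin (fun _ => 0) K x = 0
    ext v
    simp [extDerivWithin, ContinuousAlternatingMap.alternatizeUncurryFin_apply]

/-- NQ-maps pull back along linear maps. -/
theorem IsNQMap.comap (hK : UniqueDiffOn ℝ K) (hK' : K ⊆ closure (interior K)) {L : Set W}
    (hL : UniqueDiffOn ℝ L) (hL' : L ⊆ closure (interior L)) {h : V → ExtPoint B V}
    (H : IsNQMap K h) (T : W →L[ℝ] V) (hT : Set.MapsTo T L K) :
    IsNQMap L fun y => (h (T y)).comap T := by
  obtain ⟨a1, a2, a3, a4⟩ := (isNQMap_iff hK hK').1 H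
  have e : ∀ y ∈ L, leftMC E L (fun y => (h (T y)).body) y =
      (leftMC E K (fun x => (h x).body) (T y)).compContinuousLinearMap T := fun y hy => by
    rw [leftMC_comp (f := fun x => (h x).body) (hL y hy)
      ((a1 _ (hT hy)).mdifferentiableWithinAt (by simp)) T.differentiableWithinAt hT,
      T.fderivWithin (hL y hy)]
  refine (isNQMap_iff hL hL').2 ⟨a1.comp T.contDiff.contMDiff.contMDiffOn hT, fun y hy => ?_, ?_,
    fun y hy => ?_⟩
  · change ((h (T y)).one).compContinuousLinearMap T = leftMC E L (fun y => (h (T y)).body) y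
    rw [e y hy, a2 _ (hT hy)]
  · exact (ContinuousAlternatingMap.compContinuousLinearMapCLM T).contDiff.comp_contDiffOn
      (a3.comp T.contDiff.contDiffOn hT)
  · change _ = (1 / 12 : ℝ) • cartanForm B (leftMC E L (fun y => (h (T y)).body) y)
    have e3 : ∀ z ∈ L, ((h (T z)).comap T).two =
      ((h (T z)).two).compContinuousLinearMap (fderivWithin ℝ T L z) := fun z hz => by
      rw [T.fderivWithin (hL z hz)]; rfl
    rw [e y hy, extDerivWithin_congr' e3 hy, extDerivWithin_pullback (t := K) (f := T)
      (a3.differentiableOn (by simp) (T y) (hT hy)) T.contDiff.contDiffWithinAt minSmoothness_two_le hL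
      (hL' hy) hy hT, a4 _ (hT hy), T.fderivWithin (hL y hy), cartanForm_comp]
    rfl

end NormalForm

/-! ### Smooth dependence of integrals on parameters, up to the boundary. -/

section ParametricIntegral
universe u
variable {V : Type u} [NormedAddCommGroup V] [NormedSpace ℝ V] {K : Set V}

theorem hasFDerivWithinAt_slice {F : Type*} [NormedAddCommGroup F] [NormedSpace ℝ F]
    {g : V × ℝ → F} (hg : DifferentiableOn ℝ g (K ×ˢ Set.Icc 0 1)) {x : V} {s : ℝ} (hx : x ∈ K)
    (hs : s ∈ Set.Icc (0 : ℝ) 1) :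
    HasFDerivWithinAt (fun y => g (y, s)) ((fderivWithin ℝ g (K ×ˢ Set.Icc 0 1) (x, s)).comp
      (ContinuousLinearMap.inl ℝ V ℝ)) K x :=
  HasFDerivWithinAt.comp (t := K ×ˢ Set.Icc (0 : ℝ) 1) x (hg (x, s) ⟨hx, hs⟩).hasFDerivWithinAt
    (hasFDerivAt_prodMk_left x s).hasFDerivWithinAt fun _ hy => ⟨hy, hs⟩

theorem intervalIntegrable_slice {F : Type*} [NormedAddCommGroup F]
    {g : V × ℝ → F} (hg : ContinuousOn g (K ×ˢ Set.Icc 0 1)) {x : V} (hx : x ∈ K) :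
    IntervalIntegrable (fun s => g (x, s)) volume 0 1 := by
  refine ContinuousOn.intervalIntegrable ?_
  rw [Set.uIcc_of_le zero_le_one]
  exact hg.comp (by fun_prop) fun s hs => ⟨hx, hs⟩

/-- Differentiation under the integral sign within a compact convex set of parameters. -/
theorem hasFDerivWithinAt_integral {F : Type*} [NormedAddCommGroup F] [NormedSpace ℝ F]
    [CompleteSpace F] (hK : UniqueDiffOn ℝ K) (hKc : IsCompact K) (hKv : Convex ℝ K)
    {g : V × ℝ → F} (hg : ContDiffOn ℝ 1 g (K ×ˢ Set.Icc 0 1)) {x : V} (hx : x ∈ K) :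
    HasFDerivWithinAt (fun y => ∫ s in (0 : ℝ)..1, g (y, s))
      (∫ s in (0 : ℝ)..1, (fderivWithin ℝ g (K ×ˢ Set.Icc 0 1) (x, s)).comp
        (ContinuousLinearMap.inl ℝ V ℝ)) K x := by
  set I := Set.Icc (0 : ℝ) 1
  set D : V × ℝ → V →L[ℝ] F := fun z => (fderivWithin ℝ g (K ×ˢ I) z).comp
        (ContinuousLinearMap.inl ℝ V ℝ) with hD
  have hu : UniqueDiffOn ℝ (K ×ˢ I) := hK.prod (uniqueDiffOn_Icc zero_lt_one)
  have hDc : ContinuousOn D (K ×ˢ I) :=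
    (hg.continuousOn_fderivWithin hu le_rfl).clm_comp continuousOn_const
  have huc := (hKc.prod isCompact_Icc).uniformContinuousOn_of_continuous hDc
  rw [hasFDerivWithinAt_iff_isLittleO, Asymptotics.isLittleO_iff]
  intro ε hε
  obtain ⟨δ, hδ, H⟩ := Metric.uniformContinuousOn_iff_le.1 huc ε hε
  filter_upwards [self_mem_nhdsWithin, mem_nhdsWithin_of_mem_nhds (Metric.closedBall_mem_nhds x hδ)]
    with y hy hyδ
  -- The mean value inequality on the convex set K ∩ ball, with a radius that uniform continuity
  -- makes independent of `s`.
  have key : ∀ s ∈ I, ‖g (y, s) - g (x, s) - D (x, s) (y - x)‖ ≤ ε * ‖y - x‖ := fun s hs => by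
    refine Convex.norm_image_sub_le_of_norm_hasFDerivWithin_le' (f := fun z => g (z, s))
      (f' := fun z => D (z, s)) (s := K ∩ Metric.closedBall x δ) (fun z hz =>
      (hasFDerivWithinAt_slice (hg.differentiableOn (by simp)) hz.1 hs).mono Set.inter_subset_left)
      (fun z hz => ?_) (hKv.inter (convex_closedBall _ _)) ⟨hx, Metric.mem_closedBall_self hδ.le⟩
      ⟨hy, hyδ⟩
    rw [← dist_eq_norm]
    refine H (z, s) ⟨hz.1, hs⟩ (x, s) ⟨hx, hs⟩ ?_
    simpa [Prod.dist_eq, hδ.le] using hz.2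
  have i1 := intervalIntegrable_slice hg.continuousOn hy
  have i2 := intervalIntegrable_slice hg.continuousOn hx
  have i3 := intervalIntegrable_slice hDc hx
  rw [ContinuousLinearMap.intervalIntegral_apply i3,
    ← intervalIntegral.integral_sub i1 i2, ← intervalIntegral.integral_sub (i1.sub i2)
      (intervalIntegrable_slice (g := fun z => D z (y - x)) (hDc.clm_apply continuousOn_const) hx)]
  refine (intervalIntegral.norm_integral_le_of_norm_le_const (C := ε * ‖y - x‖)
    fun s hs => ?_).trans (by simp)
  rw [Set.uIoc_of_le zero_le_one] at hs
  exact key s ⟨hs.1.le, hs.2⟩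

/-- The derivative is again an integral of this kind, with values in V →L F. The induction therefore
varies `F`, which has to stay in the universe of `V`. -/
theorem contDiffOn_integral {F : Type u} [NormedAddCommGroup F] [NormedSpace ℝ F]
    [CompleteSpace F] (hK : UniqueDiffOn ℝ K) (hKc : IsCompact K) (hKv : Convex ℝ K)
    {g : V × ℝ → F} (hg : ContDiffOn ℝ ∞ g (K ×ˢ Set.Icc 0 1)) :
    ContDiffOn ℝ ∞ (fun y => ∫ s in (0 : ℝ)..1, g (y, s)) K := by
  have hu : UniqueDiffOn ℝ (K ×ˢ Set.Icc (0 : ℝ) 1) := hK.prod (uniqueDiffOn_Icc zero_lt_one)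
  rw [contDiffOn_infty]
  intro n
  induction n generalizing F with
  | zero =>
    refine contDiffOn_zero.2 fun x hx => ?_
    exact (hasFDerivWithinAt_integral hK hKc hKv (hg.of_le (by simp)) hx).continuousWithinAt
  | succ n ih =>
    rw [Nat.cast_succ]
    refine (contDiffOn_succ_iff_hasFDerivWithinAt_of_uniqueDiffOn hK).2
      ⟨by rintro ⟨⟩, _, ?_, fun x hx =>
      hasFDerivWithinAt_integral hK hKc hKv (hg.of_le (by simp)) hx⟩
    exact ih ((hg.fderivWithin hu (by simp)).clm_comp contDiffOn_const)

end ParametricIntegral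

/-! ### Green's theorem on the disk. -/

section Green
open Real

theorem convex_disk : Convex ℝ disk := convex_closedBall _ _
theorem isCompact_disk : IsCompact disk := isCompact_closedBall _ _

theorem disk_subset_closure_interior : disk ⊆ closure (interior disk) := by
  have : (interior disk).Nonempty := ⟨0, by simp [disk, interior_closedBall]⟩
  rw [convex_disk.closure_interior_eq_closure_of_nonempty_interior this]
  exact subset_closure

/-- The unit vector with given angle. -/
def unitVec (t : ℝ) : ℂ := Real.cos t + Real.sin t * Complex.I

theorem norm_unitVec (t : ℝ) : ‖unitVec t‖ = 1 := by
  rw [unitVec, Complex.ofReal_cos, Complex.ofReal_sin, ← Complex.exp_mul_I,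
    Complex.norm_exp_ofReal_mul_I]

theorem hasDerivAt_unitVec (t : ℝ) : HasDerivAt unitVec (Complex.I * unitVec t) t := by
  have h1 := (Real.hasDerivAt_cos t).ofReal_comp
  have h2 := ((Real.hasDerivAt_sin t).ofReal_comp).mul_const Complex.I
  refine HasDerivAt.congr_deriv (f := unitVec) (h1.add h2) ?_
  simp only [unitVec]
  push_cast
  linear_combination -(Complex.sin t) * Complex.I_mul_I

theorem continuous_unitVec : Continuous unitVec :=
  continuous_iff_continuousAt.2 fun t => (hasDerivAt_unitVec t).continuousAt

/-- The component of the exterior derivative of a 1-form on the disk. -/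
def curl (l : ℂ → ℂ →L[ℝ] ℝ) (z : ℂ) : ℝ :=
  fderivWithin ℝ l disk z 1 Complex.I - fderivWithin ℝ l disk z Complex.I 1

theorem integral_disk_eq_polar (f : ℂ → ℝ) :
    ∫ z in disk, f z = ∫ p in Set.Icc ((0 : ℝ), -π) (1, π), p.1 * f (p.1 * unitVec p.2) := by
  have hm : MeasurableSet disk := Metric.isClosed_closedBall.measurableSet
  have hP : Continuous fun p : ℝ × ℝ => (p.1 : ℂ) * unitVec p.2 :=
    (Complex.continuous_ofReal.comp continuous_fst).mul (continuous_unitVec.comp continuous_snd)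
  have e : Set.Ioi (0 : ℝ) ×ˢ Set.Ioo (-π) π ∩ (fun p : ℝ × ℝ => (p.1 : ℂ) * unitVec p.2) ⁻¹' disk =
      Set.Ioc 0 1 ×ˢ Set.Ioo (-π) π := by
    ext p
    have h : ‖(p.1 : ℂ) * unitVec p.2‖ = |p.1| := by
      rw [norm_mul, norm_unitVec, Complex.norm_real, mul_one, Real.norm_eq_abs]
    simp only [Set.mem_inter_iff, Set.mem_prod, Set.mem_Ioi, Set.mem_preimage, disk,
      mem_closedBall_zero_iff, h, Set.mem_Ioc]
    constructor
    · rintro ⟨⟨h1, h2⟩, h3⟩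
      exact ⟨⟨h1, (le_abs_self _).trans h3⟩, h2⟩
    · rintro ⟨⟨h1, h3⟩, h2⟩
      exact ⟨⟨h1, h2⟩, by rwa [abs_of_pos h1]⟩
  -- The divergence theorem is stated on a closed rectangle, which differs from the polar domain by
  -- a null set.
  have e2 : (Set.Ioc (0 : ℝ) 1 ×ˢ Set.Ioo (-π) π : Set (ℝ × ℝ)) =ᵐ[volume]
      Set.Icc ((0 : ℝ), -π) (1, π) := by
    rw [Set.Icc_prod_eq]
    exact Measure.set_prod_ae_eq Ioc_ae_eq_Icc Ioo_ae_eq_Icc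
  rw [← integral_indicator hm, ← Complex.integral_comp_polarCoord_symm, polarCoord_target,
    ← setIntegral_congr_set e2, ← e, ← setIntegral_indicator (hP.measurable hm)]
  refine setIntegral_congr_fun (measurableSet_Ioi.prod measurableSet_Ioo) fun p _ => ?_
  have h3 : Complex.polarCoord.symm p = (p.1 : ℂ) * unitVec p.2 := Complex.polarCoord_symm_apply p
  simp only [h3]
  by_cases hp : (p.1 : ℂ) * unitVec p.2 ∈ disk
  · rw [Set.indicator_of_mem hp,
      Set.indicator_of_mem (s := (fun p : ℝ × ℝ => (p.1 : ℂ) * unitVec p.2) ⁻¹' disk) hp, smul_eq_mul]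
  · rw [Set.indicator_of_notMem hp,
      Set.indicator_of_notMem (s := (fun p : ℝ × ℝ => (p.1 : ℂ) * unitVec p.2) ⁻¹' disk) hp, smul_zero]

/-- The antisymmetric part of a bilinear form on the plane takes the same value on every rotated
copy of the frame (1, i). -/
theorem curl_rotate (L : ℂ →L[ℝ] ℂ →L[ℝ] ℝ) (t : ℝ) :
    L (unitVec t) (Complex.I * unitVec t) - L (Complex.I * unitVec t) (unitVec t) =
      L 1 Complex.I - L Complex.I 1 := by
  have h1 : unitVec t = Real.cos t • (1 : ℂ) + Real.sin t • Complex.I := by simp [unitVec]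
  have h2 : Complex.I * unitVec t = Real.cos t • Complex.I - Real.sin t • (1 : ℂ) := by
    simp only [unitVec, Complex.real_smul]
    linear_combination (Real.sin t : ℂ) * Complex.I_mul_I
  rw [h2, h1]
  simp only [map_add, map_sub, map_smul, _root_.add_apply, _root_.sub_apply, _root_.smul_apply,
    smul_eq_mul]
  linear_combination (L 1 Complex.I - L Complex.I 1) * Real.cos_sq_add_sin_sq t

/-- In polar coordinates the pull-back of `l` is l(u) dr + l(i r u) dt with u = e^{it}. The
divergence theorem on [0, 1] × [−π, π] is applied to the field (l(i r u), −l(u)). -/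
theorem integral_curl {l : ℂ → ℂ →L[ℝ] ℝ} (hl : ContDiffOn ℝ 1 l disk) :
    ∫ z in disk, curl l z = ∫ t in (-π)..π, l (unitVec t) (Complex.I * unitVec t) := by
  set P : ℝ × ℝ → ℂ := fun p => (p.1 : ℂ) * unitVec p.2 with hP
  have hnorm : ∀ p : ℝ × ℝ, ‖P p‖ = |p.1| := fun p => by
    rw [hP, norm_mul, norm_unitVec, Complex.norm_real, mul_one, Real.norm_eq_abs]
  have hPc : Continuous P :=
    (Complex.continuous_ofReal.comp continuous_fst).mul (continuous_unitVec.comp continuous_snd)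
  have huc : Continuous fun p : ℝ × ℝ => unitVec p.2 := continuous_unitVec.comp continuous_snd
  have hmem : Set.MapsTo P (Set.Icc ((0 : ℝ), -π) (1, π)) disk := fun p hp => by
    simp only [disk, mem_closedBall_zero_iff, hnorm]
    rw [abs_of_nonneg hp.1.1]
    exact hp.2.1
  let U' : ℝ × ℝ → ℝ × ℝ →L[ℝ] ℂ := fun p => 
    (ContinuousLinearMap.toSpanSingleton ℝ (Complex.I * unitVec p.2)).comp
      (ContinuousLinearMap.snd ℝ ℝ ℝ)
  have hU : ∀ p : ℝ × ℝ, HasFDerivAt (fun p : ℝ × ℝ => unitVec p.2) (U' p) p := fun p =>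
    (hasDerivAt_unitVec p.2).hasFDerivAt.comp p hasFDerivAt_snd
  let P' : ℝ × ℝ → ℝ × ℝ →L[ℝ] ℂ := fun p => (p.1 : ℂ) • U' p +
    unitVec p.2 • (Complex.ofRealCLM.comp (ContinuousLinearMap.fst ℝ ℝ ℝ))
  have hP' : ∀ p : ℝ × ℝ, HasFDerivAt P (P' p) p := fun p =>
    HasFDerivAt.mul (Complex.ofRealCLM.hasFDerivAt.comp p hasFDerivAt_fst) (hU p)
  have hIP' : ∀ p : ℝ × ℝ, HasFDerivAt (fun p => Complex.I * P p) (Complex.I • P' p) p := fun p =>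
    (hP' p).const_mul Complex.I
  let D : ℝ × ℝ → ℂ →L[ℝ] ℂ →L[ℝ] ℝ := fun p => fderivWithin ℝ l disk (P p)
  have hD : ∀ p ∈ Set.Ioo (0 : ℝ) 1 ×ˢ Set.Ioo (-π) π, HasFDerivAt (fun p => l (P p))
      ((D p).comp (P' p)) p := fun p hp => by
    refine HasFDerivAt.comp p (HasFDerivWithinAt.hasFDerivAt
      (hl.differentiableOn (by simp) (P p) ?_).hasFDerivWithinAt ?_) (hP' p)
    · simp only [disk, mem_closedBall_zero_iff, hnorm, abs_of_pos hp.1.1]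
      exact hp.1.2.le
    · refine Metric.closedBall_mem_nhds_of_mem ?_
      simp only [mem_ball_zero_iff, hnorm, abs_of_pos hp.1.1]
      exact hp.1.2
  have hlc : ContinuousOn (fun p => l (P p)) (Set.Icc ((0 : ℝ), -π) (1, π)) :=
    hl.continuousOn.comp hPc.continuousOn hmem
  -- The two terms l(i u) cancel, and the derivative terms form the curl in the rotated frame, with
  -- the Jacobian factor r.
  have hsum : ∀ p : ℝ × ℝ,
      ((l (P p)).comp (Complex.I • P' p) + ((D p).comp (P' p)).flip (Complex.I * P p)) (1, 0) +
      (-((l (P p)).comp (U' p) + ((D p).comp (P' p)).flip (unitVec p.2))) (0, 1) =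
      p.1 * curl l (P p) := fun p => by
    have h1 : P' p (1, 0) = unitVec p.2 := by simp [P', U']
    have h2 : P' p (0, 1) = p.1 • (Complex.I * unitVec p.2) := by simp [P', U']
    have h3 : U' p (0, 1) = Complex.I * unitVec p.2 := by simp [U']
    have h4 : Complex.I * P p = p.1 • (Complex.I * unitVec p.2) := by
      simp only [P, Complex.real_smul]; ring
    have h5 := curl_rotate (D p) p.2
    simp only [_root_.add_apply, _root_.neg_apply, ContinuousLinearMap.comp_apply,
      ContinuousLinearMap.flip_apply, _root_.smul_apply, h1, h2, h3, h4, map_smul, smul_eq_mul]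
    unfold curl
    linear_combination p.1 * h5
  have hcurl : ContinuousOn (fun p : ℝ × ℝ => p.1 * curl l (P p)) (Set.Icc ((0 : ℝ), -π) (1, π)) := by
    have h := (hl.continuousOn_fderivWithin uniqueDiffOn_disk le_rfl).comp hPc.continuousOn hmem
    exact continuous_fst.continuousOn.mul (((h.clm_apply continuousOn_const).clm_apply
      continuousOn_const).sub ((h.clm_apply continuousOn_const).clm_apply continuousOn_const))
  have main := integral_divergence_prod_Icc_of_hasFDerivAt_off_countable_of_le
    (fun p => l (P p) (Complex.I * P p)) (fun p => -l (P p) (unitVec p.2))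
    (fun p => (l (P p)).comp (Complex.I • P' p) + ((D p).comp (P' p)).flip (Complex.I * P p))
    (fun p => -((l (P p)).comp (U' p) + ((D p).comp (P' p)).flip (unitVec p.2)))
    ((0 : ℝ), -π) (1, π) ⟨zero_le_one, by linarith [pi_pos]⟩ ∅ Set.countable_empty
    (hlc.clm_apply (continuous_const.mul hPc).continuousOn)
    (hlc.clm_apply huc.continuousOn).neg
    (fun p hp => (hD p hp.1).clm_apply (hIP' p))
    (fun p hp => ((hD p hp.1).clm_apply (hU p)).neg)
    (by simp only [hsum]; exact hcurl.integrableOn_compact isCompact_Icc)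
  simp only [hsum] at main
  rw [integral_disk_eq_polar]
  refine main.trans ?_
  have h6 : unitVec (-π) = unitVec π := by simp [unitVec]
  -- The edge r = 0 contributes nothing since i r u vanishes there, and the edges t = ±π cancel by
  -- periodicity.
  simp [P, h6]

end Green

/-! ### A relative Poincaré lemma for 2-forms on the disk. -/

section Poincare
open Real

/-- The 1-form `x dy - y dx`. -/
def angularForm : ℂ →L[ℝ] ℂ →L[ℝ] ℝ :=
  Complex.reCLM.smulRight Complex.imCLM - Complex.imCLM.smulRight Complex.reCLM

theorem angularForm_apply (z w : ℂ) : angularForm z w = z.re * w.im - z.im * w.re := by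
  simp [angularForm]

theorem unitInterval_smul_mem_disk {z : ℂ} (hz : z ∈ disk) {r : ℝ} (hr : r ∈ Set.Icc (0 : ℝ) 1) :
    r • z ∈ disk := by
  simp only [disk, mem_closedBall_zero_iff, norm_smul, Real.norm_of_nonneg hr.1] at hz ⊢
  exact mul_le_one₀ hr.2 (norm_nonneg z) hz

theorem unitVec_mul_mem_disk {z : ℂ} (hz : z ∈ disk) (t : ℝ) : unitVec t * z ∈ disk := by
  simpa [disk, norm_unitVec] using hz

/-- The integral `∫₀¹ r k(r z) dr`. -/
def radialIntegral (k : ℂ → ℝ) (z : ℂ) : ℝ := ∫ r in (0 : ℝ)..1, r * k (r • z)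

theorem contDiffOn_radial_integrand {k : ℂ → ℝ} (hk : ContDiffOn ℝ ∞ k disk) :
    ContDiffOn ℝ ∞ (fun p : ℂ × ℝ => p.2 * k (p.2 • p.1)) (disk ×ˢ Set.Icc (0 : ℝ) 1) :=
  contDiff_snd.contDiffOn.mul (hk.comp (contDiff_snd.smul contDiff_fst).contDiffOn
    fun _ hp => unitInterval_smul_mem_disk hp.1 hp.2)

theorem contDiffOn_radialIntegral {k : ℂ → ℝ} (hk : ContDiffOn ℝ ∞ k disk) :
    ContDiffOn ℝ ∞ (radialIntegral k) disk :=
  contDiffOn_integral uniqueDiffOn_disk isCompact_disk convex_disk (contDiffOn_radial_integrand hk)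

theorem fderivWithin_integral_apply {g : ℂ × ℝ → ℝ}
    (hg : ContDiffOn ℝ ∞ g (disk ×ˢ Set.Icc (0 : ℝ) 1)) {g' : ℂ → ℝ → ℂ →L[ℝ] ℝ} {z : ℂ}
    (hz : z ∈ disk)
    (hg' : ∀ s ∈ Set.Icc (0 : ℝ) 1, HasFDerivWithinAt (fun y => g (y, s)) (g' z s) disk z) (w : ℂ) :
    fderivWithin ℝ (fun y => ∫ s in (0 : ℝ)..1, g (y, s)) disk z w =
      ∫ s in (0 : ℝ)..1, g' z s w := by
  have hu : UniqueDiffOn ℝ (disk ×ˢ Set.Icc (0 : ℝ) 1) :=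
    uniqueDiffOn_disk.prod (uniqueDiffOn_Icc zero_lt_one)
  have h := hasFDerivWithinAt_integral uniqueDiffOn_disk isCompact_disk convex_disk
    (hg.of_le (by simp)) hz
  rw [h.fderivWithin (uniqueDiffOn_disk z hz), ContinuousLinearMap.intervalIntegral_apply]
  · refine intervalIntegral.integral_congr fun s hs => ?_
    rw [Set.uIcc_of_le zero_le_one] at hs
    have := (uniqueDiffOn_disk z hz).eq (hasFDerivWithinAt_slice (hg.differentiableOn (by simp)) hz hs)
      (hg' s hs)
    exact DFunLike.congr_fun this w
  · exact intervalIntegrable_slice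
      (g := fun p => (fderivWithin ℝ g (disk ×ˢ Set.Icc (0 : ℝ) 1) p).comp
        (ContinuousLinearMap.inl ℝ ℂ ℝ))
      ((hg.continuousOn_fderivWithin hu (by simp)).clm_comp continuousOn_const) hz

/-- Integrate the derivative 2r k(rz) + r² dk(z) of r² k(rz) over [0, 1]. With
`curl_mul_angularForm`, this makes K (x dy − y dx) a primitive of k dx ∧ dy, where K is the radial
integral. -/
theorem radialIntegral_ode {k : ℂ → ℝ} (hk : ContDiffOn ℝ ∞ k disk) {z : ℂ} (hz : z ∈ disk) :
    fderivWithin ℝ (radialIntegral k) disk z z + 2 * radialIntegral k z = k z := by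
  have hkd : ∀ y ∈ disk, HasFDerivWithinAt k (fderivWithin ℝ k disk y) disk y := fun y hy =>
    (hk.differentiableOn (by simp) y hy).hasFDerivWithinAt
  have h1 := fderivWithin_integral_apply (contDiffOn_radial_integrand hk) hz
    (g' := fun z r => r • (fderivWithin ℝ k disk (r • z)).comp (r • ContinuousLinearMap.id ℝ ℂ))
    (fun r hr => ((hkd _ (unitInterval_smul_mem_disk hz hr)).comp z
      ((hasFDerivAt_id z).const_smul r).hasFDerivWithinAt
      fun y hy => unitInterval_smul_mem_disk hy hr).const_mul r) z
  have hc : Set.MapsTo (fun r : ℝ => r • z) (Set.Icc 0 1) disk :=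
    fun r hr => unitInterval_smul_mem_disk hz hr
  have hcc : ContinuousOn (fun r : ℝ => r • z) (Set.Icc 0 1) := by fun_prop
  have c1 : ContinuousOn (fun r : ℝ => k (r • z)) (Set.Icc 0 1) := hk.continuousOn.comp hcc hc
  have c2 : ContinuousOn (fun r : ℝ => fderivWithin ℝ k disk (r • z) z) (Set.Icc 0 1) :=
    ((hk.continuousOn_fderivWithin uniqueDiffOn_disk (by simp)).comp hcc hc).clm_apply
      continuousOn_const
  have ii : ∀ {φ : ℝ → ℝ}, ContinuousOn φ (Set.Icc 0 1) → IntervalIntegrable φ volume 0 1 :=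
    fun h => ContinuousOn.intervalIntegrable (by rwa [Set.uIcc_of_le zero_le_one])
  have h2 : ∫ r in (0 : ℝ)..1, ((2 * r) * k (r • z) + r ^ 2 * fderivWithin ℝ k disk (r • z) z) = 
      1 ^ 2 * k ((1 : ℝ) • z) - 0 ^ 2 * k ((0 : ℝ) • z) := by
    refine intervalIntegral.integral_eq_sub_of_hasDerivAt_of_le
      (f := fun r : ℝ => r ^ 2 * k (r • z)) zero_le_one
      ((continuous_pow 2).continuousOn.mul c1) (fun r hr => ?_) (ii ?_)
    · have d1 : HasDerivAt (fun r : ℝ => r • z) z r := by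
        simpa using (hasDerivAt_id r).smul_const z
      have d2 : HasDerivWithinAt (fun r : ℝ => k (r • z)) (fderivWithin ℝ k disk (r • z) z)
          (Set.Icc 0 1) r :=
        (hkd _ (hc ⟨hr.1.le, hr.2.le⟩)).comp_hasDerivWithinAt r d1.hasDerivWithinAt hc
      have d3 := (hasDerivAt_pow 2 r).fun_mul (d2.hasDerivAt (Icc_mem_nhds hr.1 hr.2))
      simpa using d3
    · exact ((continuous_const.mul continuous_id).continuousOn.mul c1).add
        ((continuous_pow 2).continuousOn.mul c2)
  have h3 : fderivWithin ℝ (radialIntegral k) disk z z =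
      ∫ r in (0 : ℝ)..1, r ^ 2 * fderivWithin ℝ k disk (r • z) z := by
    refine h1.trans (intervalIntegral.integral_congr fun r _ => ?_)
    simp
    ring
  rw [h3]
  unfold radialIntegral
  have i1 : IntervalIntegrable (fun r : ℝ => r ^ 2 * fderivWithin ℝ k disk (r • z) z) volume 0 1 :=
    ii ((continuous_pow 2).continuousOn.mul c2)
  have i2 : IntervalIntegrable (fun r : ℝ => 2 * (r * k (r • z))) volume 0 1 :=
    ii (continuousOn_const.mul (continuousOn_id.mul c1))
  rw [← intervalIntegral.integral_const_mul, ← intervalIntegral.integral_add i1 i2]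
  simp only [one_pow, one_smul, one_mul, ne_eq, OfNat.ofNat_ne_zero, not_false_eq_true, zero_pow,
    zero_mul, sub_zero] at h2
  rw [← h2]
  exact intervalIntegral.integral_congr fun r _ => by ring

theorem map_complex_eq (L : ℂ →L[ℝ] ℝ) (z : ℂ) : L z = z.re * L 1 + z.im * L Complex.I := by
  conv_lhs => rw [show z = z.re • (1 : ℂ) + z.im • Complex.I by simp]
  simp only [map_add, map_smul, smul_eq_mul]

theorem curl_mul_angularForm {q : ℂ → ℝ} (hq : ContDiffOn ℝ ∞ q disk) {z : ℂ} (hz : z ∈ disk) :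
    curl (fun y => q y • angularForm y) z = fderivWithin ℝ q disk z z + 2 * q z := by
  have h := ((hq.differentiableOn (by simp) z hz).hasFDerivWithinAt.fun_smul
    angularForm.hasFDerivAt.hasFDerivWithinAt).fderivWithin (uniqueDiffOn_disk z hz)
  unfold curl
  rw [h, map_complex_eq (fderivWithin ℝ q disk z) z]
  simp [angularForm_apply]
  ring

/-- A primitive of `q` along rotations, up to its mean: `∫₀¹ 2πσ q(e^{2πiσ} z) dσ`. -/
def rotationPrimitive (q : ℂ → ℝ) (z : ℂ) : ℝ :=
  ∫ s in (0 : ℝ)..1, (2 * π * s) * q (unitVec (2 * π * s) * z)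

theorem contDiff_unitVec : ContDiff ℝ ∞ unitVec := by
  unfold unitVec
  exact ((Complex.ofRealCLM.contDiff.comp Real.contDiff_cos)).add
    ((Complex.ofRealCLM.contDiff.comp Real.contDiff_sin).mul contDiff_const)

theorem contDiffOn_rotation_integrand {q : ℂ → ℝ} (hq : ContDiffOn ℝ ∞ q disk) :
    ContDiffOn ℝ ∞ (fun p : ℂ × ℝ => (2 * π * p.2) * q (unitVec (2 * π * p.2) * p.1))
      (disk ×ˢ Set.Icc (0 : ℝ) 1) :=
  (contDiff_const.mul contDiff_snd).contDiffOn.mul (hq.comp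
    ((contDiff_unitVec.comp (contDiff_const.mul contDiff_snd)).mul contDiff_fst).contDiffOn
    fun _ hp => unitVec_mul_mem_disk hp.1 _)

theorem contDiffOn_rotationPrimitive {q : ℂ → ℝ} (hq : ContDiffOn ℝ ∞ q disk) :
    ContDiffOn ℝ ∞ (rotationPrimitive q) disk :=
  contDiffOn_integral uniqueDiffOn_disk isCompact_disk convex_disk (contDiffOn_rotation_integrand hq)

/-- Differentiating in the direction iz turns the integrand into s times the s-derivative of
q(e^{2πis} z). Integration by parts leaves the end value q(z) and the mean over the circle. -/
theorem rotationPrimitive_deriv {q : ℂ → ℝ} (hq : ContDiffOn ℝ ∞ q disk) {z : ℂ} (hz : z ∈ disk) :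
    fderivWithin ℝ (rotationPrimitive q) disk z (Complex.I * z) =
      q z - ∫ s in (0 : ℝ)..1, q (unitVec (2 * π * s) * z) := by
  have hqd : ∀ y ∈ disk, HasFDerivWithinAt q (fderivWithin ℝ q disk y) disk y := fun y hy =>
    (hq.differentiableOn (by simp) y hy).hasFDerivWithinAt
  have hm : ∀ t : ℝ, unitVec t * z ∈ disk := unitVec_mul_mem_disk hz
  have h1 := fderivWithin_integral_apply (contDiffOn_rotation_integrand hq) hz
    (g' := fun z s => (2 * π * s) • (fderivWithin ℝ q disk (unitVec (2 * π * s) * z)).comp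
      (unitVec (2 * π * s) • ContinuousLinearMap.id ℝ ℂ))
    (fun s _ => ((hqd _ (hm _)).comp z
      ((hasFDerivAt_id z).const_mul (unitVec (2 * π * s))).hasFDerivWithinAt
      fun y hy => unitVec_mul_mem_disk hy _).const_mul (2 * π * s)) (Complex.I * z)
  have he : Continuous fun s : ℝ => unitVec (2 * π * s) * z :=
    (continuous_unitVec.comp (continuous_const.mul continuous_id)).mul continuous_const
  have c1 : Continuous fun s : ℝ => q (unitVec (2 * π * s) * z) :=
    hq.continuousOn.comp_continuous he fun _ => hm _
  have c2 : Continuous fun s : ℝ => fderivWithin ℝ q disk (unitVec (2 * π * s) * z)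
      ((2 * π) • (Complex.I * unitVec (2 * π * s) * z)) :=
    ((hq.continuousOn_fderivWithin uniqueDiffOn_disk (by simp)).comp_continuous he
      fun _ => hm _).clm_apply (by
        simp only [mul_assoc Complex.I]
        exact (continuous_const.mul he).const_smul (2 * π))
  have c3 : Continuous fun s : ℝ => s * fderivWithin ℝ q disk (unitVec (2 * π * s) * z)
      ((2 * π) • (Complex.I * unitVec (2 * π * s) * z)) := continuous_id.mul c2
  have h2 : ∫ s in (0 : ℝ)..1, (q (unitVec (2 * π * s) * z) + s * fderivWithin ℝ q disk
      (unitVec (2 * π * s) * z) ((2 * π) • (Complex.I * unitVec (2 * π * s) * z))) =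
      1 * q (unitVec (2 * π * 1) * z) - 0 * q (unitVec (2 * π * 0) * z) := by
    refine intervalIntegral.integral_eq_sub_of_hasDerivAt
      (f := fun s : ℝ => s * q (unitVec (2 * π * s) * z)) (fun s _ => ?_)
      ((c1.add c3).intervalIntegrable _ _)
    have d0 : HasDerivAt (fun s : ℝ => 2 * π * s) (2 * π) s := by
      simpa using (hasDerivAt_id s).const_mul (2 * π)
    have d1 : HasDerivAt (fun s : ℝ => unitVec (2 * π * s) * z)
        ((2 * π) • (Complex.I * unitVec (2 * π * s) * z)) s := by
      refine (((hasDerivAt_unitVec (2 * π * s)).scomp s d0).mul_const z).congr_deriv ?_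
      rw [smul_mul_assoc]
    have d2 : HasDerivAt (fun s : ℝ => q (unitVec (2 * π * s) * z))
        (fderivWithin ℝ q disk (unitVec (2 * π * s) * z)
          ((2 * π) • (Complex.I * unitVec (2 * π * s) * z))) s := by
      have := (hqd _ (hm (2 * π * s))).comp_hasDerivWithinAt s (d1.hasDerivWithinAt (s := Set.univ))
        fun _ _ => hm _
      exact this.hasDerivAt Filter.univ_mem
    simpa using (hasDerivAt_id s).fun_mul d2
  have hone : unitVec (2 * π * 1) = 1 := by simp [unitVec]
  rw [intervalIntegral.integral_add (c1.intervalIntegrable _ _) (c3.intervalIntegrable _ _), hone,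
    one_mul, one_mul, zero_mul, sub_zero] at h2
  rw [← h2, add_sub_cancel_left]
  refine h1.trans (intervalIntegral.integral_congr fun s _ => ?_)
  have : unitVec (2 * π * s) * (Complex.I * z) = Complex.I * unitVec (2 * π * s) * z := by ring
  simp only [_root_.smul_apply, ContinuousLinearMap.comp_apply, ContinuousLinearMap.id_apply,
    smul_eq_mul, this, map_smul]
  ring

theorem unitVec_mul (s t : ℝ) : unitVec s * unitVec t = unitVec (s + t) := by
  simp only [unitVec, Complex.ofReal_cos, Complex.ofReal_sin, ← Complex.exp_mul_I,
    ← Complex.exp_add, Complex.ofReal_add, add_mul]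

theorem exists_unitVec_eq {z : ℂ} (hz : ‖z‖ = 1) : ∃ t : ℝ, unitVec t = z := by
  refine ⟨z.arg, ?_⟩
  have := Complex.norm_mul_exp_arg_mul_I z
  rw [hz, Complex.ofReal_one, one_mul] at this
  simp only [unitVec, Complex.ofReal_cos, Complex.ofReal_sin, ← Complex.exp_mul_I, this]

theorem periodic_unitVec : Function.Periodic unitVec (2 * π) := fun t => by
  simp [unitVec]

theorem integral_rotation {q : ℂ → ℝ} {z : ℂ} (hz : ‖z‖ = 1) :
    2 * π * ∫ s in (0 : ℝ)..1, q (unitVec (2 * π * s) * z) = ∫ t in (-π)..π, q (unitVec t) := by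
  obtain ⟨α, rfl⟩ := exists_unitVec_eq hz
  simp only [unitVec_mul]
  have h := intervalIntegral.mul_integral_comp_mul_add (a := 0) (b := 1)
    (f := fun t => q (unitVec t)) (c := 2 * π) (d := α)
  rw [h]
  have hp : Function.Periodic (fun t => q (unitVec t)) (2 * π) := fun t => by
    simp only [periodic_unitVec t]
  have := hp.intervalIntegral_add_eq α (-π)
  convert this using 2 <;> ring

theorem curl_fderivWithin {u : ℂ → ℝ} (hu : ContDiffOn ℝ ∞ u disk) {z : ℂ} (hz : z ∈ disk) :
    curl (fun y => fderivWithin ℝ u disk y) z = 0 := by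
  have h := (hu z hz).isSymmSndFDerivWithinAt (by
    rw [minSmoothness_of_isRCLikeNormedField]; exact WithTop.coe_le_coe.2 le_top)
    uniqueDiffOn_disk (disk_subset_closure_interior hz) hz
  exact sub_eq_zero.2 (h 1 Complex.I)

/-- A function on the disk with vanishing integral is the exterior derivative of a 1-form that
vanishes on the vectors tangent to the boundary. -/
theorem exists_curl_eq {k : ℂ → ℝ} (hk : ContDiffOn ℝ ∞ k disk) (h0 : ∫ z in disk, k z = 0) :
    ∃ l : ℂ → ℂ →L[ℝ] ℝ, ContDiffOn ℝ ∞ l disk ∧ (∀ z ∈ disk, curl l z = k z) ∧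
      ∀ z ∈ Metric.sphere (0 : ℂ) 1, l z (Complex.I * z) = 0 := by
  have hK := contDiffOn_radialIntegral hk
  have hu := contDiffOn_rotationPrimitive hK
  have hl0 : ContDiffOn ℝ ∞ (fun y => radialIntegral k y • angularForm y) disk :=
    hK.smul angularForm.contDiff.contDiffOn
  have hdu : ContDiffOn ℝ ∞ (fun y => fderivWithin ℝ (rotationPrimitive (radialIntegral k)) disk y)
      disk := hu.fderivWithin uniqueDiffOn_disk (by simp)
  have hc0 : ∀ z ∈ disk, curl (fun y => radialIntegral k y • angularForm y) z = k z := fun z hz => by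
    rw [curl_mul_angularForm hK hz, radialIntegral_ode hk hz]
  have hang : ∀ z : ℂ, ‖z‖ = 1 → angularForm z (Complex.I * z) = 1 := fun z hz => by
    have h := Complex.sq_norm z
    rw [hz, Complex.normSq_apply] at h
    rw [angularForm_apply]
    simp
    linarith
  -- Green's theorem turns ∫k = 0 into the vanishing of the boundary mean of K.
  have hmean : ∫ t in (-π)..π, radialIntegral k (unitVec t) = 0 := by
    have h1 := integral_curl (hl0.of_le (by simp))
    rw [setIntegral_congr_fun isCompact_disk.measurableSet hc0, h0] at h1
    rw [h1]
    refine intervalIntegral.integral_congr fun t _ => ?_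
    simp [hang _ (norm_unitVec t)]
  -- Subtracting an exact form keeps the curl. On the boundary the first term has tangential value
  -- K, and the subtracted differential has value K minus its zero mean.
  refine ⟨fun y => radialIntegral k y • angularForm y -
    fderivWithin ℝ (rotationPrimitive (radialIntegral k)) disk y, hl0.sub hdu, fun z hz => ?_,
    fun z hz => ?_⟩
  · have h1 := fderivWithin_fun_sub (uniqueDiffOn_disk z hz) (hl0.differentiableOn (by simp) z hz)
      (hdu.differentiableOn (by simp) z hz)
    have h2 := hc0 z hz
    have h3 := curl_fderivWithin hu hz
    unfold curl at h2 h3 ⊢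
    rw [h1]
    simp only [_root_.sub_apply]
    linarith
  · have hz' : ‖z‖ = 1 := by simpa using hz
    have h1 := integral_rotation (q := radialIntegral k) hz'
    rw [hmean] at h1
    have h2 : ∫ s in (0 : ℝ)..1, radialIntegral k (unitVec (2 * π * s) * z) = 0 := by
      have := Real.pi_pos
      simpa [this.ne'] using h1
    simp only [_root_.sub_apply, _root_.smul_apply, smul_eq_mul, hang z hz', mul_one]
    rw [rotationPrimitive_deriv hK (Metric.sphere_subset_closedBall hz), h2]
    ring

end Poincare

/-! ### Forms on the disk and on the cylinder. -/

section Cylinder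

theorem convex_cylinder : Convex ℝ cylinder := convex_disk.prod (convex_Icc 0 1)

theorem isCompact_cylinder : IsCompact cylinder := isCompact_disk.prod isCompact_Icc

theorem interior_cylinder_nonempty : (interior cylinder).Nonempty :=
  ⟨(0, 1 / 2), by
    rw [cylinder, interior_prod_eq, disk, interior_closedBall _ one_ne_zero, interior_Icc]
    exact ⟨by simp, by norm_num⟩⟩

theorem uniqueDiffOn_cylinder : UniqueDiffOn ℝ cylinder :=
  uniqueDiffOn_convex convex_cylinder interior_cylinder_nonempty

theorem cylinder_subset_closure_interior : cylinder ⊆ closure (interior cylinder) := by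
  rw [convex_cylinder.closure_interior_eq_closure_of_nonempty_interior interior_cylinder_nonempty]
  exact subset_closure

/-- A 3-form on the plane vanishes. -/
theorem three_form_complex_eq_zero {F : Type*} [NormedAddCommGroup F] [NormedSpace ℝ F]
    (φ : ℂ [⋀^Fin 3]→L[ℝ] F) : φ = 0 := by
  ext v
  refine φ.toAlternatingMap.map_linearDependent v fun h => ?_
  have := h.fintype_card_le_finrank
  simp [Complex.finrank_real_complex] at this

/-- The standard basis of `ℂ × ℝ`. -/
def cylinderBasis : Module.Basis (Fin 3) ℝ (ℂ × ℝ) :=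
  (Complex.basisOneI.prod (Module.Basis.singleton (Fin 1) ℝ)).reindex finSumFinEquiv

theorem coe_cylinderBasis : ⇑cylinderBasis = ![(1, 0), (Complex.I, 0), (0, 1)] := by
  ext i : 1
  fin_cases i
  · change cylinderBasis (finSumFinEquiv (m := 2) (n := 1) (Sum.inl 0)) = _
    simp [cylinderBasis]
  · change cylinderBasis (finSumFinEquiv (m := 2) (n := 1) (Sum.inl 1)) = _
    simp [cylinderBasis]
  · change cylinderBasis (finSumFinEquiv (m := 2) (n := 1) (Sum.inr 0)) = _
    simp [cylinderBasis]

theorem three_form_cylinder_ext {φ ψ : (ℂ × ℝ) [⋀^Fin 3]→L[ℝ] ℝ}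
    (h : φ ![(1, 0), (Complex.I, 0), (0, 1)] = ψ ![(1, 0), (Complex.I, 0), (0, 1)]) : φ = ψ := by
  have h1 := φ.toAlternatingMap.eq_smul_basis_det cylinderBasis
  have h2 := ψ.toAlternatingMap.eq_smul_basis_det cylinderBasis
  refine ContinuousAlternatingMap.toAlternatingMap_injective ?_
  rw [h1, h2, coe_cylinderBasis]
  exact congrArg (· • _) h

theorem two_form_complex_apply (φ : ℂ [⋀^Fin 2]→L[ℝ] ℝ) (u v : ℂ) :
    φ ![u, v] = φ ![1, Complex.I] * (u.re * v.im - v.re * u.im) := by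
  have h1 := φ.toAlternatingMap.eq_smul_basis_det Complex.basisOneI
  have h2 := congrArg (fun ψ => ψ ![u, v]) h1
  refine h2.trans ?_
  rw [Complex.coe_basisOneI]
  change φ ![1, Complex.I] * _ = _
  congr 1
  change Complex.basisOneI.det ![u, v] = _
  rw [Module.Basis.det_apply, Matrix.det_fin_two]
  simp [Module.Basis.toMatrix_apply, Complex.basisOneI]

theorem two_form_complex_ext {φ ψ : ℂ [⋀^Fin 2]→L[ℝ] ℝ}
    (h : φ ![1, Complex.I] = ψ ![1, Complex.I]) : φ = ψ :=
  ContinuousAlternatingMap.ext_pair fun u v => by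
    rw [two_form_complex_apply φ, two_form_complex_apply ψ, h]

theorem fderivWithin_alternating_apply {V F : Type*} [NormedAddCommGroup V] [NormedSpace ℝ V]
    [NormedAddCommGroup F] [NormedSpace ℝ F] {k : ℕ} {K : Set V} {x : V}
    (hK : UniqueDiffWithinAt ℝ K x) {ρ : V → V [⋀^Fin k]→L[ℝ] F}
    (h : DifferentiableWithinAt ℝ ρ K x) (z : Fin k → V) (u : V) :
    fderivWithin ℝ (fun y => ρ y z) K x u = fderivWithin ℝ ρ K x u z := by
  rw [(hasFDerivWithinAt_alternating_apply h.hasFDerivWithinAt z).fderivWithin hK]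
  rfl

/-- The 1-form given by a linear functional. -/
abbrev oneForm {V : Type*} [NormedAddCommGroup V] [NormedSpace ℝ V] (l : V →L[ℝ] ℝ) :
    V [⋀^Fin 1]→L[ℝ] ℝ := ContinuousAlternatingMap.ofSubsingleton ℝ V ℝ 0 l

/-- The 2-form `s dx ∧ dy + dt ∧ l` on `ℂ × ℝ`. -/
def cylinderForm (s : ℝ) (l : ℂ →L[ℝ] ℝ) : (ℂ × ℝ) [⋀^Fin 2]→L[ℝ] ℝ :=
  s • wedge (ContinuousLinearMap.mul ℝ ℝ)
      (oneForm (Complex.reCLM.comp (ContinuousLinearMap.fst ℝ ℂ ℝ)))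
      (oneForm (Complex.imCLM.comp (ContinuousLinearMap.fst ℝ ℂ ℝ))) +
    wedge (ContinuousLinearMap.mul ℝ ℝ) (oneForm (ContinuousLinearMap.snd ℝ ℂ ℝ))
      (oneForm (l.comp (ContinuousLinearMap.fst ℝ ℂ ℝ)))

theorem cylinderForm_apply (s : ℝ) (l : ℂ →L[ℝ] ℝ) (u v : ℂ × ℝ) :
    cylinderForm s l ![u, v] =
      s * (u.1.re * v.1.im - v.1.re * u.1.im) + (u.2 * l v.1 - v.2 * l u.1) := by
  simp [cylinderForm, wedge_pair_apply]

theorem contDiffOn_cylinderForm {S : ℂ × ℝ → ℝ} {l : ℂ → ℂ →L[ℝ] ℝ}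
    (hS : ContDiffOn ℝ ∞ S cylinder) (hl : ContDiffOn ℝ ∞ l disk) :
    ContDiffOn ℝ ∞ (fun p => cylinderForm (S p) (l p.1)) cylinder := by
  refine (hS.smul contDiffOn_const).add (contDiffOn_wedge _ contDiffOn_const ?_)
  exact (ContinuousAlternatingMap.ofSubsingletonLIE (ι := Fin 1) (𝕜 := ℝ) (E := ℂ × ℝ) (F := ℝ)
    0).contDiff.comp_contDiffOn
      ((hl.comp contDiff_fst.contDiffOn fun _ hp => hp.1).clm_comp contDiffOn_const)

/-- As `l` does not depend on t, d(dt ∧ l) = −dt ∧ dl, whose coefficient is −curl l. -/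
theorem extDerivWithin_cylinderForm {S : ℂ × ℝ → ℝ} {l : ℂ → ℂ →L[ℝ] ℝ}
    (hS : ContDiffOn ℝ ∞ S cylinder) (hl : ContDiffOn ℝ ∞ l disk) {p : ℂ × ℝ} (hp : p ∈ cylinder) :
    extDerivWithin (fun p => cylinderForm (S p) (l p.1)) cylinder p
      ![(1, 0), (Complex.I, 0), (0, 1)] =
      fderivWithin ℝ S cylinder p (0, 1) - curl l p.1 := by
  have hu := uniqueDiffOn_cylinder p hp
  have hd := (contDiffOn_cylinderForm hS hl).differentiableOn (by simp) p hp
  have hl' : ∀ w : ℂ, ∀ v : ℂ × ℝ, fderivWithin ℝ (fun q : ℂ × ℝ => -l q.1 w) cylinder p v =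
      -fderivWithin ℝ l disk p.1 v.1 w := fun w v => by
    have h1 : HasFDerivWithinAt (fun q : ℂ × ℝ => l q.1) _ cylinder p :=
      (hl.differentiableOn (by simp) p.1 hp.1).hasFDerivWithinAt.comp p
        (hasFDerivWithinAt_fst) fun q hq => hq.1
    have h2 : HasFDerivWithinAt (fun q : ℂ × ℝ => -l q.1 w) _ cylinder p :=
      (h1.clm_apply (hasFDerivWithinAt_const w p cylinder)).neg
    rw [h2.fderivWithin hu]
    simp
  rw [extDerivWithin_two_apply]
  simp only [← fderivWithin_alternating_apply hu hd, cylinderForm_apply]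
  have e := hl'
  simp at e ⊢
  rw [e, e]
  simp [curl]
  ring

end Cylinder

/-! ### Homotopies rel boundary and their construction from 2-forms. -/

section Homotopy
variable {E : Type*} [NormedAddCommGroup E] [NormedSpace ℝ E] [FiniteDimensional ℝ E]
  {G : Type*} [TopologicalSpace G] [ChartedSpace E G] [Group G] [LieGroup 𝓘(ℝ, E) ∞ G]
  {V W : Type*} [NormedAddCommGroup V] [NormedSpace ℝ V] [NormedAddCommGroup W] [NormedSpace ℝ W]
  {B : InvariantInnerProduct E G}

namespace ExtPoint

theorem comap_mul (L : W →L[ℝ] V) (h h' : ExtPoint B V) :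
    (h * h').comap L = h.comap L * h'.comap L := by
  ext v
  · rfl
  · rfl
  · simp only [comap, mul_def, oddBracket, ContinuousAlternatingMap.compContinuousLinearMap_apply,
      ContinuousAlternatingMap.add_apply, ContinuousAlternatingMap.smul_apply,
      ContinuousAlternatingMap.neg_apply, wedge_apply]
    have e : ∀ u : W, L ∘ ![u] = ![L u] := fun u => by ext i; fin_cases i; rfl
    simp only [ContinuousLinearMap.compContinuousAlternatingMap_coe, Function.comp_apply,
      ContinuousAlternatingMap.compContinuousLinearMap_apply, e]
    rfl

theorem comap_two_pair (L : W →L[ℝ] V) (h : ExtPoint B V) (u v : W) :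
    (h.comap L).two ![u, v] = h.two ![L u, L v] := by
  have e : L ∘ ![u, v] = ![L u, L v] := by ext i; fin_cases i <;> rfl
  rw [← e]
  rfl

theorem comap_inv (L : W →L[ℝ] V) (h : ExtPoint B V) : h⁻¹.comap L = (h.comap L)⁻¹ := rfl

end ExtPoint

/-- There are no nonzero 3-forms on the plane, so the 2-form is unconstrained. -/
theorem isNQMap_disk_iff {h : ℂ → ExtPoint B ℂ} :
    IsNQMap disk h ↔ ContMDiffOn 𝓘(ℝ, ℂ) 𝓘(ℝ, E) ∞ (fun x => (h x).body) disk ∧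
      (∀ x ∈ disk, (h x).one = leftMC E disk (fun x => (h x).body) x) ∧
      ContDiffOn ℝ ∞ (fun x => (h x).two) disk := by
  rw [isNQMap_iff uniqueDiffOn_disk disk_subset_closure_interior]
  refine ⟨fun h => ⟨h.1, h.2.1, h.2.2.1⟩, fun h => ⟨h.1, h.2.1, h.2.2, fun x _ => ?_⟩⟩
  rw [three_form_complex_eq_zero (extDerivWithin _ _ _), three_form_complex_eq_zero (_ • _)]

namespace HomotopicRB
variable {a b a' b' c : ℂ → ExtPoint B ℂ}

theorem refl (ha : IsNQMap disk a) : HomotopicRB a a :=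
  ⟨_, ha.comap uniqueDiffOn_disk disk_subset_closure_interior uniqueDiffOn_cylinder
    cylinder_subset_closure_interior (ContinuousLinearMap.fst ℝ ℂ ℝ) fun _ hp => hp.1,
    fun _ _ => rfl, fun _ _ => rfl, fun _ _ _ _ => rfl⟩

theorem mul : HomotopicRB a b → HomotopicRB a' b' → HomotopicRB (a * a') (b * b') :=
  fun ⟨H, h1, h2, h3, h4⟩ ⟨H', h1', h2', h3', h4'⟩ =>
    ⟨H * H', h1.mul uniqueDiffOn_cylinder cylinder_subset_closure_interior h1',
      fun x hx => by simp only [Pi.mul_apply, ExtPoint.comap_mul, h2 x hx, h2' x hx],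
      fun x hx => by simp only [Pi.mul_apply, ExtPoint.comap_mul, h3 x hx, h3' x hx],
      fun x hx t ht => by
        simp only [Pi.mul_apply, ExtPoint.comap_mul, h4 x hx t ht, h4' x hx t ht]⟩

theorem inv : HomotopicRB a b → HomotopicRB a⁻¹ b⁻¹ :=
  fun ⟨H, h1, h2, h3, h4⟩ =>
    ⟨H⁻¹, h1.inv uniqueDiffOn_cylinder cylinder_subset_closure_interior,
      fun x hx => by simp only [Pi.inv_apply, ExtPoint.comap_inv, h2 x hx],
      fun x hx => by simp only [Pi.inv_apply, ExtPoint.comap_inv, h3 x hx],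
      fun x hx t ht => by simp only [Pi.inv_apply, ExtPoint.comap_inv, h4 x hx t ht]⟩

/-- Pointwise multiplication turns h⁻¹ into a homotopy from a a⁻¹ b to a b⁻¹ b, so time is not
reversed. -/
theorem symm (h : HomotopicRB a b) (ha : IsNQMap disk a) (hb : IsNQMap disk b) :
    HomotopicRB b a := by
  simpa using ((refl ha).mul h.inv).mul (refl hb)

/-- The product of the homotopies a ∼ b, b⁻¹ ∼ b⁻¹ and b ∼ c runs from a to c. No concatenation,
hence no smoothing at a junction, is needed. -/
theorem trans (h : HomotopicRB a b) (h' : HomotopicRB b c) (hb : IsNQMap disk b) :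
    HomotopicRB a c := by
  simpa using (h.mul (refl hb).inv).mul h'

theorem isMapHomotopyRB_of {H : ℂ × ℝ → ExtPoint B (ℂ × ℝ)} (h1 : IsNQMap cylinder H)
    (h2 : ∀ x ∈ disk, (H (x, 0)).comap (ContinuousLinearMap.inl ℝ ℂ ℝ) = a x)
    (h3 : ∀ x ∈ disk, (H (x, 1)).comap (ContinuousLinearMap.inl ℝ ℂ ℝ) = b x)
    (h4 : ∀ x ∈ Metric.sphere (0 : ℂ) 1, ∀ t ∈ Set.Icc (0 : ℝ) 1,
      (H (x, t)).comap ((circleTangent x).prodMap (ContinuousLinearMap.id ℝ ℝ)) =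
        (a x).comap ((circleTangent x).comp (ContinuousLinearMap.fst ℝ ℝ ℝ))) :
    IsMapHomotopyRB E (fun x => (a x).body) (fun x => (b x).body) (fun p => (H p).body) where
  smooth := h1.smooth_body
  start x hx := congrArg ExtPoint.body (h2 x hx)
  finish x hx := congrArg ExtPoint.body (h3 x hx)
  boundary x hx t ht := congrArg ExtPoint.body (h4 x hx t ht)

end HomotopicRB

variable (B) in
/-- The coefficient of the pull-back of the Cartan 3-form to `ℂ × ℝ`. -/
def etaDensity (F : ℂ × ℝ → G) (p : ℂ × ℝ) : ℝ :=
  B.form (leftMC E cylinder F p ![(1, 0)])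
    (lieBr E G (leftMC E cylinder F p ![(Complex.I, 0)]) (leftMC E cylinder F p ![(0, 1)]))

theorem etaIntegral_eq (F : ℂ × ℝ → G) :
    etaIntegral B F = ∫ p in cylinder, etaDensity B F p := rfl

theorem contDiffOn_etaDensity {F : ℂ × ℝ → G} (hF : ContMDiffOn 𝓘(ℝ, ℂ × ℝ) 𝓘(ℝ, E) ∞ F cylinder) :
    ContDiffOn ℝ ∞ (etaDensity B F) cylinder := by
  have h : ∀ v : Fin 1 → ℂ × ℝ, ContDiffOn ℝ ∞ (fun p => leftMC E cylinder F p v) cylinder := fun v =>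
    (ContinuousAlternatingMap.apply ℝ (ℂ × ℝ) E v).contDiff.comp_contDiffOn
      (contDiffOn_leftMC uniqueDiffOn_cylinder hF)
  exact (contDiffOn_const.clm_apply (h _)).clm_apply
    ((contDiffOn_const.clm_apply (h _)).clm_apply (h _))

theorem cartanForm_leftMC_basis (F : ℂ × ℝ → G) (p : ℂ × ℝ) :
    ((1 / 12 : ℝ) • cartanForm B (leftMC E cylinder F p)) ![(1, 0), (Complex.I, 0), (0, 1)] =
      1 / 2 * etaDensity B F p := by
  rw [ContinuousAlternatingMap.smul_apply, cartanForm_apply, etaDensity, smul_eq_mul]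
  ring

theorem leftMC_slice {F : ℂ × ℝ → G} (hF : ContMDiffOn 𝓘(ℝ, ℂ × ℝ) 𝓘(ℝ, E) ∞ F cylinder) {x : ℂ}
    (hx : x ∈ disk) {t : ℝ} (ht : t ∈ Set.Icc (0 : ℝ) 1) {f : ℂ → G} (hf : ∀ y ∈ disk, F (y, t) = f y) :
    (leftMC E cylinder F (x, t)).compContinuousLinearMap (ContinuousLinearMap.inl ℝ ℂ ℝ) =
      leftMC E disk f x := by
  have h : HasFDerivWithinAt (fun y : ℂ => (y, t)) (ContinuousLinearMap.inl ℝ ℂ ℝ) disk x :=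
    (hasFDerivAt_prodMk_left x t).hasFDerivWithinAt
  have h1 := leftMC_comp (E := E) (f := F) (K := cylinder) (q := fun y : ℂ => (y, t))
    (uniqueDiffOn_disk x hx) ((hF (x, t) ⟨hx, ht⟩).mdifferentiableWithinAt (by simp))
    h.differentiableWithinAt fun y hy => ⟨hy, ht⟩
  rw [h.fderivWithin (uniqueDiffOn_disk x hx)] at h1
  exact h1.symm.trans (leftMC_congr hf hx)

/-- On the lateral boundary `F` agrees with `f` along rotations of the circle and is constant in
time. The differential is checked on these two directions separately, and linearity does the rest.
-/
theorem leftMC_boundary {f f' : ℂ → G} {F : ℂ × ℝ → G} (hF : IsMapHomotopyRB E f f' F)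
    (hf : ContMDiffOn 𝓘(ℝ, ℂ) 𝓘(ℝ, E) ∞ f disk) {x : ℂ} (hx : x ∈ Metric.sphere (0 : ℂ) 1)
    {t : ℝ} (ht : t ∈ Set.Icc (0 : ℝ) 1) :
    (leftMC E cylinder F (x, t)).compContinuousLinearMap
        ((circleTangent x).prodMap (ContinuousLinearMap.id ℝ ℝ)) =
      (leftMC E disk f x).compContinuousLinearMap
        ((circleTangent x).comp (ContinuousLinearMap.fst ℝ ℝ ℝ)) := by
  have hxd : x ∈ disk := Metric.sphere_subset_closedBall hx
  have hFd := (hF.smooth (x, t) ⟨hxd, ht⟩).mdifferentiableWithinAt (by simp)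
  have hfd := (hf x hxd).mdifferentiableWithinAt (by simp)
  have hxs : ∀ s : ℝ, unitVec s * x ∈ Metric.sphere (0 : ℂ) 1 := fun s => by
    have : ‖x‖ = 1 := by simpa using hx
    simp [norm_unitVec, this]
  have h0 : unitVec 0 * x = x := by simp [unitVec]
  have d1 : HasFDerivWithinAt (fun s : ℝ => unitVec s * x) (circleTangent x) Set.univ 0 := by
    have := (hasDerivAt_unitVec 0).mul_const x
    rw [mul_assoc, h0] at this
    exact this.hasFDerivAt.hasFDerivWithinAt
  have key : ∀ v : ℝ × ℝ, dMap E cylinder (fun y => (F (x, t))⁻¹ * F y) (x, t)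
      (circleTangent x v.1, v.2) = dMap E disk (fun y => (f x)⁻¹ * f y) x (circleTangent x v.1) := by
    intro v
    have e1 : dMap E cylinder (fun y => (F (x, t))⁻¹ * F y) (x, t) (circleTangent x v.1, 0) =
        dMap E disk (fun y => (f x)⁻¹ * f y) x (circleTangent x v.1) := by
      have d2 : HasFDerivWithinAt (fun s : ℝ => (unitVec s * x, t))
          ((circleTangent x).prod 0) Set.univ 0 := d1.prodMk (hasFDerivWithinAt_const t 0 _)
      have c1 := leftMC_comp (E := E) (f := F) (K := cylinder) (q := fun s : ℝ => (unitVec s * x, t))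
        (L := Set.univ) (y := 0) uniqueDiffWithinAt_univ (by simpa only [h0] using hFd)
        d2.differentiableWithinAt
        fun s _ => ⟨Metric.sphere_subset_closedBall (hxs s), ht⟩
      have c2 := leftMC_comp (E := E) (f := f) (K := disk) (q := fun s : ℝ => unitVec s * x)
        (L := Set.univ) (y := 0) uniqueDiffWithinAt_univ (by simpa only [h0] using hfd)
        d1.differentiableWithinAt
        fun s _ => Metric.sphere_subset_closedBall (hxs s)
      have e : (fun s : ℝ => F (unitVec s * x, t)) = fun s => f (unitVec s * x) := by
        ext s
        exact hF.boundary _ (hxs s) t ht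
      rw [e, c2, d2.fderivWithin uniqueDiffWithinAt_univ, d1.fderivWithin uniqueDiffWithinAt_univ]
        at c1
      have := DFunLike.congr_fun c1 ![v.1]
      simp only [h0] at this
      exact this.symm
    have e2 : dMap E cylinder (fun y => (F (x, t))⁻¹ * F y) (x, t) (0, v.2) = 0 := by
      have hu := uniqueDiffOn_Icc (zero_lt_one (α := ℝ)) t ht
      have d2 : HasFDerivWithinAt (fun s : ℝ => (x, s))
          (ContinuousLinearMap.inr ℝ ℂ ℝ) (Set.Icc 0 1) t :=
        (hasFDerivAt_prodMk_right x t).hasFDerivWithinAt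
      have c1 := leftMC_comp (E := E) (f := F) (K := cylinder) (q := fun s : ℝ => (x, s))
        (L := Set.Icc 0 1) (y := t) hu hFd d2.differentiableWithinAt fun s hs => ⟨hxd, hs⟩
      have c2 : leftMC E (Set.Icc (0 : ℝ) 1) (fun s => F (x, s)) t =
          leftMC E (Set.Icc (0 : ℝ) 1) (fun _ => f x) t :=
        leftMC_congr (fun s hs => hF.boundary x hx s hs) ht
      rw [d2.fderivWithin hu, c2] at c1
      have := DFunLike.congr_fun c1 ![v.2]
      refine this.symm.trans ?_
      simp [leftMC, dMap_const]
    have : ((circleTangent x v.1, v.2) : ℂ × ℝ) = (circleTangent x v.1, 0) + (0, v.2) := by simp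
    rw [this, map_add, e1, e2, add_zero]
  ext v
  exact key (v 0)

/-- A homotopy of maps lifts to a homotopy of NQ-maps with a prescribed primitive of the pull-back of
the Cartan form. -/
theorem homotopicRB_of_primitive {f f' : ℂ → G} {F : ℂ × ℝ → G} (hF : IsMapHomotopyRB E f f' F)
    {S : ℂ × ℝ → ℝ} (hS : ContDiffOn ℝ ∞ S cylinder) {l : ℂ → ℂ →L[ℝ] ℝ}
    (hl : ContDiffOn ℝ ∞ l disk) (hl0 : ∀ z ∈ Metric.sphere (0 : ℂ) 1, l z (Complex.I * z) = 0)
    (hd : ∀ p ∈ cylinder, fderivWithin ℝ S cylinder p (0, 1) = 1 / 2 * etaDensity B F p + curl l p.1)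
    {a b : ℂ → ExtPoint B ℂ} (ha : IsNQMap disk a) (hb : IsNQMap disk b)
    (haf : ∀ x ∈ disk, (a x).body = f x) (hbf : ∀ x ∈ disk, (b x).body = f' x)
    (hSa : ∀ x ∈ disk, S (x, 0) = (a x).two ![1, Complex.I])
    (hSb : ∀ x ∈ disk, S (x, 1) = (b x).two ![1, Complex.I]) : HomotopicRB a b := by
  obtain ⟨a1, a2, a3⟩ := isNQMap_disk_iff.1 ha
  obtain ⟨b1, b2, b3⟩ := isNQMap_disk_iff.1 hb
  have hs := contDiffOn_cylinderForm hS hl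
  have hext : ∀ (φ ψ : (ℝ × ℝ) [⋀^Fin 2]→L[ℝ] ℝ), (∀ u v, φ ![u, v] = ψ ![u, v]) → φ = ψ :=
    fun _ _ => ContinuousAlternatingMap.ext_pair
  refine ⟨fun p => ⟨F p, leftMC E cylinder F p, cylinderForm (S p) (l p.1)⟩,
    (isNQMap_iff uniqueDiffOn_cylinder cylinder_subset_closure_interior).2
      ⟨hF.smooth, fun _ _ => rfl, hs, fun p hp => three_form_cylinder_ext ?_⟩,
    fun x hx => ?_, fun x hx => ?_, fun x hx t ht => ?_⟩
  · rw [extDerivWithin_cylinderForm hS hl hp, cartanForm_leftMC_basis, hd p hp]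
    ring
  · refine ExtPoint.ext ((hF.start x hx).trans (haf x hx).symm) ?_ (two_form_complex_ext ?_)
    · rw [a2 x hx]
      exact leftMC_slice hF.smooth hx (by simp) fun y hy => (hF.start y hy).trans (haf y hy).symm
    · rw [ExtPoint.comap_two_pair]
      refine (cylinderForm_apply _ _ (1, 0) (Complex.I, 0)).trans ?_
      simp [hSa x hx]
  · refine ExtPoint.ext ((hF.finish x hx).trans (hbf x hx).symm) ?_ (two_form_complex_ext ?_)
    · rw [b2 x hx]
      exact leftMC_slice hF.smooth hx (by simp) fun y hy => (hF.finish y hy).trans (hbf y hy).symm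
    · rw [ExtPoint.comap_two_pair]
      refine (cylinderForm_apply _ _ (1, 0) (Complex.I, 0)).trans ?_
      simp [hSb x hx]
  · have hxd : x ∈ disk := Metric.sphere_subset_closedBall hx
    have hf : ContMDiffOn 𝓘(ℝ, ℂ) 𝓘(ℝ, E) ∞ f disk := a1.congr fun y hy => (haf y hy).symm
    refine ExtPoint.ext ((hF.boundary x hx t ht).trans (haf x hxd).symm) ?_ (hext _ _ fun u v => ?_)
    · refine (leftMC_boundary hF hf hx ht).trans ?_
      rw [← leftMC_congr haf hxd, ← a2 x hxd]
      rfl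
    -- The term dt ∧ l vanishes because `l` kills the tangents of the circle, and dx ∧ dy because
    -- those tangents span only a line.
    · have e1 : ∀ r : ℝ, circleTangent x r = r • (Complex.I * x) := fun r => rfl
      rw [ExtPoint.comap_two_pair, ExtPoint.comap_two_pair]
      refine (cylinderForm_apply _ _ (circleTangent x u.1, u.2) (circleTangent x v.1, v.2)).trans ?_
      refine Eq.trans ?_ (two_form_complex_apply _ (circleTangent x u.1) (circleTangent x v.1)).symm
      have e2 : ∀ r r' : ℝ, (r • (Complex.I * x)).re * (r' • (Complex.I * x)).im -
          (r' • (Complex.I * x)).re * (r • (Complex.I * x)).im = 0 := fun r r' => by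
        simp only [Complex.smul_re, Complex.smul_im, smul_eq_mul]
        ring
      simp only [e1, map_smul, hl0 x hx, e2, smul_zero, mul_zero, sub_zero, add_zero]
end Homotopy

/-! ### Stokes' theorem on the cylinder and lifting of homotopies. -/

section Stokes
variable {E : Type*} [NormedAddCommGroup E] [NormedSpace ℝ E] [FiniteDimensional ℝ E]
  {G : Type*} [TopologicalSpace G] [ChartedSpace E G] [Group G] [LieGroup 𝓘(ℝ, E) ∞ G]
  {B : InvariantInnerProduct E G} {a b : ℂ → ExtPoint B ℂ}

theorem hasDerivWithinAt_vertical {F : Type*} [NormedAddCommGroup F] [NormedSpace ℝ F]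
    {g : ℂ × ℝ → F} (hg : DifferentiableOn ℝ g cylinder) {z : ℂ} (hz : z ∈ disk) {t : ℝ}
    (ht : t ∈ Set.Icc (0 : ℝ) 1) :
    HasDerivWithinAt (fun s => g (z, s)) (fderivWithin ℝ g cylinder (z, t) (0, 1))
      (Set.Icc 0 1) t := by
  have h := (hg (z, t) ⟨hz, ht⟩).hasFDerivWithinAt.comp t
    (hasFDerivAt_prodMk_right z t).hasFDerivWithinAt
    (fun s hs => ⟨hz, hs⟩ : Set.MapsTo (fun s : ℝ => (z, s)) (Set.Icc 0 1) cylinder)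
  refine HasDerivWithinAt.congr_deriv (f := fun s => g (z, s)) h.hasDerivWithinAt ?_
  simp

theorem fderivWithin_vertical {g : ℂ × ℝ → ℝ} (hg : DifferentiableOn ℝ g cylinder) {p : ℂ × ℝ}
    (hp : p ∈ cylinder) {g' : ℝ}
    (h : HasDerivWithinAt (fun s => g (p.1, s)) g' (Set.Icc 0 1) p.2) :
    fderivWithin ℝ g cylinder p (0, 1) = g' :=
  (uniqueDiffOn_Icc zero_lt_one p.2 hp.2).eq_deriv _ (hasDerivWithinAt_vertical hg hp.1 hp.2) h

theorem integral_vertical {g : ℂ × ℝ → ℝ} (hg : ContDiffOn ℝ ∞ g cylinder) {z : ℂ} (hz : z ∈ disk) :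
    ∫ t in Set.Icc (0 : ℝ) 1, fderivWithin ℝ g cylinder (z, t) (0, 1) = g (z, 1) - g (z, 0) := by
  have hd := fun t (ht : t ∈ Set.Icc (0 : ℝ) 1) =>
    hasDerivWithinAt_vertical (hg.differentiableOn (by simp)) hz ht
  rw [integral_Icc_eq_integral_Ioc, ← intervalIntegral.integral_of_le zero_le_one]
  refine intervalIntegral.integral_eq_sub_of_hasDerivAt_of_le (f := fun t => g (z, t)) zero_le_one
    (fun t ht => (hd t ht).continuousWithinAt)
    (fun t ht => (hd t ⟨ht.1.le, ht.2.le⟩).hasDerivAt (Icc_mem_nhds ht.1 ht.2)) ?_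
  exact intervalIntegrable_slice (K := disk) (g := fun p => fderivWithin ℝ g cylinder p (0, 1))
    ((hg.continuousOn_fderivWithin uniqueDiffOn_cylinder (by simp)).clm_apply continuousOn_const) hz

theorem integrableOn_cylinder {g : ℂ × ℝ → ℝ} (hg : ContinuousOn g cylinder) :
    IntegrableOn g cylinder := hg.integrableOn_compact isCompact_cylinder

theorem integral_cylinder {g : ℂ × ℝ → ℝ} (hg : ContinuousOn g cylinder) :
    ∫ p in cylinder, g p = ∫ z in disk, ∫ t in Set.Icc (0 : ℝ) 1, g (z, t) :=
  setIntegral_prod g (integrableOn_cylinder hg)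

theorem integral_cylinder_symm {g : ℂ × ℝ → ℝ} (hg : ContinuousOn g cylinder) :
    ∫ p in cylinder, g p = ∫ t in Set.Icc (0 : ℝ) 1, ∫ z in disk, g (z, t) := by
  have h := integrableOn_cylinder hg
  rw [IntegrableOn, cylinder, Measure.volume_eq_prod, ← Measure.prod_restrict] at h
  rw [cylinder, Measure.volume_eq_prod, ← Measure.prod_restrict, integral_prod_symm _ h]

/-- Stokes' theorem for 2-forms on the cylinder that vanish on the lateral boundary. -/
theorem integral_extDerivWithin_cylinder {τ : ℂ × ℝ → (ℂ × ℝ) [⋀^Fin 2]→L[ℝ] ℝ}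
    (hτ : ContDiffOn ℝ ∞ τ cylinder)
    (h0 : ∀ z ∈ Metric.sphere (0 : ℂ) 1, ∀ t ∈ Set.Icc (0 : ℝ) 1,
      τ (z, t) ![(Complex.I * z, 0), (0, 1)] = 0) :
    ∫ p in cylinder, extDerivWithin τ cylinder p ![(1, 0), (Complex.I, 0), (0, 1)] =
      ∫ z in disk, (τ (z, 1) ![(1, 0), (Complex.I, 0)] - τ (z, 0) ![(1, 0), (Complex.I, 0)]) := by
  have hτ' : ∀ v : Fin 2 → ℂ × ℝ, ContDiffOn ℝ ∞ (fun p => τ p v) cylinder := fun v =>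
    (ContinuousAlternatingMap.apply ℝ (ℂ × ℝ) ℝ v).contDiff.comp_contDiffOn hτ
  have hD : ∀ (v : Fin 2 → ℂ × ℝ) (w : ℂ × ℝ),
      ContinuousOn (fun p => fderivWithin ℝ (fun p => τ p v) cylinder p w) cylinder := fun v w =>
    ((hτ' v).continuousOn_fderivWithin uniqueDiffOn_cylinder (by simp)).clm_apply continuousOn_const
  have e : ∀ p ∈ cylinder, extDerivWithin τ cylinder p ![(1, 0), (Complex.I, 0), (0, 1)] =
      (fderivWithin ℝ (fun p => τ p ![(Complex.I, 0), (0, 1)]) cylinder p (1, 0) -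
        fderivWithin ℝ (fun p => τ p ![(1, 0), (0, 1)]) cylinder p (Complex.I, 0)) +
      fderivWithin ℝ (fun p => τ p ![(1, 0), (Complex.I, 0)]) cylinder p (0, 1) := fun p hp => by
    have hu := uniqueDiffOn_cylinder p hp
    have hd := hτ.differentiableOn (by simp) p hp
    rw [extDerivWithin_two_apply]
    simp only [fderivWithin_alternating_apply hu hd]
  -- At fixed time the horizontal terms are the curl of w ↦ τ((w, 0), (0, 1)), which vanishes on
  -- boundary tangents by assumption, so Green's theorem gives zero. The remaining term is a time
  -- derivative.
  have hcurl : ∀ t ∈ Set.Icc (0 : ℝ) 1, ∫ z in disk,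
      (fderivWithin ℝ (fun p => τ p ![(Complex.I, 0), (0, 1)]) cylinder (z, t) (1, 0) -
        fderivWithin ℝ (fun p => τ p ![(1, 0), (0, 1)]) cylinder (z, t) (Complex.I, 0)) = 0 := by
    intro t ht
    set l : ℂ → ℂ →L[ℝ] ℝ := fun z => τ (z, t) ![(1, 0), (0, 1)] • Complex.reCLM +
      τ (z, t) ![(Complex.I, 0), (0, 1)] • Complex.imCLM with hl
    have hsl : ∀ v : Fin 2 → ℂ × ℝ, ContDiffOn ℝ 1 (fun z => τ (z, t) v) disk := fun v =>
      ((hτ' v).of_le (by simp)).comp (contDiff_prodMk_left t).contDiffOn fun z hz => ⟨hz, ht⟩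
    have hlc : ContDiffOn ℝ 1 l disk :=
      ((hsl _).smul contDiffOn_const).add ((hsl _).smul contDiffOn_const)
    have h1 : ∫ z in disk, curl l z = 0 := by
      rw [integral_curl hlc]
      refine intervalIntegral.integral_zero_ae (Filter.Eventually.of_forall fun s _ => ?_)
      have h2 := h0 (unitVec s) (by simp [norm_unitVec]) t ht
      set w := Complex.I * unitVec s with hw
      have h3 : ((w, 0) : ℂ × ℝ) = w.re • ((1 : ℂ), (0 : ℝ)) + w.im • (Complex.I, (0 : ℝ)) := by
        simp
      have h4 := (τ (unitVec s, t)).map_update_add ![(w, 0), (0, 1)] 0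
        (w.re • ((1 : ℂ), (0 : ℝ))) (w.im • (Complex.I, (0 : ℝ)))
      have h5 := (τ (unitVec s, t)).map_update_smul ![(w, 0), (0, 1)] 0 w.re ((1 : ℂ), (0 : ℝ))
      have h6 := (τ (unitVec s, t)).map_update_smul ![(w, 0), (0, 1)] 0 w.im (Complex.I, (0 : ℝ))
      have h7 : ∀ u v w : ℂ × ℝ, Function.update ![u, v] 0 w = ![w, v] := fun u v w => by
        ext i : 1; fin_cases i <;> rfl
      simp only [h7] at h4 h5 h6
      rw [← h3, h2, h5, h6] at h4
      simp only [hl, _root_.add_apply, _root_.smul_apply, Complex.reCLM_apply, Complex.imCLM_apply,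
        smul_eq_mul] at h4 ⊢
      linarith
    refine Eq.trans ?_ h1
    refine setIntegral_congr_fun isCompact_disk.measurableSet fun z hz => ?_
    have hs : ∀ v : Fin 2 → ℂ × ℝ, HasFDerivWithinAt (fun y => τ (y, t) v)
        ((fderivWithin ℝ (fun p => τ p v) cylinder (z, t)).comp (ContinuousLinearMap.inl ℝ ℂ ℝ))
        disk z := fun v =>
      hasFDerivWithinAt_slice (g := fun p => τ p v) ((hτ' v).differentiableOn (by simp)) hz ht
    have h3 : HasFDerivWithinAt l _ disk z :=
      ((hs ![(1, 0), (0, 1)]).smul_const Complex.reCLM).add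
        ((hs ![(Complex.I, 0), (0, 1)]).smul_const Complex.imCLM)
    simp only [curl]
    rw [h3.fderivWithin (uniqueDiffOn_disk z hz)]
    simp
  rw [setIntegral_congr_fun isCompact_cylinder.measurableSet e,
    integral_add (integrableOn_cylinder ((hD _ _).fun_sub (hD _ _))) (integrableOn_cylinder (hD _ _)),
    integral_cylinder_symm ((hD _ _).fun_sub (hD _ _)), integral_cylinder (hD _ _),
    setIntegral_congr_fun measurableSet_Icc hcurl, integral_zero, zero_add]
  exact setIntegral_congr_fun isCompact_disk.measurableSet fun z hz => integral_vertical (hτ' _) hz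

theorem integrableOn_two (ha : IsNQMap disk a) :
    IntegrableOn (fun x => (a x).two ![1, Complex.I]) disk :=
  ((ContinuousAlternatingMap.apply ℝ ℂ ℝ ![1, Complex.I]).continuous.comp_continuousOn
    ha.smooth_two.continuousOn).integrableOn_compact isCompact_disk

/-- The bodies of homotopic NQ-maps are homotopic, and the integrals of the 2-forms differ by the
integral of the Cartan form over the homotopy. -/
theorem HomotopicRB.exists_isMapHomotopyRB (ha : IsNQMap disk a) (hb : IsNQMap disk b)
    (h : HomotopicRB a b) :
    ∃ F : ℂ × ℝ → G, IsMapHomotopyRB E (fun x => (a x).body) (fun x => (b x).body) F ∧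
      ∫ x in disk, 2 * (b x).two ![1, Complex.I] =
        (∫ x in disk, 2 * (a x).two ![1, Complex.I]) + etaIntegral B F := by
  obtain ⟨H, h1, h2, h3, h4⟩ := h
  refine ⟨fun p => (H p).body, HomotopicRB.isMapHomotopyRB_of h1 h2 h3 h4, ?_⟩
  obtain ⟨c1, c2, c3, c4⟩ :=
    (isNQMap_iff uniqueDiffOn_cylinder cylinder_subset_closure_interior).1 h1
  -- The rel-boundary condition identifies this lateral component with a 2-form pulled back along
  -- the projection, which sends the time direction to 0.
  have key := integral_extDerivWithin_cylinder c3 fun z hz t ht => by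
    have h5 := congrArg (fun q => q.two ![(1, 0), (0, 1)]) (h4 z hz t ht)
    simp only [ExtPoint.comap_two_pair] at h5
    have e1 : (circleTangent z).prodMap (ContinuousLinearMap.id ℝ ℝ) (1, 0) = (Complex.I * z, 0) := by
      simp [circleTangent]
    have e2 : (circleTangent z).prodMap (ContinuousLinearMap.id ℝ ℝ) (0, 1) = (0, 1) := by simp
    rw [e1, e2] at h5
    rw [h5, two_form_complex_apply]
    simp
  have e : ∀ p ∈ cylinder, extDerivWithin (fun y => (H y).two) cylinder p
      ![(1, 0), (Complex.I, 0), (0, 1)] = 1 / 2 * etaDensity B (fun p => (H p).body) p :=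
    fun p hp => by rw [c4 p hp, cartanForm_leftMC_basis]
  have e0 : ∀ x ∈ disk, (H (x, 1)).two ![(1, 0), (Complex.I, 0)] -
      (H (x, 0)).two ![(1, 0), (Complex.I, 0)] =
      (b x).two ![1, Complex.I] - (a x).two ![1, Complex.I] := fun x hx => by
    rw [← h2 x hx, ← h3 x hx, ExtPoint.comap_two_pair, ExtPoint.comap_two_pair]
    simp
  rw [setIntegral_congr_fun isCompact_cylinder.measurableSet e, integral_const_mul,
    setIntegral_congr_fun isCompact_disk.measurableSet e0,
    integral_sub (integrableOn_two hb) (integrableOn_two ha)] at key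
  rw [integral_const_mul, integral_const_mul, etaIntegral_eq]
  linarith

/-- The 2-form with given coefficient on the plane. -/
def planeForm (s : ℝ) : ℂ [⋀^Fin 2]→L[ℝ] ℝ :=
  s • wedge (ContinuousLinearMap.mul ℝ ℝ) (oneForm Complex.reCLM) (oneForm Complex.imCLM)

theorem planeForm_apply (s : ℝ) : planeForm s ![1, Complex.I] = s := by
  simp [planeForm, wedge_pair_apply]

variable (B) in
/-- The NQ-map with given body and given coefficient of the 2-form. -/
def nqDisk (f : ℂ → G) (s : ℂ → ℝ) (x : ℂ) : ExtPoint B ℂ :=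
  ⟨f x, leftMC E disk f x, planeForm (s x)⟩

theorem isNQMap_nqDisk {f : ℂ → G} (hf : ContMDiffOn 𝓘(ℝ, ℂ) 𝓘(ℝ, E) ∞ f disk) {s : ℂ → ℝ}
    (hs : ContDiffOn ℝ ∞ s disk) : IsNQMap disk (nqDisk B f s) :=
  isNQMap_disk_iff.2 ⟨hf, fun _ _ => rfl, hs.smul contDiffOn_const⟩

theorem contDiffOn_two (ha : IsNQMap disk a) :
    ContDiffOn ℝ ∞ (fun x => (a x).two ![1, Complex.I]) disk :=
  (ContinuousAlternatingMap.apply ℝ ℂ ℝ ![1, Complex.I]).contDiff.comp_contDiffOn ha.smooth_two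

theorem ContMDiffOn.slice {F : ℂ × ℝ → G} (hF : ContMDiffOn 𝓘(ℝ, ℂ × ℝ) 𝓘(ℝ, E) ∞ F cylinder)
    {t : ℝ} (ht : t ∈ Set.Icc (0 : ℝ) 1) :
    ContMDiffOn 𝓘(ℝ, ℂ) 𝓘(ℝ, E) ∞ (fun x => F (x, t)) disk :=
  hF.comp (contDiff_prodMk_left t).contMDiff.contMDiffOn fun _ hx => ⟨hx, ht⟩

/-- Homotopies of the body lift to NQ-maps; the integral of the 2-form changes by the integral of the
Cartan form. -/
theorem exists_homotopicRB (ha : IsNQMap disk a) {f' : ℂ → G} {F : ℂ × ℝ → G}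
    (hF : IsMapHomotopyRB E (fun x => (a x).body) f' F) :
    ∃ b : ℂ → ExtPoint B ℂ, IsNQMap disk b ∧ (∀ x, (b x).body = f' x) ∧ HomotopicRB a b ∧
      ∫ x in disk, 2 * (b x).two ![1, Complex.I] =
        (∫ x in disk, 2 * (a x).two ![1, Complex.I]) + etaIntegral B F := by
  have hη := contDiffOn_etaDensity (B := B) hF.smooth
  -- The time primitive of η over [0, t], rescaled to a fixed interval as t ∫₀¹ η(z, t r) dr, so
  -- that smoothness up to the boundary follows from `contDiffOn_integral`.
  set J : ℂ × ℝ → ℝ := fun p => ∫ r in (0 : ℝ)..1, etaDensity B F (p.1, p.2 * r) with hJdef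
  have hJ : ContDiffOn ℝ ∞ J cylinder := by
    refine contDiffOn_integral uniqueDiffOn_cylinder isCompact_cylinder convex_cylinder
      (g := fun q : (ℂ × ℝ) × ℝ => etaDensity B F (q.1.1, q.1.2 * q.2)) ?_
    refine hη.comp (ContDiff.contDiffOn ((contDiff_fst.comp contDiff_fst).prodMk
      ((contDiff_snd.comp contDiff_fst).mul contDiff_snd))) fun q hq => ⟨hq.1.1, ?_⟩
    exact ⟨mul_nonneg hq.1.2.1 hq.2.1, mul_le_one₀ hq.1.2.2 hq.2.1 hq.2.2⟩
  set S : ℂ × ℝ → ℝ := fun p => (a p.1).two ![1, Complex.I] + 1 / 2 * (p.2 * J p) with hSdef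
  have hS : ContDiffOn ℝ ∞ S cylinder :=
    ((contDiffOn_two ha).comp contDiff_fst.contDiffOn fun _ hp => hp.1).add
      (contDiffOn_const.mul (contDiff_snd.contDiffOn.mul hJ))
  have hf' : ContMDiffOn 𝓘(ℝ, ℂ) 𝓘(ℝ, E) ∞ f' disk :=
    (ContMDiffOn.slice hF.smooth (t := 1) (by simp)).congr fun x hx => (hF.finish x hx).symm
  have hs1 : ContDiffOn ℝ ∞ (fun x => S (x, 1)) disk :=
    hS.comp (contDiff_prodMk_left (1 : ℝ)).contDiffOn fun x hx => ⟨hx, by simp⟩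
  have hb : IsNQMap disk (nqDisk B f' fun x => S (x, 1)) := isNQMap_nqDisk hf' hs1
  refine ⟨_, hb, fun _ => rfl, homotopicRB_of_primitive hF hS (l := fun _ => 0) contDiffOn_const
    (fun _ _ => rfl) (fun p hp => ?_) ha hb (fun _ _ => rfl) (fun _ _ => rfl)
    (fun x _ => by simp [hSdef]) (fun x _ => (planeForm_apply _).symm), ?_⟩
  rotate_left
  · have hJ1 : ContinuousOn (fun x => J (x, 1)) disk :=
      hJ.continuousOn.comp (by fun_prop) fun x hx => ⟨hx, by simp⟩
    have e : ∀ x, 2 * (nqDisk B f' (fun x => S (x, 1)) x).two ![1, Complex.I] =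
        2 * (a x).two ![1, Complex.I] + J (x, 1) := fun x => by
      simp only [nqDisk, planeForm_apply, hSdef]
      ring
    simp only [e]
    rw [integral_add ((integrableOn_two ha).const_mul 2) (hJ1.integrableOn_compact isCompact_disk),
      etaIntegral_eq, integral_cylinder hη.continuousOn]
    simp only [hJdef, one_mul, intervalIntegral.integral_of_le zero_le_one,
      integral_Icc_eq_integral_Ioc]
  refine fderivWithin_vertical (hS.differentiableOn (by simp)) hp ?_
  have hc : ContinuousOn (fun t => etaDensity B F (p.1, t)) (Set.Icc 0 1) :=
    hη.continuousOn.comp (by fun_prop) fun t ht => ⟨hp.1, ht⟩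
  -- The filter instance for the fundamental theorem within `Icc` takes this membership as a `Fact`.
  have : Fact (p.2 ∈ Set.Icc (0 : ℝ) 1) := ⟨hp.2⟩
  have h1 : HasDerivWithinAt (fun t => ∫ r in (0 : ℝ)..t, etaDensity B F (p.1, r))
      (etaDensity B F p) (Set.Icc 0 1) p.2 := by
    refine intervalIntegral.integral_hasDerivWithinAt_right
      (ContinuousOn.intervalIntegrable (hc.mono ?_))
      (hc.stronglyMeasurableAtFilter_nhdsWithin measurableSet_Icc _) (hc p.2 hp.2)
    rw [Set.uIcc_of_le hp.2.1]
    exact Set.Icc_subset_Icc_right hp.2.2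
  have h2 : (fun t => S (p.1, t)) = fun t => (a p.1).two ![1, Complex.I] +
      1 / 2 * ∫ r in (0 : ℝ)..t, etaDensity B F (p.1, r) := by
    ext t
    have := intervalIntegral.mul_integral_comp_mul_left (a := 0) (b := 1)
      (f := fun r => etaDensity B F (p.1, r)) (c := t)
    rw [mul_zero, mul_one] at this
    simp only [hSdef, hJdef, this]
  rw [h2]
  refine ((h1.const_mul (1 / 2)).const_add _).congr_deriv ?_
  simp [curl]

theorem isMapHomotopyRB_const {f f' : ℂ → G} (hf : ContMDiffOn 𝓘(ℝ, ℂ) 𝓘(ℝ, E) ∞ f disk)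
    (h : ∀ x ∈ disk, f x = f' x) : IsMapHomotopyRB E f f' fun p => f p.1 where
  smooth := hf.comp contDiff_fst.contMDiff.contMDiffOn fun _ hp => hp.1
  start _ _ := rfl
  finish x hx := h x hx
  boundary _ _ _ _ := rfl

/-- A homotopy constant in time kills the vertical vector, hence one argument of η. -/
theorem etaDensity_const {f : ℂ → G} (hf : ContMDiffOn 𝓘(ℝ, ℂ) 𝓘(ℝ, E) ∞ f disk) {p : ℂ × ℝ}
    (hp : p ∈ cylinder) : etaDensity B (fun p => f p.1) p = 0 := by
  have hd : HasFDerivWithinAt (fun p : ℂ × ℝ => p.1) (ContinuousLinearMap.fst ℝ ℂ ℝ) cylinder p :=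
    hasFDerivWithinAt_fst
  have h := leftMC_comp (E := E) (f := f) (K := disk) (q := fun p : ℂ × ℝ => p.1)
    (uniqueDiffOn_cylinder p hp) ((hf p.1 hp.1).mdifferentiableWithinAt (by simp))
    hd.differentiableWithinAt fun _ hp => hp.1
  rw [hd.fderivWithin (uniqueDiffOn_cylinder p hp)] at h
  have h0 : leftMC E cylinder (fun p => f p.1) p ![(0, 1)] = 0 := by
    rw [h]
    exact map_zero (dMap E disk (fun y => (f p.1)⁻¹ * f y) p.1)
  rw [etaDensity, h0, map_zero, map_zero]

theorem etaIntegral_const {f : ℂ → G} (hf : ContMDiffOn 𝓘(ℝ, ℂ) 𝓘(ℝ, E) ∞ f disk) :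
    etaIntegral B (fun p => f p.1) = 0 := by
  rw [etaIntegral_eq, setIntegral_congr_fun isCompact_cylinder.measurableSet
    fun p hp => etaDensity_const hf hp, integral_zero]

/-- NQ-maps with the same body and the same integral of the 2-form are homotopic. -/
theorem homotopicRB_of_integral_eq (ha : IsNQMap disk a) (hb : IsNQMap disk b)
    (hab : ∀ x ∈ disk, (a x).body = (b x).body)
    (hi : ∫ x in disk, (a x).two ![1, Complex.I] = ∫ x in disk, (b x).two ![1, Complex.I]) :
    HomotopicRB a b := by
  have hk := (contDiffOn_two hb).sub (contDiffOn_two ha)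
  obtain ⟨l, hl, hlk, hl0⟩ := exists_curl_eq hk (by
    rw [integral_sub (integrableOn_two hb) (integrableOn_two ha), hi, sub_self])
  -- The coefficients are interpolated linearly in time. Their time derivative is the difference of
  -- the two, which is the curl of `l`.
  set S : ℂ × ℝ → ℝ := fun p => (a p.1).two ![1, Complex.I] +
    p.2 * ((b p.1).two ![1, Complex.I] - (a p.1).two ![1, Complex.I]) with hSdef
  have hS : ContDiffOn ℝ ∞ S cylinder :=
    ((contDiffOn_two ha).comp contDiff_fst.contDiffOn fun _ hp => hp.1).add
      (contDiff_snd.contDiffOn.mul (hk.comp contDiff_fst.contDiffOn fun _ hp => hp.1))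
  refine homotopicRB_of_primitive (isMapHomotopyRB_const ha.smooth_body hab) hS hl hl0
    (fun p hp => ?_) ha hb (fun _ _ => rfl) (fun _ _ => rfl) (fun x _ => by simp [hSdef])
    (fun x _ => by simp [hSdef])
  refine fderivWithin_vertical (hS.differentiableOn (by simp)) hp ?_
  rw [etaDensity_const ha.smooth_body hp, mul_zero, zero_add, hlk _ hp.1]
  have := (((hasDerivAt_id p.2).mul_const ((b p.1).two ![1, Complex.I] -
    (a p.1).two ![1, Complex.I])).const_add ((a p.1).two ![1, Complex.I])).hasDerivWithinAt
      (s := Set.Icc 0 1)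
  rw [one_mul] at this
  exact this

end Stokes

/-! ### Comparison of homotopy classes of NQ-maps with the loop group extension. -/

section Comparison
variable {E : Type*} [NormedAddCommGroup E] [NormedSpace ℝ E] [FiniteDimensional ℝ E]
  {G : Type*} [TopologicalSpace G] [ChartedSpace E G] [Group G] [LieGroup 𝓘(ℝ, E) ∞ G]
  {B : InvariantInnerProduct E G}

theorem conGen_iff_of_equivalence {M : Type*} [Mul M] {r : M → M → Prop} (h : Equivalence r)
    (hm : ∀ {w x y z}, r w x → r y z → r (w * y) (x * z)) (x y : M) : conGen r x y ↔ r x y :=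
  have e : conGen r = ⟨⟨r, h⟩, hm⟩ := Con.conGen_of_con ⟨⟨r, h⟩, hm⟩
  iff_of_eq (congrArg (fun c : Con M => c x y) e)

theorem mem_NQDisks {a : ℂ → ExtPoint B ℂ} : a ∈ NQDisks B ↔ IsNQMap disk a := by
  refine ⟨fun h => ?_, fun h => Subgroup.subset_closure h⟩
  induction h using Subgroup.closure_induction with
  | mem _ h => exact h
  | one => exact IsNQMap.one uniqueDiffOn_disk disk_subset_closure_interior
  | mul _ _ _ _ h h' => exact h.mul uniqueDiffOn_disk disk_subset_closure_interior h'
  | inv _ _ h => exact h.inv uniqueDiffOn_disk disk_subset_closure_interior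

/-- The integral `2 ∫ s` of the 2-form of an NQ-map. -/
def twoIntegral (a : ℂ → ExtPoint B ℂ) : ℝ := ∫ x in disk, 2 * (a x).two ![1, Complex.I]

theorem twoIntegral_one : twoIntegral (1 : ℂ → ExtPoint B ℂ) = 0 := by
  simp [twoIntegral, ExtPoint.one_def]

theorem twoIntegral_inv (a : ℂ → ExtPoint B ℂ) : twoIntegral a⁻¹ = -twoIntegral a := by
  simp [twoIntegral, ExtPoint.inv_def, integral_neg]

/-- Doubling −⟨Ad(g⁻¹) f^*θ_l ∧ g^*θ_l⟩/2 and applying Ad(g) to both factors gives −⟨f^*θ_l ∧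
g^*θ_r⟩. -/
theorem twoIntegral_mul {a b : ℂ → ExtPoint B ℂ} (ha : IsNQMap disk a) (hb : IsNQMap disk b) :
    twoIntegral (a * b) = twoIntegral a + twoIntegral b +
      -cocycle B (fun x => (a x).body) (fun x => (b x).body) := by
  obtain ⟨a1, a2, a3⟩ := isNQMap_disk_iff.1 ha
  obtain ⟨b1, b2, b3⟩ := isNQMap_disk_iff.1 hb
  have ia := (integrableOn_two ha).const_mul 2
  have ib := (integrableOn_two hb).const_mul 2
  unfold twoIntegral cocycle
  rw [← sub_eq_add_neg, ← integral_add ia ib, ← integral_sub (ia.fun_add ib) (integrable_cocycle B a1 b1)]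
  refine setIntegral_congr_fun isCompact_disk.measurableSet fun x hx => ?_
  have h1 := B.wedge_Ad (b x).body ((Ad E (b x).body⁻¹).compContinuousAlternatingMap (a x).one)
    (b x).one
  rw [← ExtPoint.Ad_mul_comp, mul_inv_cancel, ExtPoint.Ad_one_comp] at h1
  rw [rightMC_eq (uniqueDiffOn_disk x hx) ((b1 x hx).mdifferentiableWithinAt (by simp)),
    ← a2 x hx, ← b2 x hx, h1]
  simp only [Pi.mul_apply, ExtPoint.mul_def, oddBracket, ContinuousAlternatingMap.add_apply,
    ContinuousAlternatingMap.smul_apply, ContinuousAlternatingMap.neg_apply, smul_eq_mul]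
  ring

variable (B) in
/-- The homomorphism `f exp(α + s) ↦ (f, 2 ∫ s)`. -/
def toDiskPair : NQDisks B →* DiskPair B where
  toFun a := ⟨⟨fun x => ((a : ℂ → ExtPoint B ℂ) x).body, (mem_NQDisks.1 a.2).smooth_body⟩,
    (twoIntegral (a : ℂ → ExtPoint B ℂ) : ℝ ⧸ periods B)⟩
  map_one' := DiskPair.ext rfl (congrArg ((↑) : ℝ → ℝ ⧸ periods B) twoIntegral_one)
  map_mul' a b := DiskPair.ext rfl
    (congrArg ((↑) : ℝ → ℝ ⧸ periods B) (twoIntegral_mul (mem_NQDisks.1 a.2) (mem_NQDisks.1 b.2)))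

theorem exists_twoIntegral_eq {f : ℂ → G} (hf : f ∈ SmoothDisks E G) (r : ℝ) :
    ∃ a : ℂ → ExtPoint B ℂ, IsNQMap disk a ∧ (∀ x, (a x).body = f x) ∧ twoIntegral a = r := by
  -- A constant 2-form has any prescribed integral, since the disk has positive area.
  refine ⟨nqDisk B f fun _ => r / (2 * volume.real disk), isNQMap_nqDisk hf contDiffOn_const,
    fun _ => rfl, ?_⟩
  have h : volume.real disk ≠ 0 := by
    rw [disk, Measure.real, Complex.volume_closedBall]
    simp [Real.pi_pos.ne']
  simp only [twoIntegral, nqDisk, planeForm_apply, setIntegral_const, smul_eq_mul]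
  field_simp

theorem toDiskPair_surjective : Function.Surjective (toDiskPair B) := fun p => by
  obtain ⟨r, hr⟩ := QuotientAddGroup.mk_surjective p.phase
  obtain ⟨a, ha, hf, hi⟩ := exists_twoIntegral_eq (B := B) p.map.2 r
  refine ⟨⟨a, mem_NQDisks.2 ha⟩, DiskPair.ext (Subtype.ext (funext hf)) ?_⟩
  rw [← hr, ← hi]
  rfl

/-- Phases are known only modulo periods, while integrals of 2-forms are real numbers; these maps
absorb the difference within a homotopy class. A generator comes from lifting a spherical homotopy
that starts at 1. Sums and negatives are products and inverses, because the cocycle vanishes on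
trivial bodies. -/
theorem exists_of_mem_periods {r : ℝ} (hr : r ∈ periods B) :
    ∃ a : ℂ → ExtPoint B ℂ, IsNQMap disk a ∧ (∀ x, (a x).body = 1) ∧ HomotopicRB 1 a ∧
      twoIntegral a = r := by
  have h1 : IsNQMap disk (1 : ℂ → ExtPoint B ℂ) :=
    IsNQMap.one uniqueDiffOn_disk disk_subset_closure_interior
  induction hr using AddSubgroup.closure_induction with
  | mem r h =>
    obtain ⟨F, hF, rfl⟩ := h
    obtain ⟨b, hb, hbf, hab, hi⟩ := exists_homotopicRB h1 (f' := 1) hF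
    refine ⟨b, hb, hbf, hab, hi.trans ?_⟩
    exact (congrArg (· + _) twoIntegral_one).trans (zero_add _)
  | zero => exact ⟨1, h1, fun _ => rfl, .refl h1, twoIntegral_one⟩
  | add r r' _ _ h h' =>
    obtain ⟨a, ha, haf, h1a, rfl⟩ := h
    obtain ⟨b, hb, hbf, h1b, rfl⟩ := h'
    refine ⟨a * b, ha.mul uniqueDiffOn_disk disk_subset_closure_interior hb, fun x => ?_,
      by simpa using h1a.mul h1b, ?_⟩
    · simp [ExtPoint.mul_def, haf, hbf]
    · have : (fun x => (a x).body) = 1 := funext haf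
      rw [twoIntegral_mul ha hb, this, cocycle_one_left, neg_zero, add_zero]
  | neg r _ h =>
    obtain ⟨a, ha, haf, h1a, rfl⟩ := h
    refine ⟨a⁻¹, ha.inv uniqueDiffOn_disk disk_subset_closure_interior, fun x => ?_,
      by simpa using h1a.inv, twoIntegral_inv a⟩
    simp [ExtPoint.inv_def, haf]

/-- The heart of the comparison: `toDiskPair` both preserves and reflects the two relations. -/
theorem rel_toDiskPair_iff {a b : NQDisks B} :
    DiskPair.Rel (toDiskPair B a) (toDiskPair B b) ↔
      HomotopicRB (a : ℂ → ExtPoint B ℂ) b := by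
  have ha := mem_NQDisks.1 a.2
  have hb := mem_NQDisks.1 b.2
  constructor
  · rintro ⟨F, hF, hp⟩
    obtain ⟨b', hb', hbf, hab, hi⟩ := exists_homotopicRB ha hF
    change twoIntegral b' = twoIntegral (a : ℂ → ExtPoint B ℂ) + etaIntegral B F at hi
    have hp' : ((twoIntegral (b : ℂ → ExtPoint B ℂ) : ℝ) : ℝ ⧸ periods B) =
        ((twoIntegral b' : ℝ) : ℝ ⧸ periods B) := by
      rw [hi]
      exact hp
    -- The lifted end b' matches b only up to a period in the integral. Multiplying by `c` removes
    -- this discrepancy without changing the body or the homotopy class.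
    obtain ⟨c, hc, hcf, h1c, hci⟩ := exists_of_mem_periods (QuotientAddGroup.eq.1 hp'.symm)
    have hbc := hb'.mul uniqueDiffOn_disk disk_subset_closure_interior hc
    have h1 : HomotopicRB (a : ℂ → ExtPoint B ℂ) (b' * c) := by simpa using hab.mul h1c
    refine h1.trans (homotopicRB_of_integral_eq hbc hb (fun x _ => ?_) ?_) hbc
    · simp only [Pi.mul_apply, ExtPoint.mul_def, hcf, mul_one, hbf]
      rfl
    · have h2 : twoIntegral (b' * c) = twoIntegral (b : ℂ → ExtPoint B ℂ) := by
        have : (fun x => (c x).body) = 1 := funext hcf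
        rw [twoIntegral_mul hb' hc, this, cocycle_one_right, hci]
        ring
      simpa only [twoIntegral, integral_const_mul, mul_right_inj' (two_ne_zero (α := ℝ))] using h2
  · intro h
    obtain ⟨F, hF, hi⟩ := h.exists_isMapHomotopyRB ha hb
    exact ⟨F, hF, congrArg _ hi⟩

theorem diskCon_iff {a b : NQDisks B} :
    diskCon B a b ↔ HomotopicRB (a : ℂ → ExtPoint B ℂ) b :=
  conGen_iff_of_equivalence
    ⟨fun a => .refl (mem_NQDisks.1 a.2),
      fun {a b} h => h.symm (mem_NQDisks.1 a.2) (mem_NQDisks.1 b.2),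
      fun {_ b _} h h' => h.trans h' (mem_NQDisks.1 b.2)⟩ (fun h h' => h.mul h') a b

/-- Every pair comes from an NQ-map, so ∼ inherits the congruence properties of homotopy through
`rel_toDiskPair_iff`; additivity of ∫F^*η under composing or multiplying homotopies is never
computed. -/
theorem loopCon_iff {p q : DiskPair B} : loopCon B p q ↔ DiskPair.Rel p q := by
  refine conGen_iff_of_equivalence ⟨fun p => ?_, fun {p q} h => ?_, fun {p q r} h h' => ?_⟩
    (fun {p q r s} h h' => ?_) p q
  · obtain ⟨a, rfl⟩ := toDiskPair_surjective p
    exact rel_toDiskPair_iff.2 (.refl (mem_NQDisks.1 a.2))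
  · obtain ⟨a, rfl⟩ := toDiskPair_surjective p
    obtain ⟨b, rfl⟩ := toDiskPair_surjective q
    exact rel_toDiskPair_iff.2
      ((rel_toDiskPair_iff.1 h).symm (mem_NQDisks.1 a.2) (mem_NQDisks.1 b.2))
  · obtain ⟨a, rfl⟩ := toDiskPair_surjective p
    obtain ⟨b, rfl⟩ := toDiskPair_surjective q
    obtain ⟨c, rfl⟩ := toDiskPair_surjective r
    exact rel_toDiskPair_iff.2
      ((rel_toDiskPair_iff.1 h).trans (rel_toDiskPair_iff.1 h') (mem_NQDisks.1 b.2))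
  · obtain ⟨a, rfl⟩ := toDiskPair_surjective p
    obtain ⟨b, rfl⟩ := toDiskPair_surjective q
    obtain ⟨c, rfl⟩ := toDiskPair_surjective r
    obtain ⟨d, rfl⟩ := toDiskPair_surjective s
    rw [← map_mul, ← map_mul]
    exact rel_toDiskPair_iff.2 ((rel_toDiskPair_iff.1 h).mul (rel_toDiskPair_iff.1 h'))

theorem loopCon_toDiskPair_iff {a b : NQDisks B} :
    loopCon B (toDiskPair B a) (toDiskPair B b) ↔ diskCon B a b :=
  loopCon_iff.trans (rel_toDiskPair_iff.trans diskCon_iff.symm)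

variable (B) in
/-- The homomorphism on classes induced by `f exp(α + s) ↦ (f, 2 ∫ s)`. -/
def classMap : DiskClasses B →* LoopExtension B :=
  Con.lift (diskCon B) ((loopCon B).mk'.comp (toDiskPair B)) fun _ _ h =>
    (Con.ker_rel _).2 ((loopCon B).eq.2 (loopCon_toDiskPair_iff.2 h))

theorem classMap_bijective : Function.Bijective (classMap B) := by
  refine ⟨fun x y => Con.induction_on₂ x y fun a b h => ?_, fun y => Con.induction_on y fun p => ?_⟩
  · exact (diskCon B).eq.2 (loopCon_toDiskPair_iff.1 ((loopCon B).eq.1 h))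
  · obtain ⟨a, rfl⟩ := toDiskPair_surjective p
    exact ⟨a, rfl⟩

/-- The pair may differ from the image of `a` outside the disk. The constant homotopy, along which η
integrates to zero, identifies the two. -/
theorem classMap_eq {a : NQDisks B} {p : DiskPair B}
    (h : ∀ x ∈ disk, (p.map : ℂ → G) x = ((a : ℂ → ExtPoint B ℂ) x).body)
    (hp : p.phase = ((twoIntegral (a : ℂ → ExtPoint B ℂ) : ℝ) : ℝ ⧸ periods B)) :
    classMap B (a : DiskClasses B) = (p : LoopExtension B) := by
  have ha := (mem_NQDisks.1 a.2).smooth_body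
  refine (loopCon B).eq.2 (loopCon_iff.2
    ⟨_, isMapHomotopyRB_const ha fun x hx => (h x hx).symm, ?_⟩)
  have h0 : etaIntegral B (fun p => ((toDiskPair B a).map : ℂ → G) p.1) = 0 := etaIntegral_const ha
  rw [h0, hp, QuotientAddGroup.mk_zero, add_zero]
  rfl

end Comparison

end NQLoop
end

open scoped Manifold ContDiff
open MeasureTheory NQLoop

theorem mainTheorem2 {E : Type*} [NormedAddCommGroup E] [NormedSpace ℝ E] [FiniteDimensional ℝ E]
    {G : Type*} [TopologicalSpace G] [ChartedSpace E G] [Group G] [LieGroup 𝓘(ℝ, E) ∞ G]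
    [T2Space G] [CompactSpace G] (hG : LieAlgebra.IsSimple ℝ (GroupLieAlgebra 𝓘(ℝ, E) G))
    (B : InvariantInnerProduct E G) :
    (∀ a : ℂ → ExtPoint B ℂ, a ∈ NQDisks B ↔ IsNQMap disk a) ∧
    (∀ a b : NQDisks B, diskCon B a b ↔ HomotopicRB (a : ℂ → ExtPoint B ℂ) b) ∧
    (∀ p q : DiskPair B, loopCon B p q ↔ DiskPair.Rel p q) ∧
    ∃ e : DiskClasses B ≃* LoopExtension B,
      (∀ (a : NQDisks B) (p : DiskPair B),
        (∀ x ∈ disk, (p.map : ℂ → G) x = ((a : ℂ → ExtPoint B ℂ) x).body) →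
        p.phase = ((∫ x in disk, 2 * ((a : ℂ → ExtPoint B ℂ) x).two ![1, Complex.I] : ℝ) :
          ℝ ⧸ periods B) →
        e (a : DiskClasses B) = (p : LoopExtension B)) ∧
      (∀ (a : NQDisks B) (z : Circle),
        LoopExtension.toLoop B (e (a : DiskClasses B)) z = ((a : ℂ → ExtPoint B ℂ) z).body) ∧
      (∀ a : NQDisks B,
        (∀ x ∈ disk, ((a : ℂ → ExtPoint B ℂ) x).body = 1 ∧ ((a : ℂ → ExtPoint B ℂ) x).one = 0) →
        e (a : DiskClasses B) = LoopExtension.central B (Multiplicative.ofAdd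
          ((∫ x in disk, 2 * ((a : ℂ → ExtPoint B ℂ) x).two ![1, Complex.I] : ℝ) :
            ℝ ⧸ periods B))) := by
  -- Restriction to loops is compatible by definition, since `toDiskPair` keeps the body. The
  -- central clause is the general formula for a pair whose map is 1.
  refine ⟨fun _ => mem_NQDisks, fun _ _ => diskCon_iff, fun _ _ => loopCon_iff,
    MulEquiv.ofBijective (classMap B) classMap_bijective, fun _ _ => classMap_eq, fun _ _ => rfl,
    fun a h => classMap_eq (p := ⟨1, _⟩) (fun x hx => (h x hx).1.symm) rfl⟩
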